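/- **Setting.** For a compact Hausdorff space $X$ with a continuous action of a torus $\mathbb T^n$ and a real skew symmetric $n\times n$ matrix $\Theta$, let $C(X_\Theta)$ be the $C^*$-algebraic toric deformation of $C(X)$: functions $f_r,g_s$ of degrees $r,s\in\mathbb Z^n$ (that is, $f_r(t\cdot x)=t^r f_r(x)$) are multiplied by $f_r\times g_s=e^{\pi i\,r\cdot\Theta s}f_rg_s$, the involution is complex conjugation, and $C(X_\Theta)$ is the completion of the span of such functions in the norm $\|\sum_r f_r\|=\sup_{x\in X}\|\sum_r f_r(x)U_r\|$, where $(U_r\xi)(s)=e^{\pi i\, r\cdot\Theta s}\xi(s-r)$ on $\ell^2(\mathbb Z^n)$. Tensor products are $C(X_\Theta)\otimes C(Y_{\Theta'})=C((X\times Y)_{\Theta\oplus\Theta'})$. For $\theta\in\mathbb R$, $C(SU(3)_\theta)$ is the deformation of $C(SU(3))$ for the action $(x,s)\cdot g=D(x)^{-1}gD(s)$ of $\mathbb T^2\times\mathbb T^2$, $D(t)=\mathrm{diag}(t_1,t_2,(t_1t_2)^{-1})$, and the matrix $K\oplus(-K)$ with $K=\begin{pmatrix}0&-\theta\\ \theta&0\end{pmatrix}$.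 Its coordinates are $u_{ij}(g)=g_{ij}$, and $A(SU(3)_\theta)$ is the $*$-subalgebra they generate. For a real skew symmetric $6\times 6$ matrix $\theta'$, $C((S^5\times S^5)_{\theta'})$ is the deformation of $C(S^5\times S^5)$, $S^5\times S^5\subset\mathbb C^3\times\mathbb C^3=\mathbb C^6$, for the action $(t\cdot z)_j=t_jz_j$ of $\mathbb T^6$ and the matrix $\theta'$; $A((S^5\times S^5)_{\theta'})$ is its $*$-subalgebra generated by the coordinates $z_1,\dots,z_6$. In particular $z_jz_k=e^{2\pi i\theta'_{jk}}z_kz_j$, $z_jz_k^*=e^{-2\pi i\theta'_{jk}}z_k^*z_j$ and $\sum_{j\le 3}z_jz_j^*=\sum_{j\ge4}z_jz_j^*=1$. A (left) coaction of $H=C(SU(3)_\theta)$, with coproduct $\Delta$ and counit $\epsilon$, on $A=C((S^5\times S^5)_{\theta'})$ is a unital $*$-homomorphism $\delta:A\to H\otimes A$ with $(\Delta\otimes\mathrm{id})\delta=(\mathrm{id}\otimes\delta)\delta$ and $(\epsilon\otimes\mathrm{id})\delta=\mathrm{id}$; $a\in A$ is coinvariant if $\delta(a)=1\otimes a$. **Theorem.**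 Let $\theta,\lambda_1,\lambda_2,\lambda_3\in\mathbb R$ and let $\theta'$ be a real skew symmetric $6\times6$ matrix with $$\theta=-\theta'_{12}=\theta'_{13}=-\theta'_{23}=-\theta'_{45}=\theta'_{46}=-\theta'_{56},$$ $$\lambda_1=\theta'_{14}=\theta'_{25}=\theta'_{36},\quad \lambda_2=\theta'_{15}=\theta'_{26}=\theta'_{34},\quad \lambda_3=\theta'_{16}=\theta'_{24}=\theta'_{35},$$ $$\lambda_1-\lambda_2=-\lambda_1+\lambda_3=\theta.$$ Then there are unital $*$-homomorphisms $\Delta:C(SU(3)_\theta)\to C(SU(3)_\theta)\otimes C(SU(3)_\theta)$ and $\epsilon:C(SU(3)_\theta)\to\mathbb C$ with $\Delta(u_{ij})=\sum_k u_{ik}\otimes u_{kj}$ and $\epsilon(u_{ij})=\delta_{ij}$, and the diagonal map $$\delta(z_s)=\sum_{k=1}^3u_{sk}\otimes z_k,\qquad \delta(z_{s+3})=\sum_{k=1}^3u_{sk}\otimes z_{k+3}\qquad(s=1,2,3)$$ extends to a coaction $\delta$ of $C(SU(3)_\theta)$ on $C((S^5\times S^5)_{\theta'})$, which maps $A((S^5\times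 S^5)_{\theta'})$ into the span of the elementary tensors $h\otimes a$ with $h\in A(SU(3)_\theta)$, $a\in A((S^5\times S^5)_{\theta'})$. Put $w=z_1z_4^*+z_2z_5^*+z_3z_6^*$. The subalgebra of coinvariant elements of $A((S^5\times S^5)_{\theta'})$ is generated as an algebra by $1,w,w^*$, and equally by $1$, $z_1^*z_4+z_2^*z_5+z_3^*z_6$ and $w$; the subalgebra of coinvariant elements of $C((S^5\times S^5)_{\theta'})$ is the norm closure of the algebra generated by $1,w,w^*$. Both are commutative. -/

import Mathlib

open scoped Matrix InnerProductSpace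

noncomputable section

/-! ## The Hilbert space of square-summable families -/

/-- The Hilbert space `ℓ²(I)` of complex square-summable families. -/
abbrev L2 (I : Type) : Type := lp (fun _ : I => ℂ) 2

/-- Bounded operators on `ℓ²(I)`. -/
abbrev BL2 (I : Type) : Type := L2 I →L[ℂ] L2 I

instance BL2.instCStarAlgebra (I : Type) : CStarAlgebra (BL2 I) := inferInstance

instance BL2.instCStarAlgebraMap (X : Type) [TopologicalSpace X] [CompactSpace X] (I : Type) :
    CStarAlgebra C(X, BL2 I) := inferInstance

namespace L2

theorem hasSum_sq {I : Type} (ξ : L2 I) : HasSum (fun i => ‖ξ i‖ ^ 2) (‖ξ‖ ^ 2) := by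
  have h := lp.hasSum_norm (p := 2) (by norm_num) ξ
  simpa using h

theorem memlp {I : Type} {f : I → ℂ} (hf : Summable fun i => ‖f i‖ ^ 2) :
    Memℓp f 2 := memℓp_gen (by simpa using hf)

theorem norm_le {I : Type} {ξ : L2 I} {c : ℝ} (hc : 0 ≤ c)
    (h : ∑' i, ‖ξ i‖ ^ 2 ≤ c ^ 2) : ‖ξ‖ ≤ c := by
  rw [(hasSum_sq ξ).tsum_eq] at h
  exact le_of_sq_le_sq h hc

/-- The slice `i ↦ ξ (i, q)` of a vector `ξ ∈ ℓ²(K)`, where `K` is identified with `I × J`. -/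
def slice {I J K : Type} (e : K ≃ I × J) (q : J) (ξ : L2 K) : L2 I :=
  ⟨fun i => ξ (e.symm (i, q)), memlp ((hasSum_sq ξ).summable.comp_injective (by
    intro a b h
    simpa using h))⟩

theorem slice_apply {I J K : Type} (e : K ≃ I × J) (q : J) (ξ : L2 K) (i : I) :
    slice e q ξ i = ξ (e.symm (i, q)) := rfl

theorem slice_ext {I J K : Type} (e : K ≃ I × J) {ξ η : L2 K}
    (h : ∀ q, slice e q ξ = slice e q η) : ξ = η := by
  apply lp.ext
  funext k
  have := congrArg (fun v : L2 I => v (e k).1) (h (e k).2)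
  simpa [slice_apply] using this

theorem hasSum_slice {I J K : Type} (e : K ≃ I × J) (ξ : L2 K) :
    HasSum (fun q => ‖slice e q ξ‖ ^ 2) (‖ξ‖ ^ 2) := by
  have h1 : HasSum (fun p : J × I => ‖ξ (e.symm (p.2, p.1))‖ ^ 2) (‖ξ‖ ^ 2) :=
    (((Equiv.prodComm J I).trans e.symm).hasSum_iff (f := fun k => ‖ξ k‖ ^ 2)).2 (hasSum_sq ξ)
  exact h1.prod_fiberwise fun q => hasSum_sq (slice e q ξ)

theorem amp_memlp {I J K : Type} (e : K ≃ I × J) (T : BL2 I) (ξ : L2 K) :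
    HasSum (fun k => ‖T (slice e (e k).2 ξ) (e k).1‖ ^ 2)
      (∑' q, ‖T (slice e q ξ)‖ ^ 2) := by
  have hs : Summable fun q => ‖T (slice e q ξ)‖ ^ 2 := by
    refine Summable.of_nonneg_of_le (fun q => by positivity) (fun q => ?_)
      ((hasSum_slice e ξ).summable.mul_left (‖T‖ ^ 2))
    rw [← mul_pow]
    gcongr
    exact T.le_opNorm _
  have hp : HasSum (fun p : J × I => ‖T (slice e p.1 ξ) p.2‖ ^ 2)
      (∑' q, ‖T (slice e q ξ)‖ ^ 2) := by
    have hsum : Summable fun p : J × I => ‖T (slice e p.1 ξ) p.2‖ ^ 2 := by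
      rw [summable_prod_of_nonneg (fun p => by positivity)]
      refine ⟨fun q => (hasSum_sq (T (slice e q ξ))).summable, ?_⟩
      simpa only [(hasSum_sq (T (slice e _ ξ))).tsum_eq] using hs
    have := hsum.hasSum
    rwa [hsum.tsum_prod' fun q => (hasSum_sq (T (slice e q ξ))).summable,
      tsum_congr fun q => (hasSum_sq (T (slice e q ξ))).tsum_eq] at this
  exact ((e.trans (Equiv.prodComm I J)).hasSum_iff
    (f := fun p : J × I => ‖T (slice e p.1 ξ) p.2‖ ^ 2)).2 hp

/-- The amplification `T ⊗ 1` on `ℓ²(K) = ℓ²(I) ⊗ ℓ²(J)` of a bounded operator `T` on `ℓ²(I)`;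
the identification `K ≃ I × J` is part of the data. -/
def amp {I J K : Type} (e : K ≃ I × J) (T : BL2 I) : BL2 K :=
  LinearMap.mkContinuous
    { toFun := fun ξ => ⟨fun k => T (slice e (e k).2 ξ) (e k).1,
        memlp (amp_memlp e T ξ).summable⟩
      map_add' := by
        intro ξ η
        apply lp.ext
        funext k
        have : slice e (e k).2 (ξ + η) = slice e (e k).2 ξ + slice e (e k).2 η := rfl
        simp [this]
        rfl
      map_smul' := by
        intro c ξ
        apply lp.ext
        funext k
        have : slice e (e k).2 (c • ξ) = c • slice e (e k).2 ξ := rfl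
        simp [this] }
    ‖T‖ (by
      intro ξ
      refine norm_le (by positivity) ?_
      refine (amp_memlp e T ξ).tsum_eq.trans_le ?_
      rw [mul_pow, ← (hasSum_slice e ξ).tsum_eq, ← tsum_mul_left]
      refine Summable.tsum_le_tsum (fun q => ?_) ?_ ((hasSum_slice e ξ).summable.mul_left _)
      · rw [← mul_pow]
        gcongr
        exact T.le_opNorm _
      · refine Summable.of_nonneg_of_le (fun q => by positivity) (fun q => ?_)
          ((hasSum_slice e ξ).summable.mul_left (‖T‖ ^ 2))
        rw [← mul_pow]
        gcongr
        exact T.le_opNorm _)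

theorem amp_apply {I J K : Type} (e : K ≃ I × J) (T : BL2 I) (ξ : L2 K) (k : K) :
    amp e T ξ k = T (slice e (e k).2 ξ) (e k).1 := rfl

theorem slice_amp {I J K : Type} (e : K ≃ I × J) (T : BL2 I) (ξ : L2 K) (q : J) :
    slice e q (amp e T ξ) = T (slice e q ξ) := by
  apply lp.ext
  funext i
  simp [slice_apply, amp_apply]

theorem inner_slice {I J K : Type} (e : K ≃ I × J) (ξ η : L2 K) :
    HasSum (fun q => ⟪slice e q ξ, slice e q η⟫_ℂ) ⟪ξ, η⟫_ℂ := by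
  have h1 : HasSum (fun p : J × I => ⟪ξ (e.symm (p.2, p.1)), η (e.symm (p.2, p.1))⟫_ℂ)
      ⟪ξ, η⟫_ℂ :=
    (((Equiv.prodComm J I).trans e.symm).hasSum_iff (f := fun k => ⟪ξ k, η k⟫_ℂ)).2
      (lp.hasSum_inner ξ η)
  exact h1.prod_fiberwise fun q => lp.hasSum_inner (slice e q ξ) (slice e q η)

theorem amp_star {I J K : Type} (e : K ≃ I × J) (T : BL2 I) :
    amp e (star T) = star (amp e T) := by
  rw [ContinuousLinearMap.star_eq_adjoint, ContinuousLinearMap.star_eq_adjoint,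
    ContinuousLinearMap.eq_adjoint_iff]
  intro ξ η
  refine (inner_slice e _ _).unique ?_
  have := inner_slice e ξ (amp e T η)
  simpa only [slice_amp, ContinuousLinearMap.adjoint_inner_left] using this

/-- Amplification is a unital `*`-homomorphism. -/
def ampHom {I J K : Type} (e : K ≃ I × J) : BL2 I →⋆ₐ[ℂ] BL2 K where
  toFun := amp e
  map_one' := by
    ext1 ξ
    exact slice_ext e fun q => by simp [slice_amp]
  map_mul' S T := by
    ext1 ξ
    exact slice_ext e fun q => by simp [slice_amp]
  map_zero' := by
    ext1 ξ
    apply lp.ext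
    funext k
    simp [amp_apply]
  map_add' S T := by
    ext1 ξ
    apply lp.ext
    funext k
    simp [amp_apply]
  commutes' c := by
    ext1 ξ
    apply lp.ext
    funext k
    simp [amp_apply, Algebra.algebraMap_eq_smul_one, slice_apply]
  map_star' := amp_star e

end L2

/-! ## Bicharacters and the twisted translations of `ℤⁿ` -/

/-- The bicharacter `χ(r, s) = exp(π i r · θ s)` of `ℤ^ι`. -/
def bichar {ι : Type} [Fintype ι] (θ : Matrix ι ι ℝ) (r s : ι → ℤ) : ℂ :=
  Complex.exp (Real.pi * Complex.I *
    (((fun i => (r i : ℝ)) ⬝ᵥ (θ *ᵥ fun i => (s i : ℝ)) : ℝ) : ℂ))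

theorem norm_bichar {ι : Type} [Fintype ι] (θ : Matrix ι ι ℝ) (r s : ι → ℤ) :
    ‖bichar θ r s‖ = 1 := by
  rw [bichar, mul_right_comm, ← Complex.ofReal_mul, Complex.norm_exp_ofReal_mul_I]

theorem weyl_hasSum {ι : Type} [Fintype ι] (θ : Matrix ι ι ℝ) (r : ι → ℤ)
    (ξ : L2 (ι → ℤ)) :
    HasSum (fun s => ‖bichar θ r s * ξ (s - r)‖ ^ 2) (‖ξ‖ ^ 2) := by
  simp only [norm_mul, norm_bichar, one_mul]
  exact ((Equiv.subRight r).hasSum_iff (f := fun k => ‖ξ k‖ ^ 2)).2 (L2.hasSum_sq ξ)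

/-- The unitary `U_r` on `ℓ²(ℤ^ι)`, `(U_r ξ)(s) = χ(r, s) ξ(s - r)`. For skew symmetric `θ` these
satisfy `U_r U_s = χ(r, s) U_{r+s}` and `U_r^* = U_{-r}`: they generate the (`C^*`-algebra of the)
noncommutative torus in its regular representation. -/
def weyl {ι : Type} [Fintype ι] (θ : Matrix ι ι ℝ) (r : ι → ℤ) : BL2 (ι → ℤ) :=
  LinearMap.mkContinuous
    { toFun := fun ξ => ⟨fun s => bichar θ r s * ξ (s - r),
        L2.memlp (weyl_hasSum θ r ξ).summable⟩
      map_add' := by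
        intro ξ η
        apply lp.ext
        funext k
        simp [mul_add]
        rfl
      map_smul' := by
        intro c ξ
        apply lp.ext
        funext k
        simp
        ring }
    1 (by
      intro ξ
      refine L2.norm_le (by positivity) ?_
      rw [one_mul]
      exact (weyl_hasSum θ r ξ).tsum_eq.le)

theorem weyl_apply {ι : Type} [Fintype ι] (θ : Matrix ι ι ℝ) (r : ι → ℤ) (ξ : L2 (ι → ℤ))
    (s : ι → ℤ) : weyl θ r ξ s = bichar θ r s * ξ (s - r) := rfl

/-! ## Toric deformations of compact spaces -/

/-- A compact Hausdorff space with a continuous action of the torus `𝕋^ι` and a real skew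
symmetric matrix of deformation parameters. -/
structure ToricDatum where
  X : Type
  [topX : TopologicalSpace X]
  [compactX : CompactSpace X]
  [t2X : T2Space X]
  ι : Type
  [fintypeι : Fintype ι]
  act : (ι → Circle) → X → X
  act_one : ∀ x, act 1 x = x
  act_mul : ∀ s t x, act (s * t) x = act s (act t x)
  continuous_act : Continuous fun p : (ι → Circle) × X => act p.1 p.2
  θ : Matrix ι ι ℝ
  skew : θᵀ = -θ

namespace ToricDatum

attribute [instance] topX compactX t2X fintypeι

/-- `f` lies in the isotypic component of degree `r`: `f(t · x) = t^r f(x)`. -/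
def IsIsotypic (D : ToricDatum) (r : D.ι → ℤ) (f : C(D.X, ℂ)) : Prop :=
  ∀ (t : D.ι → Circle) (x : D.X), f (D.act t x) = (∏ i, (t i : ℂ) ^ r i) * f x

/-- The function `x ↦ f(x) U_r`, the quantization of an isotypic function `f` of degree `r`. -/
def symbol (D : ToricDatum) (r : D.ι → ℤ) (f : C(D.X, ℂ)) : C(D.X, BL2 (D.ι → ℤ)) :=
  ⟨fun x => f x • weyl D.θ r, by fun_prop⟩

/-- The deformed algebra `C(X_θ)`. Isotypic functions `f` of degree `r`, quantized as the operator
valued functions `f U_r`, multiply by `(f U_r)(g U_s) = (χ(r, s) f g) U_{r+s}` and have adjoints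
`(f U_r)^* = (conj f) U_{-r}`, so that they span the `*`-algebra of (finite sums of) isotypic
functions with the deformed product `χ(r, s) f g`; its completion in the sup norm of `C(X, B(ℓ²))`
is the deformed `C^*`-algebra. -/
def alg (D : ToricDatum) : StarSubalgebra ℂ C(D.X, BL2 (D.ι → ℤ)) :=
  (StarAlgebra.adjoin ℂ {a | ∃ r f, D.IsIsotypic r f ∧ a = D.symbol r f}).topologicalClosure

/-- The deformed `C^*`-algebra `C(X_θ)` as a type. -/
def CAlg (D : ToricDatum) : Type := ↥D.alg

instance instCStarAlgebraCAlg (D : ToricDatum) : CStarAlgebra D.CAlg :=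
  haveI : IsClosed (D.alg : Set C(D.X, BL2 (D.ι → ℤ))) :=
    StarSubalgebra.isClosed_topologicalClosure _
  StarSubalgebra.cstarAlgebra D.alg

/-- The inclusion of `C(X_θ)` into the operator valued functions on `X`. -/
def incl (D : ToricDatum) : D.CAlg →⋆ₐ[ℂ] C(D.X, BL2 (D.ι → ℤ)) := D.alg.subtype

theorem incl_mem (D : ToricDatum) (a : D.CAlg) : D.incl a ∈ D.alg := Subtype.property a

theorem symbol_mem (D : ToricDatum) {r : D.ι → ℤ} {f : C(D.X, ℂ)} (h : D.IsIsotypic r f) :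
    D.symbol r f ∈ D.alg :=
  StarSubalgebra.le_topologicalClosure _ (StarAlgebra.subset_adjoin ℂ _ ⟨r, f, h, rfl⟩)

/-- The element of `C(X_θ)` given by an isotypic function. -/
def elt (D : ToricDatum) (r : D.ι → ℤ) (f : C(D.X, ℂ)) (h : D.IsIsotypic r f) : D.CAlg :=
  ⟨D.symbol r f, D.symbol_mem h⟩

/-- The product `X × Y` with the product torus action and the block diagonal matrix `θ ⊕ θ'`.
The algebra `C((X × Y)_{θ ⊕ θ'})` is the (spatial) tensor product `C(X_θ) ⊗ C(Y_θ')`, acting on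
`ℓ²(ℤ^ι ⊕ ℤ^κ) = ℓ²(ℤ^ι) ⊗ ℓ²(ℤ^κ)`. -/
def prod (D E : ToricDatum) : ToricDatum where
  X := D.X × E.X
  ι := D.ι ⊕ E.ι
  act t p := (D.act (fun i => t (Sum.inl i)) p.1, E.act (fun i => t (Sum.inr i)) p.2)
  act_one p := Prod.ext (D.act_one p.1) (E.act_one p.2)
  act_mul s t p := Prod.ext (D.act_mul _ _ p.1) (E.act_mul _ _ p.2)
  continuous_act := by
    have h1 := D.continuous_act
    have h2 := E.continuous_act
    refine Continuous.prodMk ?_ ?_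
    · exact h1.comp (f := fun q : ((D.ι ⊕ E.ι) → Circle) × D.X × E.X =>
        ((fun i => q.1 (Sum.inl i)), q.2.1)) (by fun_prop)
    · exact h2.comp (f := fun q : ((D.ι ⊕ E.ι) → Circle) × D.X × E.X =>
        ((fun i => q.1 (Sum.inr i)), q.2.2)) (by fun_prop)
  θ := Matrix.fromBlocks D.θ 0 0 E.θ
  skew := by
    rw [Matrix.fromBlocks_transpose, D.skew, E.skew, Matrix.fromBlocks_neg]
    simp

/-- `ℤ^(ι ⊕ κ) = ℤ^ι × ℤ^κ`. -/
def splitL (ι κ : Type) : (ι ⊕ κ → ℤ) ≃ (ι → ℤ) × (κ → ℤ) :=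
  Equiv.sumArrowEquivProdArrow ι κ ℤ

/-- `ℤ^(ι ⊕ κ) = ℤ^κ × ℤ^ι`. -/
def splitR (ι κ : Type) : (ι ⊕ κ → ℤ) ≃ (κ → ℤ) × (ι → ℤ) :=
  (splitL ι κ).trans (Equiv.prodComm _ _)

theorem amp_weyl_left (D E : ToricDatum) (r : D.ι → ℤ) :
    L2.amp (splitL D.ι E.ι) (weyl D.θ r) = weyl (Matrix.fromBlocks D.θ 0 0 E.θ) (Sum.elim r 0) := by
  ext1 ξ
  apply lp.ext
  funext k
  rw [L2.amp_apply, weyl_apply, weyl_apply]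
  congr 1
  · simp [bichar, splitL, Equiv.sumArrowEquivProdArrow, dotProduct, Matrix.mulVec]
  · rw [L2.slice_apply]
    refine congrArg (fun j => ξ j) ?_
    funext i
    cases i <;> simp [splitL, Equiv.sumArrowEquivProdArrow]

theorem amp_weyl_right (D E : ToricDatum) (r : E.ι → ℤ) :
    L2.amp (splitR D.ι E.ι) (weyl E.θ r) = weyl (Matrix.fromBlocks D.θ 0 0 E.θ) (Sum.elim 0 r) := by
  ext1 ξ
  apply lp.ext
  funext k
  rw [L2.amp_apply, weyl_apply, weyl_apply]
  congr 1
  · simp [bichar, splitL, splitR, Equiv.sumArrowEquivProdArrow, dotProduct, Matrix.mulVec]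
  · rw [L2.slice_apply]
    refine congrArg (fun j => ξ j) ?_
    funext i
    cases i <;> simp [splitR, splitL, Equiv.sumArrowEquivProdArrow]

/-- `a ↦ a ⊗ 1` on the level of operator valued functions: `(x, y) ↦ a(x) ⊗ 1`. -/
def inlAux (D E : ToricDatum) :
    C(D.X, BL2 (D.ι → ℤ)) →⋆ₐ[ℂ] C((D.prod E).X, BL2 ((D.prod E).ι → ℤ)) :=
  (ContinuousMap.compStarAlgHom (D.prod E).X (L2.ampHom (splitL D.ι E.ι))
      (map_continuous (L2.ampHom (splitL D.ι E.ι)))).comp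
    (ContinuousMap.compStarAlgHom' ℂ (BL2 (D.ι → ℤ)) ⟨fun p : D.X × E.X => p.1, continuous_fst⟩)

/-- `b ↦ 1 ⊗ b` on the level of operator valued functions: `(x, y) ↦ 1 ⊗ b(y)`. -/
def inrAux (D E : ToricDatum) :
    C(E.X, BL2 (E.ι → ℤ)) →⋆ₐ[ℂ] C((D.prod E).X, BL2 ((D.prod E).ι → ℤ)) :=
  (ContinuousMap.compStarAlgHom (D.prod E).X (L2.ampHom (splitR D.ι E.ι))
      (map_continuous (L2.ampHom (splitR D.ι E.ι)))).comp
    (ContinuousMap.compStarAlgHom' ℂ (BL2 (E.ι → ℤ)) ⟨fun p : D.X × E.X => p.2, continuous_snd⟩)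

theorem inlAux_continuous (D E : ToricDatum) : Continuous (inlAux D E) :=
  (ContinuousMap.continuous_postcomp _).comp (ContinuousMap.continuous_precomp _)

theorem inrAux_continuous (D E : ToricDatum) : Continuous (inrAux D E) :=
  (ContinuousMap.continuous_postcomp _).comp (ContinuousMap.continuous_precomp _)

theorem inlAux_symbol (D E : ToricDatum) {r : D.ι → ℤ} {f : C(D.X, ℂ)} (h : D.IsIsotypic r f) :
    inlAux D E (D.symbol r f) ∈ (D.prod E).alg := by
  have key : inlAux D E (D.symbol r f) =
      (D.prod E).symbol (Sum.elim r 0) ⟨fun p : D.X × E.X => f p.1, by fun_prop⟩ := by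
    ext1 p
    change L2.ampHom (splitL D.ι E.ι) (f p.1 • weyl D.θ r) = _
    rw [map_smul]
    exact congrArg (f p.1 • ·) (amp_weyl_left D E r)
  rw [key]
  refine (D.prod E).symbol_mem fun t p => ?_
  refine (h (fun i => t (Sum.inl i)) p.1).trans ?_
  change _ = (∏ i : D.ι ⊕ E.ι, (t i : ℂ) ^ (Sum.elim r 0 : D.ι ⊕ E.ι → ℤ) i) * f p.1
  simp

theorem inrAux_symbol (D E : ToricDatum) {r : E.ι → ℤ} {f : C(E.X, ℂ)} (h : E.IsIsotypic r f) :
    inrAux D E (E.symbol r f) ∈ (D.prod E).alg := by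
  have key : inrAux D E (E.symbol r f) =
      (D.prod E).symbol (Sum.elim 0 r) ⟨fun p : D.X × E.X => f p.2, by fun_prop⟩ := by
    ext1 p
    change L2.ampHom (splitR D.ι E.ι) (f p.2 • weyl E.θ r) = _
    rw [map_smul]
    exact congrArg (f p.2 • ·) (amp_weyl_right D E r)
  rw [key]
  refine (D.prod E).symbol_mem fun t p => ?_
  refine (h (fun i => t (Sum.inr i)) p.2).trans ?_
  change _ = (∏ i : D.ι ⊕ E.ι, (t i : ℂ) ^ (Sum.elim 0 r : D.ι ⊕ E.ι → ℤ) i) * f p.2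
  simp

theorem map_mem_of_symbol {D E : ToricDatum}
    (φ : C(D.X, BL2 (D.ι → ℤ)) →⋆ₐ[ℂ] C(E.X, BL2 (E.ι → ℤ))) (hφ : Continuous φ)
    (h : ∀ r f, D.IsIsotypic r f → φ (D.symbol r f) ∈ E.alg)
    {a : C(D.X, BL2 (D.ι → ℤ))} (ha : a ∈ D.alg) : φ a ∈ E.alg := by
  have hle : D.alg ≤ E.alg.comap φ := by
    refine StarSubalgebra.topologicalClosure_minimal (StarAlgebra.adjoin_le ?_) ?_
    · rintro _ ⟨r, f, hf, rfl⟩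
      exact h r f hf
    · exact (StarSubalgebra.isClosed_topologicalClosure _).preimage hφ
  exact hle ha

/-- The embedding `a ↦ a ⊗ 1` of `C(X_θ)` into `C(X_θ) ⊗ C(Y_θ')`. -/
def inl (D E : ToricDatum) : D.CAlg →⋆ₐ[ℂ] (D.prod E).CAlg :=
  StarAlgHom.codRestrict ((inlAux D E).comp D.incl) (D.prod E).alg fun a =>
    map_mem_of_symbol (inlAux D E) (inlAux_continuous D E)
      (fun _ _ => inlAux_symbol D E) (D.incl_mem a)

/-- The embedding `b ↦ 1 ⊗ b` of `C(Y_θ')` into `C(X_θ) ⊗ C(Y_θ')`. -/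
def inr (D E : ToricDatum) : E.CAlg →⋆ₐ[ℂ] (D.prod E).CAlg :=
  StarAlgHom.codRestrict ((inrAux D E).comp E.incl) (D.prod E).alg fun a =>
    map_mem_of_symbol (inrAux D E) (inrAux_continuous D E)
      (fun _ _ => inrAux_symbol D E) (E.incl_mem a)

/-- The elementary tensor `a ⊗ b = (a ⊗ 1)(1 ⊗ b)` in `C(X_θ) ⊗ C(Y_θ')`. -/
def tmul {D E : ToricDatum} (a : D.CAlg) (b : E.CAlg) : (D.prod E).CAlg :=
  inl D E a * inr D E b

theorem tmul_one_left {D E : ToricDatum} (b : E.CAlg) : tmul (1 : D.CAlg) b = inr D E b := by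
  rw [tmul, map_one, one_mul]

/-- `Φ = φ ⊗ ψ`. -/
def IsTensorMap {D D' E E' : ToricDatum} (φ : D.CAlg →⋆ₐ[ℂ] D'.CAlg) (ψ : E.CAlg →⋆ₐ[ℂ] E'.CAlg)
    (Φ : (D.prod E).CAlg →⋆ₐ[ℂ] (D'.prod E').CAlg) : Prop :=
  ∀ a b, Φ (tmul a b) = tmul (φ a) (ψ b)

/-- `α` is the canonical isomorphism `(A ⊗ B) ⊗ C ≅ A ⊗ (B ⊗ C)`. -/
def IsAssociator {D E F : ToricDatum}
    (α : ((D.prod E).prod F).CAlg ≃⋆ₐ[ℂ] (D.prod (E.prod F)).CAlg) : Prop :=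
  ∀ a b c, α (tmul (tmul a b) c) = tmul a (tmul b c)

/-- `δ : A → H ⊗ A` is a left coaction of `(H, Δ, ε)` on `A`:
`(Δ ⊗ id) δ = (id ⊗ δ) δ` and `(ε ⊗ id) δ = id`. The homomorphisms `Δ ⊗ id`, `id ⊗ δ`, `ε ⊗ id`
(and the rebracketing of triple tensor products) are determined by their values on elementary
tensors, since these span a dense subspace. -/
structure IsLeftCoaction {H A : ToricDatum} (Δ : H.CAlg →⋆ₐ[ℂ] (H.prod H).CAlg)
    (ε : H.CAlg →⋆ₐ[ℂ] ℂ) (δ : A.CAlg →⋆ₐ[ℂ] (H.prod A).CAlg) : Prop where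
  coassoc : ∃ (Φ : (H.prod A).CAlg →⋆ₐ[ℂ] ((H.prod H).prod A).CAlg)
    (Ψ : (H.prod A).CAlg →⋆ₐ[ℂ] (H.prod (H.prod A)).CAlg)
    (α : ((H.prod H).prod A).CAlg ≃⋆ₐ[ℂ] (H.prod (H.prod A)).CAlg),
    IsTensorMap Δ (StarAlgHom.id ℂ A.CAlg) Φ ∧ IsTensorMap (StarAlgHom.id ℂ H.CAlg) δ Ψ ∧
      IsAssociator α ∧ ∀ a, α (Φ (δ a)) = Ψ (δ a)
  counit : ∃ Φ : (H.prod A).CAlg →⋆ₐ[ℂ] A.CAlg,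
    (∀ h a, Φ (tmul h a) = ε h • a) ∧ ∀ a, Φ (δ a) = a

/-- The coinvariant elements `{a : δ(a) = 1 ⊗ a}`. -/
def coinvariants {H A : ToricDatum} (δ : A.CAlg →⋆ₐ[ℂ] (H.prod A).CAlg) :
    StarSubalgebra ℂ A.CAlg where
  carrier := {a | δ a = tmul 1 a}
  mul_mem' := by
    intro a b ha hb
    change δ a = tmul 1 a at ha
    change δ b = tmul 1 b at hb
    change δ (a * b) = tmul 1 (a * b)
    rw [tmul_one_left] at *
    rw [map_mul, map_mul, ha, hb]
  add_mem' := by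
    intro a b ha hb
    change δ a = tmul 1 a at ha
    change δ b = tmul 1 b at hb
    change δ (a + b) = tmul 1 (a + b)
    rw [tmul_one_left] at *
    rw [map_add, map_add, ha, hb]
  algebraMap_mem' c := by
    change δ (algebraMap ℂ _ c) = tmul 1 (algebraMap ℂ _ c)
    rw [tmul_one_left, AlgHomClass.commutes, AlgHomClass.commutes]
  star_mem' := by
    intro a ha
    change δ a = tmul 1 a at ha
    change δ (star a) = tmul 1 (star a)
    rw [tmul_one_left] at *
    rw [map_star, map_star, ha]

end ToricDatum

/-! ## The quantum group `SU(3)_θ` -/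

/-- The compact group `SU(3)`. -/
abbrev SU3 : Type := Matrix.specialUnitaryGroup (Fin 3) ℂ

theorem SU3.norm_entry_le (g : SU3) (i j : Fin 3) : ‖g.1 i j‖ ≤ 1 :=
  entry_norm_bound_of_unitary (Matrix.specialUnitaryGroup_le_unitaryGroup g.2) i j

instance SU3.instCompactSpace : CompactSpace SU3 := by
  have hc : IsClosed {A : Matrix (Fin 3) (Fin 3) ℂ | A * star A = 1 ∧ A.det = 1} := by
    refine IsClosed.inter (isClosed_eq (by fun_prop) continuous_const)
      (isClosed_eq (by fun_prop) continuous_const)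
  have hK : IsCompact (Set.univ.pi fun _ : Fin 3 => Set.univ.pi fun _ : Fin 3 =>
      Metric.closedBall (0 : ℂ) 1) :=
    isCompact_univ_pi fun _ => isCompact_univ_pi fun _ => isCompact_closedBall _ _
  have he : (Matrix.specialUnitaryGroup (Fin 3) ℂ : Set (Matrix (Fin 3) (Fin 3) ℂ)) =
      {A | A * star A = 1 ∧ A.det = 1} := by
    ext A
    simp [Matrix.mem_specialUnitaryGroup_iff, Matrix.mem_unitaryGroup_iff]
  rw [← he] at hc
  refine isCompact_iff_compactSpace.1 (IsCompact.of_isClosed_subset (X := Matrix (Fin 3) (Fin 3) ℂ)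
    hK hc ?_)
  intro A hA i _ j _
  simpa using SU3.norm_entry_le ⟨A, hA⟩ i j

/-- The element `diag(t₁, t₂, (t₁t₂)⁻¹)` of the maximal torus of `SU(3)`. -/
def SU3.torus (t : Fin 2 → Circle) : SU3 :=
  ⟨Matrix.diagonal ![(t 0 : ℂ), (t 1 : ℂ), ((t 0 * t 1)⁻¹ : Circle)], by
    rw [Matrix.mem_specialUnitaryGroup_iff, Matrix.mem_unitaryGroup_iff]
    constructor
    · rw [Matrix.star_eq_conjTranspose, Matrix.diagonal_conjTranspose, Matrix.diagonal_mul_diagonal,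
        ← Matrix.diagonal_one]
      congr 1
      funext i
      have h := fun z : Circle => Complex.mul_conj' (z : ℂ)
      simp only [Circle.norm_coe, Complex.ofReal_one, one_pow] at h
      fin_cases i
      · exact h (t 0)
      · exact h (t 1)
      · exact h (t 0 * t 1)⁻¹
    · simp [Matrix.det_diagonal, Fin.prod_univ_three]
      field_simp⟩

theorem SU3.torus_mul (s t : Fin 2 → Circle) : torus (s * t) = torus s * torus t := by
  apply Subtype.ext
  simp only [torus, Submonoid.coe_mul, Matrix.diagonal_mul_diagonal]
  congr 1
  funext i
  fin_cases i <;> simp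
  ring

theorem SU3.torus_one : torus 1 = 1 := by
  apply Subtype.ext
  simp only [torus, Submonoid.coe_one, ← Matrix.diagonal_one]
  congr 1
  funext i
  fin_cases i <;> simp

theorem SU3.continuous_torus : Continuous torus := by
  refine Continuous.subtype_mk (Continuous.matrix_diagonal ?_) _
  refine continuous_pi fun i => ?_
  fin_cases i
  · exact continuous_subtype_val.comp (continuous_apply 0)
  · exact continuous_subtype_val.comp (continuous_apply 1)
  · exact continuous_subtype_val.comp ((continuous_apply 0).mul (continuous_apply 1)).inv

/-- The data defining `C(SU(3)_θ)`: the torus `𝕋² × 𝕋²` acts on `SU(3)` so that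
`f(g) ↦ f(exp(-x) g exp(s))`, with the matrix `K ⊕ (-K)`, `K = (0, -θ; θ, 0)`. -/
def qSU3 (θ : ℝ) : ToricDatum where
  X := SU3
  ι := Fin 2 ⊕ Fin 2
  act t g := SU3.torus (fun i => (t (Sum.inl i))⁻¹) * g * SU3.torus (fun i => t (Sum.inr i))
  act_one g := by
    have h1 : SU3.torus (fun i => ((1 : Fin 2 ⊕ Fin 2 → Circle) (Sum.inl i))⁻¹) = 1 := by
      rw [← SU3.torus_one]; congr 1; funext i; simp
    have h2 : SU3.torus (fun i => (1 : Fin 2 ⊕ Fin 2 → Circle) (Sum.inr i)) = 1 := SU3.torus_one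
    rw [h1, h2, one_mul, mul_one]
  act_mul s t g := by
    have h1 : SU3.torus (fun i => ((s * t) (Sum.inl i))⁻¹) =
        SU3.torus (fun i => (s (Sum.inl i))⁻¹) * SU3.torus (fun i => (t (Sum.inl i))⁻¹) := by
      rw [← SU3.torus_mul]; congr 1; funext i; simp [mul_comm]
    have h2 : SU3.torus (fun i => (s * t) (Sum.inr i)) =
        SU3.torus (fun i => t (Sum.inr i)) * SU3.torus (fun i => s (Sum.inr i)) := by
      rw [← SU3.torus_mul]; congr 1; funext i; simp [mul_comm]
    rw [h1, h2]
    simp only [mul_assoc]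
  continuous_act := by
    have := SU3.continuous_torus
    fun_prop
  θ := Matrix.fromBlocks !![0, -θ; θ, 0] 0 0 (-!![0, -θ; θ, 0])
  skew := by
    rw [Matrix.fromBlocks_transpose, Matrix.fromBlocks_neg]
    congr 1 <;> ext i j <;> fin_cases i <;> fin_cases j <;> simp

/-- The degree of the coordinate function `u_ij` on `SU(3)`. -/
def uDeg (i j : Fin 3) : Fin 2 ⊕ Fin 2 → ℤ :=
  Sum.elim (![![-1, 0], ![0, -1], ![1, 1]] i) (![![1, 0], ![0, 1], ![-1, -1]] j)

/-- The coordinate function `g ↦ g_ij` on `SU(3)`. -/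
def uFun (i j : Fin 3) : C(SU3, ℂ) := 
  ⟨fun g => g.1 i j, (continuous_apply_apply i j).comp continuous_subtype_val⟩

theorem uFun_isotypic (θ : ℝ) (i j : Fin 3) : (qSU3 θ).IsIsotypic (uDeg i j) (uFun i j) := by
  intro t g
  change ((Matrix.diagonal _ * g.1 * Matrix.diagonal _ : Matrix (Fin 3) (Fin 3) ℂ)) i j =
    (∏ k : Fin 2 ⊕ Fin 2, (t k : ℂ) ^ uDeg i j k) * g.1 i j
  rw [Matrix.mul_diagonal, Matrix.diagonal_mul]
  fin_cases i <;> fin_cases j <;>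
    simp [uDeg, Fintype.prod_sum_type, Fin.prod_univ_two] <;> ring

/-- The generator `u_ij` of `C(SU(3)_θ)`. -/
def u (θ : ℝ) (i j : Fin 3) : (qSU3 θ).CAlg :=
  (qSU3 θ).elt (uDeg i j) (uFun i j) (uFun_isotypic θ i j)

/-- The `*`-algebra generated by the coordinates `u_ij`, a dense subalgebra of `C(SU(3)_θ)`. -/
def polySU3 (θ : ℝ) : StarSubalgebra ℂ (qSU3 θ).CAlg :=
  StarAlgebra.adjoin ℂ (Set.range fun p : Fin 3 × Fin 3 => u θ p.1 p.2)

/-! ## The deformation of `S⁵ × S⁵` -/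

/-- `S⁵ × S⁵ ⊆ ℂ³ × ℂ³ = ℂ⁶`. -/
def S5S5 : Type :=
  {z : Fin 6 → ℂ // ‖z 0‖ ^ 2 + ‖z 1‖ ^ 2 + ‖z 2‖ ^ 2 = 1 ∧ ‖z 3‖ ^ 2 + ‖z 4‖ ^ 2 + ‖z 5‖ ^ 2 = 1}

instance : TopologicalSpace S5S5 := inferInstanceAs (TopologicalSpace (Subtype _))

instance : T2Space S5S5 := inferInstanceAs (T2Space (Subtype _))

instance : CompactSpace S5S5 := by
  have hc : IsClosed {z : Fin 6 → ℂ | ‖z 0‖ ^ 2 + ‖z 1‖ ^ 2 + ‖z 2‖ ^ 2 = 1 ∧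
      ‖z 3‖ ^ 2 + ‖z 4‖ ^ 2 + ‖z 5‖ ^ 2 = 1} :=
    IsClosed.inter (isClosed_eq (by fun_prop) continuous_const)
      (isClosed_eq (by fun_prop) continuous_const)
  have hK : IsCompact (Set.univ.pi fun _ : Fin 6 => Metric.closedBall (0 : ℂ) 1) :=
    isCompact_univ_pi fun _ => isCompact_closedBall _ _
  refine isCompact_iff_compactSpace.1 (hK.of_isClosed_subset hc ?_)
  rintro z ⟨h1, h2⟩ i _
  rw [mem_closedBall_zero_iff]
  fin_cases i <;> simp <;> nlinarith [sq_nonneg ‖z 0‖, sq_nonneg ‖z 1‖, sq_nonneg ‖z 2‖,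
    sq_nonneg ‖z 3‖, sq_nonneg ‖z 4‖, sq_nonneg ‖z 5‖]

/-- The data defining `(S⁵ × S⁵)_θ'`: the torus `𝕋⁶` acts by `(t · z)_j = t_j z_j`. -/
def qS5S5 (θ' : Matrix (Fin 6) (Fin 6) ℝ) (hθ' : θ'ᵀ = -θ') : ToricDatum where
  X := S5S5
  ι := Fin 6
  act t z := ⟨fun j => t j * z.1 j, by simpa only [norm_mul, Circle.norm_coe, one_mul] using z.2⟩
  act_one z := Subtype.ext (by funext j; simp)
  act_mul s t z := Subtype.ext (by funext j; simp [mul_assoc])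
  continuous_act := by
    refine Continuous.subtype_mk (continuous_pi fun j => ?_) _
    have h : Continuous fun z : S5S5 => z.1 j := (continuous_apply j).comp continuous_subtype_val
    exact (by fun_prop : Continuous fun p : (Fin 6 → Circle) × S5S5 => (p.1 j : ℂ)).mul
      (h.comp continuous_snd)
  θ := θ'
  skew := hθ'

/-- The coordinate function `z_j` on `S⁵ × S⁵`. -/
def zFun (j : Fin 6) : C(S5S5, ℂ) :=
  ⟨fun z => z.1 j, (continuous_apply j).comp continuous_subtype_val⟩

theorem zFun_isotypic (θ' : Matrix (Fin 6) (Fin 6) ℝ) (hθ' : θ'ᵀ = -θ') (j : Fin 6) :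
    (qS5S5 θ' hθ').IsIsotypic (Pi.single j (1 : ℤ) : Fin 6 → ℤ) (zFun j) := by
  intro t z
  change (t j : ℂ) * z.1 j =
    (∏ k : Fin 6, (t k : ℂ) ^ (Pi.single j (1 : ℤ) : Fin 6 → ℤ) k) * z.1 j
  congr 1
  rw [Finset.prod_eq_single j] <;> simp +contextual

section

variable (θ' : Matrix (Fin 6) (Fin 6) ℝ) (hθ' : θ'ᵀ = -θ')

/-- The generator `z_{j+1}` of the algebra of `(S⁵ × S⁵)_θ'`, for `j = 0, …, 5`. -/
def zGen (j : Fin 6) : (qS5S5 θ' hθ').CAlg :=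
  (qS5S5 θ' hθ').elt (Pi.single j (1 : ℤ) : Fin 6 → ℤ) (zFun j) (zFun_isotypic θ' hθ' j)

/-- The `*`-algebra `A((S⁵ × S⁵)_θ')` generated by `z_1, …, z_6`, a dense subalgebra of
`C((S⁵ × S⁵)_θ')`. -/
def polyS5S5 : StarSubalgebra ℂ (qS5S5 θ' hθ').CAlg :=
  StarAlgebra.adjoin ℂ (Set.range (zGen θ' hθ'))

/-- `w = z_1 z_4^* + z_2 z_5^* + z_3 z_6^*`. -/
def wElt : (qS5S5 θ' hθ').CAlg :=
  ∑ k : Fin 3, zGen θ' hθ' (Fin.castAdd 3 k) * star (zGen θ' hθ' (Fin.natAdd 3 k))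

/-- `z_1^* z_4 + z_2^* z_5 + z_3^* z_6`. -/
def wElt' : (qS5S5 θ' hθ').CAlg :=
  ∑ k : Fin 3, star (zGen θ' hθ' (Fin.castAdd 3 k)) * zGen θ' hθ' (Fin.natAdd 3 k)

end

end

/-! A function with finitely many isotypic components is quantized by attaching `weyl θ r` to its
component of degree r. The relation "F is the quantization of f" is `quantOn`; F determines f and f
determines F (`quantOn_snd_unique`, `quantOn_fst_unique`). Quantization differs from being
multiplicative only by bicharacters of degrees. Hence a continuous map induces a homomorphism of
deformed algebras, by quantizing pullbacks, as soon as the degrees occurring in the pullbacks pair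
with each other exactly as the original degrees do. This is a `QMap`, and by bimultiplicativity the
condition need only be checked on coordinates (`Coordinates.Pullback`).

The analytic point is that such a map is bounded (`QMap.norm_le_of_mem_graph`). On the group M of
related pairs of degrees the two bicharacters agree, so their ratio is there the coboundary of a
phase (`exists_phase`). Twisting Følner vectors of the lattice of degrees by this phase gives
isometries which asymptotically intertwine the Weyl operators of the target with those of the source
multiplied by torus characters (`exists_weyl_intertwiner`). The quantized pullback at y is thereby
dominated by multiplication with the original operator valued function along the torus orbit of y,
so the map is contractive and extends to the C*-algebra (`exists_starAlgHom_of_graph`).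

Coproduct, counit and coaction come from the multiplication and unit of SU(3) and its diagonal
action on S⁵ × S⁵. The degrees of u_ij and u_i'j' pair to χ(i,i')/χ(j,j'), so the summation index of
a matrix product cancels. For the action the same cancellation works because the hypotheses on θ'
say that each 3 × 3 block is the weight form of SU(3), plus a constant, opposite in the two
off-diagonal blocks (`isCompatible_of_entries`). The axioms of a coaction then need checking on
generators only.

For the coinvariants, average over SU(3): integrate over Haar measure and compress to degree 0 of
the first tensor factor. This is contractive, sends 1 ⊗ a to a, and sends the quantization of F to
the quantization of ∫ F(x, ·) dx (`exists_average_of_mem_quantOn`). If p is polynomial, with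
underlying function f, then δ(p) quantizes f composed with the action, so its average b quantizes
the orbit average of f. Classically an invariant polynomial is a polynomial in w and its conjugate
(`mem_adjoin_wFun`), and the degrees occurring in these have trivial bicharacter, so b lies in the
algebra generated by w and w^*. Contractivity yields ‖b - a‖ ≤ ‖δ(p) - 1 ⊗ a‖ for every a
(`exists_norm_sub_le`). Taking a = p settles the polynomial coinvariants, and letting p approach a
coinvariant a settles the C*-algebraic ones. -/

section

open MeasureTheory Filter Topology

noncomputable section

/-! ## Normalized Haar measure on compact groups -/

section HaarProb

variable (G : Type) [Group G] [TopologicalSpace G] [IsTopologicalGroup G] [CompactSpace G]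
  [MeasurableSpace G] [BorelSpace G]

/-- The normalized Haar measure of a compact group. -/
def haarProb : Measure G := Measure.haarMeasure ⊤

instance haarProb.isHaarMeasure : (haarProb G).IsHaarMeasure :=
  inferInstanceAs (Measure.haarMeasure ⊤).IsHaarMeasure

instance haarProb.isProbabilityMeasure : IsProbabilityMeasure (haarProb G) :=
  ⟨Measure.haarMeasure_self⟩

/-- Compact groups are unimodular: a right translate of Haar measure is again a Haar probability
measure, and there is only one. -/
instance haarProb.isMulRightInvariant : (haarProb G).IsMulRightInvariant where
  map_mul_right_eq_self g := by
    have : IsProbabilityMeasure ((haarProb G).map (· * g)) :=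
      Measure.isProbabilityMeasure_map (by fun_prop)
    exact Measure.isHaarMeasure_eq_of_isProbabilityMeasure _ _

variable {G}

/-- Two-sided invariance makes the integral equal to c times itself. This gives both the
orthogonality of torus characters and the vanishing of integrals over SU(3) in nonzero degree. -/
theorem integral_haarProb_eq_zero {E : Type*} [NormedAddCommGroup E] [NormedSpace ℂ E]
    (f : G → E) (a b : G) (c : ℂ) (hc : c ≠ 1) (h : ∀ x, f (a * x * b) = c • f x) :
    ∫ x, f x ∂haarProb G = 0 := by
  have h1 : ∫ x, f (a * x * b) ∂haarProb G = ∫ x, f x ∂haarProb G := by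
    rw [integral_mul_left_eq_self (fun x => f (x * b)) a, integral_mul_right_eq_self f b]
  simp only [h, integral_smul] at h1
  have h2 : (c - 1) • ∫ x, f x ∂haarProb G = 0 := by rw [sub_smul, h1, one_smul, sub_self]
  exact (smul_eq_zero.1 h2).resolve_left (sub_ne_zero.2 hc)

end HaarProb

/-! ## Characters of the torus -/

instance torus.instMeasurableSpace (ι : Type) : MeasurableSpace (ι → Circle) := borel _

instance torus.instBorelSpace (ι : Type) : BorelSpace (ι → Circle) := ⟨rfl⟩

section TorusChar

variable {ι : Type} [Fintype ι]

/-- The character `t ↦ t^r` of the torus. -/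
def torusChar (r : ι → ℤ) : C(ι → Circle, ℂ) :=
  ⟨fun t => ∏ i, (t i : ℂ) ^ r i, by
    have : (fun t : ι → Circle => ∏ i, (t i : ℂ) ^ r i) =
        fun t => ((∏ i, t i ^ r i : Circle) : ℂ) := by
      funext t
      exact ((map_prod Circle.coeHom (fun i => t i ^ r i) Finset.univ).trans
        (Finset.prod_congr rfl fun i _ => Circle.coe_zpow (t i) (r i))).symm
    rw [this]
    fun_prop⟩

theorem torusChar_apply (r : ι → ℤ) (t : ι → Circle) :
    torusChar r t = ∏ i, (t i : ℂ) ^ r i := rfl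

theorem norm_torusChar (r : ι → ℤ) (t : ι → Circle) : ‖torusChar r t‖ = 1 := by
  rw [torusChar_apply, norm_prod]
  refine Finset.prod_eq_one fun i _ => ?_
  rw [norm_zpow]
  exact (congrArg (· ^ r i) (Circle.norm_coe (t i))).trans (one_zpow _)

theorem torusChar_zero (t : ι → Circle) : torusChar 0 t = 1 := by simp [torusChar_apply]

theorem torusChar_add (r s : ι → ℤ) (t : ι → Circle) :
    torusChar (r + s) t = torusChar r t * torusChar s t := by
  simp [torusChar_apply, ← Finset.prod_mul_distrib, zpow_add₀]

theorem torusChar_neg (r : ι → ℤ) (t : ι → Circle) :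
    torusChar (-r) t = (starRingEnd ℂ) (torusChar r t) := by
  simp [torusChar_apply, map_prod, ← Circle.coe_inv_eq_conj]

theorem torusChar_mul (r : ι → ℤ) (s t : ι → Circle) :
    torusChar r (s * t) = torusChar r s * torusChar r t := by
  simp [torusChar_apply, ← Finset.prod_mul_distrib, mul_zpow]

theorem exists_torusChar_ne_one {r : ι → ℤ} (hr : r ≠ 0) : ∃ t, torusChar r t ≠ 1 := by
  classical
  obtain ⟨i, hi⟩ := Function.ne_iff.1 hr
  -- The angle 1 detects every nonzero exponent: if exp(i r) = 1 for a nonzero integer r, then π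
  -- would be rational.
  refine ⟨Pi.mulSingle i (Circle.exp 1), ?_⟩
  rw [torusChar_apply, Finset.prod_eq_single i]
  · rw [Pi.mulSingle_eq_same, ← Circle.coe_zpow, ← Circle.exp_intCast_mul, mul_one,
      Circle.coe_exp, Ne, Complex.exp_eq_one_iff]
    rintro ⟨n, hn⟩
    have h1 : ((r i : ℝ) : ℂ) = ((n * (2 * Real.pi) : ℝ) : ℂ) := by
      have := mul_right_cancel₀ Complex.I_ne_zero (hn.trans (mul_assoc _ _ _).symm |>.trans
        (by ring : _ = (n * (2 * Real.pi) : ℂ) * Complex.I))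
      push_cast at this ⊢
      exact this
    have h2 : (r i : ℝ) = n * (2 * Real.pi) := Complex.ofReal_injective h1
    have hn0 : n ≠ 0 := by
      rintro rfl
      simp at h2
      exact hi h2
    apply irrational_pi.ne_rat ((r i : ℚ) / (2 * n))
    have : (n : ℝ) ≠ 0 := by exact_mod_cast hn0
    push_cast
    field_simp
    linarith
  · intro j _ hj
    simp [hj]
  · simp

theorem integral_torusChar (r : ι → ℤ) [Decidable (r = 0)] :
    ∫ t, torusChar r t ∂haarProb (ι → Circle) = if r = 0 then 1 else 0 := by
  split_ifs with h
  · subst h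
    simp [torusChar_zero]
  · obtain ⟨s, hs⟩ := exists_torusChar_ne_one h
    refine integral_haarProb_eq_zero _ s 1 _ hs fun t => ?_
    rw [mul_one, torusChar_mul, smul_eq_mul]

end TorusChar

/-! ## Bicharacters and Weyl operators -/

section Weyl

variable {ι : Type} [Fintype ι] (θ : Matrix ι ι ℝ)

theorem bichar_add_left (r r' s : ι → ℤ) :
    bichar θ (r + r') s = bichar θ r s * bichar θ r' s := by
  have : (fun i => (((r + r') i : ℤ) : ℝ)) = (fun i => (r i : ℝ)) + fun i => (r' i : ℝ) := by
    funext i; simp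
  rw [bichar, bichar, bichar, ← Complex.exp_add, this, add_dotProduct]
  push_cast
  ring_nf

theorem bichar_add_right (r s s' : ι → ℤ) :
    bichar θ r (s + s') = bichar θ r s * bichar θ r s' := by
  have : (fun i => (((s + s') i : ℤ) : ℝ)) = (fun i => (s i : ℝ)) + fun i => (s' i : ℝ) := by
    funext i; simp
  rw [bichar, bichar, bichar, ← Complex.exp_add, this, Matrix.mulVec_add, dotProduct_add]
  push_cast
  ring_nf

theorem bichar_zero_left (s : ι → ℤ) : bichar θ 0 s = 1 := by
  simp [bichar, dotProduct]

theorem bichar_zero_right (r : ι → ℤ) : bichar θ r 0 = 1 := by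
  simp [bichar, dotProduct, Matrix.mulVec]

theorem bichar_ne_zero (r s : ι → ℤ) : bichar θ r s ≠ 0 := Complex.exp_ne_zero _

theorem bichar_neg_left (r s : ι → ℤ) : bichar θ (-r) s = (bichar θ r s)⁻¹ := by
  refine eq_inv_of_mul_eq_one_left ?_
  rw [← bichar_add_left, neg_add_cancel,
    bichar_zero_left]

theorem bichar_neg_right (r s : ι → ℤ) : bichar θ r (-s) = (bichar θ r s)⁻¹ := by
  refine eq_inv_of_mul_eq_one_left ?_
  rw [← bichar_add_right, neg_add_cancel,
    bichar_zero_right]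

variable {θ}

theorem bichar_swap (hθ : θᵀ = -θ) (r s : ι → ℤ) : bichar θ s r = (bichar θ r s)⁻¹ := by
  rw [bichar, bichar, ← Complex.exp_neg]
  congr 1
  have : ((fun i => (s i : ℝ)) ⬝ᵥ (θ *ᵥ fun i => (r i : ℝ))) =
      -((fun i => (r i : ℝ)) ⬝ᵥ (θ *ᵥ fun i => (s i : ℝ))) := by
    rw [Matrix.dotProduct_mulVec, ← Matrix.mulVec_transpose, hθ, Matrix.neg_mulVec,
      neg_dotProduct, dotProduct_comm]
  rw [this]
  push_cast
  ring

theorem bichar_self (hθ : θᵀ = -θ) (r : ι → ℤ) : bichar θ r r = 1 := by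
  have : ((fun i => (r i : ℝ)) ⬝ᵥ (θ *ᵥ fun i => (r i : ℝ))) =
      -((fun i => (r i : ℝ)) ⬝ᵥ (θ *ᵥ fun i => (r i : ℝ))) := by
    conv_lhs => rw [Matrix.dotProduct_mulVec, ← Matrix.mulVec_transpose, hθ, Matrix.neg_mulVec,
      neg_dotProduct, dotProduct_comm]
  rw [bichar, self_eq_neg.1 this]
  simp

theorem weyl_zero : weyl θ (0 : ι → ℤ) = 1 := by
  ext1 ξ
  apply lp.ext
  funext s
  rw [weyl_apply, bichar_zero_left]
  simp

/-- The cocycle arises from evaluating χ(s, ·) at k - r instead of k: by skew symmetry χ(s, -r) =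
χ(r, s). -/
theorem weyl_mul (hθ : θᵀ = -θ) (r s : ι → ℤ) :
    weyl θ r * weyl θ s = bichar θ r s • weyl θ (r + s) := by
  ext1 ξ
  apply lp.ext
  funext k
  change weyl θ r (weyl θ s ξ) k = bichar θ r s * weyl θ (r + s) ξ k
  rw [weyl_apply, weyl_apply, weyl_apply, sub_sub, sub_eq_add_neg k r, bichar_add_right,
    bichar_neg_right, bichar_swap hθ r s, bichar_add_left, inv_inv]
  ring

theorem norm_weyl_apply (r : ι → ℤ) (ξ : L2 (ι → ℤ)) : ‖weyl θ r ξ‖ = ‖ξ‖ := by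
  have h := (L2.hasSum_sq (weyl θ r ξ)).unique (weyl_hasSum θ r ξ)
  exact (sq_eq_sq₀ (norm_nonneg _) (norm_nonneg _)).1 h

/-- The adjoint is a left inverse because the operator is isometric, and the operator of degree -r
is a right inverse, so the two coincide. -/
theorem star_weyl (hθ : θᵀ = -θ) (r : ι → ℤ) : star (weyl θ r) = weyl θ (-r) := by
  have h1 : star (weyl θ r) * weyl θ r = 1 :=
    (ContinuousLinearMap.norm_map_iff_adjoint_comp_self _).1 (norm_weyl_apply r)
  have h2 : weyl θ r * weyl θ (-r) = 1 := by
    rw [weyl_mul hθ, bichar_neg_right, bichar_self hθ, add_neg_cancel, weyl_zero]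
    simp
  calc star (weyl θ r) = star (weyl θ r) * (weyl θ r * weyl θ (-r)) := by rw [h2, mul_one]
    _ = weyl θ (-r) := by rw [← mul_assoc, h1, one_mul]

theorem norm_weyl_le (r : ι → ℤ) : ‖weyl θ r‖ ≤ 1 :=
  ContinuousLinearMap.opNorm_le_bound _ zero_le_one fun ξ => by rw [norm_weyl_apply, one_mul]

end Weyl

/-! ### Basis vectors of ℓ²(I) -/

namespace L2

variable {I : Type}

/-- The standard basis vectors of `ℓ²(I)`. -/
def basis (i : I) : L2 I :=
  haveI := Classical.decEq I
  lp.single 2 i (1 : ℂ)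

theorem basis_apply (i j : I) [Decidable (j = i)] : basis i j = if j = i then 1 else 0 := by
  classical
  rw [basis, lp.single_apply, Pi.single_apply]
  congr

theorem norm_basis (i : I) : ‖basis i‖ = 1 := by
  classical
  rw [basis, lp.norm_single (by norm_num)]
  simp

theorem inner_basis_left (i : I) (ξ : L2 I) : ⟪basis i, ξ⟫_ℂ = ξ i := by
  classical
  have := lp.inner_single_left (𝕜 := ℂ) i (1 : ℂ) ξ
  rw [basis]
  refine Eq.trans ?_ (this.trans ?_)
  · congr!
  · simp

theorem hasSum_basis (ξ : L2 I) : HasSum (fun i => ξ i • basis i) ξ := by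
  classical
  have := lp.hasSum_single (p := 2) (by norm_num) ξ
  convert this using 2 with i
  rw [basis, ← lp.single_smul]
  simp

/-- A closed subspace containing the basis vectors is everything. -/
theorem mem_of_isClosed (K : Submodule ℂ (L2 I)) (hK : IsClosed (K : Set (L2 I)))
    (h : ∀ i, basis i ∈ K) (ξ : L2 I) : ξ ∈ K :=
  hK.mem_of_tendsto (hasSum_basis ξ)
    (Eventually.of_forall fun _ => K.sum_mem fun i _ => K.smul_mem _ (h i))

theorem op_ext {H : Type*} [NormedAddCommGroup H] [NormedSpace ℂ H] {S T : L2 I →L[ℂ] H}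
    (h : ∀ i, S (basis i) = T (basis i)) : S = T := by
  ext1 ξ
  have := mem_of_isClosed (LinearMap.eqLocus (S : L2 I →ₗ[ℂ] H) T)
    (isClosed_eq S.continuous T.continuous) h ξ
  exact this

end L2

theorem weyl_basis {ι : Type} [Fintype ι] {θ : Matrix ι ι ℝ} (hθ : θᵀ = -θ) (r n : ι → ℤ) :
    weyl θ r (L2.basis n) = bichar θ r n • L2.basis (n + r) := by
  classical
  apply lp.ext
  funext k
  change _ = bichar θ r n * L2.basis (n + r) k
  rw [weyl_apply, L2.basis_apply, L2.basis_apply]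
  by_cases h : k - r = n
  · have h' : k = n + r := by rw [← h, sub_add_cancel]
    rw [if_pos h, if_pos h', h', bichar_add_right, bichar_self hθ, mul_one]
  · rw [if_neg h, if_neg fun h' => h (by rw [h', add_sub_cancel_right])]
    simp

theorem integrable_of_continuous_of_compactSpace {G E : Type*} [TopologicalSpace G] [CompactSpace G]
    [MeasurableSpace G] [BorelSpace G] [NormedAddCommGroup E] (μ : Measure G) [IsFiniteMeasure μ]
    {f : G → E} (hf : Continuous f) : Integrable f μ :=
  hf.integrable_of_hasCompactSupport (HasCompactSupport.of_compactSpace f)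

theorem norm_starAlgHom_apply_le {A B : Type*} [CStarAlgebra A] [CStarAlgebra B]
    (φ : A →⋆ₐ[ℂ] B) (a : A) : ‖φ a‖ ≤ ‖a‖ :=
  NonUnitalStarAlgHom.norm_apply_le φ a

theorem continuous_starAlgHom {A B : Type*} [CStarAlgebra A] [CStarAlgebra B]
    (φ : A →⋆ₐ[ℂ] B) : Continuous φ :=
  AddMonoidHomClass.continuous_of_bound φ 1 fun a => by
    rw [one_mul]
    exact norm_starAlgHom_apply_le φ a

namespace ToricDatum

/-! ## Isotypic functions and their quantizations -/

section Isotypic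

variable {D : ToricDatum}

theorem isIsotypic_iff {r : D.ι → ℤ} {f : C(D.X, ℂ)} :
    D.IsIsotypic r f ↔ ∀ t x, f (D.act t x) = torusChar r t * f x := Iff.rfl

theorem IsIsotypic.zero (r : D.ι → ℤ) : D.IsIsotypic r 0 := fun t x => by simp

theorem IsIsotypic.one : D.IsIsotypic 0 1 := fun t x => by simp

theorem IsIsotypic.add {r : D.ι → ℤ} {f g : C(D.X, ℂ)} (hf : D.IsIsotypic r f)
    (hg : D.IsIsotypic r g) : D.IsIsotypic r (f + g) := fun t x => by
  simp only [ContinuousMap.add_apply, hf t x, hg t x, mul_add]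

theorem IsIsotypic.smul {r : D.ι → ℤ} {f : C(D.X, ℂ)} (c : ℂ) (hf : D.IsIsotypic r f) :
    D.IsIsotypic r (c • f) := fun t x => by
  simp only [ContinuousMap.smul_apply, hf t x, smul_eq_mul]
  ring

theorem IsIsotypic.mul {r s : D.ι → ℤ} {f g : C(D.X, ℂ)} (hf : D.IsIsotypic r f)
    (hg : D.IsIsotypic s g) : D.IsIsotypic (r + s) (f * g) := isIsotypic_iff.2 fun t x => by
  rw [ContinuousMap.mul_apply, isIsotypic_iff.1 hf, isIsotypic_iff.1 hg, torusChar_add,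
    ContinuousMap.mul_apply]
  ring

theorem IsIsotypic.star {r : D.ι → ℤ} {f : C(D.X, ℂ)} (hf : D.IsIsotypic r f) :
    D.IsIsotypic (-r) (star f) := isIsotypic_iff.2 fun t x => by
  rw [ContinuousMap.star_apply, isIsotypic_iff.1 hf, torusChar_neg, star_mul',
    ContinuousMap.star_apply]
  rfl

theorem continuous_orbit (x : D.X) : Continuous fun t => D.act t x :=
  D.continuous_act.comp (by fun_prop : Continuous fun t => (t, x))

theorem symbol_apply (r : D.ι → ℤ) (f : C(D.X, ℂ)) (x : D.X) :
    D.symbol r f x = f x • weyl D.θ r := rfl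

theorem symbol_zero (r : D.ι → ℤ) : D.symbol r 0 = 0 := by
  ext1 x
  simp [symbol_apply]

theorem symbol_one : D.symbol 0 1 = 1 := by
  ext1 x
  simp [symbol_apply, weyl_zero]

theorem symbol_add (r : D.ι → ℤ) (f g : C(D.X, ℂ)) :
    D.symbol r (f + g) = D.symbol r f + D.symbol r g := by
  ext1 x
  simp [symbol_apply, add_smul]

theorem symbol_smul (r : D.ι → ℤ) (c : ℂ) (f : C(D.X, ℂ)) :
    D.symbol r (c • f) = c • D.symbol r f := by
  ext1 x
  simp [symbol_apply, mul_smul]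

theorem symbol_mul (r s : D.ι → ℤ) (f g : C(D.X, ℂ)) :
    D.symbol r f * D.symbol s g = bichar D.θ r s • D.symbol (r + s) (f * g) := by
  ext1 x
  rw [ContinuousMap.mul_apply, symbol_apply, symbol_apply, smul_mul_smul_comm, weyl_mul D.skew,
    ContinuousMap.smul_apply, symbol_apply, ContinuousMap.mul_apply, smul_comm]

theorem star_symbol (r : D.ι → ℤ) (f : C(D.X, ℂ)) :
    star (D.symbol r f) = D.symbol (-r) (star f) := by
  ext1 x
  rw [ContinuousMap.star_apply, symbol_apply, star_smul, star_weyl D.skew, symbol_apply,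
    ContinuousMap.star_apply]

theorem norm_symbol_le (r : D.ι → ℤ) (f : C(D.X, ℂ)) : ‖D.symbol r f‖ ≤ ‖f‖ := by
  refine (ContinuousMap.norm_le _ (norm_nonneg f)).2 fun x => ?_
  rw [symbol_apply, norm_smul]
  calc ‖f x‖ * ‖weyl D.θ r‖ ≤ ‖f x‖ * 1 := by
        gcongr
        exact norm_weyl_le r
    _ ≤ ‖f‖ := by rw [mul_one]; exact f.norm_coe_le_norm x

/-- The relation "`F` is the quantization of `f`", for `f` with finitely many isotypic components,
all of them of a degree in `S`. -/
def quantOn (D : ToricDatum) (S : Set (D.ι → ℤ)) :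
    Submodule ℂ (C(D.X, BL2 (D.ι → ℤ)) × C(D.X, ℂ)) :=
  Submodule.span ℂ {p | ∃ r ∈ S, ∃ f, D.IsIsotypic r f ∧ p = (D.symbol r f, f)}

theorem symbol_mem_quantOn {S : Set (D.ι → ℤ)} {r : D.ι → ℤ} (hr : r ∈ S) {f : C(D.X, ℂ)}
    (hf : D.IsIsotypic r f) : (D.symbol r f, f) ∈ D.quantOn S :=
  Submodule.subset_span ⟨r, hr, f, hf, rfl⟩

theorem quantOn_mono {S T : Set (D.ι → ℤ)} (h : S ⊆ T) : D.quantOn S ≤ D.quantOn T :=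
  Submodule.span_mono fun _ ⟨r, hr, f, hf, e⟩ => ⟨r, h hr, f, hf, e⟩

theorem one_mem_quantOn {S : Set (D.ι → ℤ)} (hS : 0 ∈ S) : (1, 1) ∈ D.quantOn S := by
  rw [← symbol_one]
  exact symbol_mem_quantOn hS IsIsotypic.one

/-- A constant bicharacter on S × S' makes the deformed product one global scalar times the
pointwise product, even for sums over several degrees. -/
theorem quantOn_mul {S S' S'' : Set (D.ι → ℤ)} {c : ℂ}
    (hc : ∀ r ∈ S, ∀ r' ∈ S', bichar D.θ r r' = c) (hS : ∀ r ∈ S, ∀ r' ∈ S', r + r' ∈ S'')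
    {p q : C(D.X, BL2 (D.ι → ℤ)) × C(D.X, ℂ)} (hp : p ∈ D.quantOn S) (hq : q ∈ D.quantOn S') :
    (p.1 * q.1, c • (p.2 * q.2)) ∈ D.quantOn S'' := by
  induction hp using Submodule.span_induction with
  | mem p hp =>
    obtain ⟨r, hr, f, hf, rfl⟩ := hp
    induction hq using Submodule.span_induction with
    | mem q hq =>
      obtain ⟨r', hr', f', hf', rfl⟩ := hq
      have := (D.quantOn S'').smul_mem c (symbol_mem_quantOn (hS r hr r' hr') (hf.mul hf'))
      dsimp only
      rw [symbol_mul, hc r hr r' hr']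
      exact this
    | zero => simp [← Prod.zero_eq_mk]
    | add q q' _ _ h h' =>
      convert (D.quantOn S'').add_mem h h' using 1
      simp [mul_add]
    | smul a q _ h =>
      convert (D.quantOn S'').smul_mem a h using 1
      simp [smul_comm a c]
  | zero => simp [← Prod.zero_eq_mk]
  | add p p' _ _ h h' =>
    convert (D.quantOn S'').add_mem h h' using 1
    simp [add_mul]
  | smul a p _ h =>
    convert (D.quantOn S'').smul_mem a h using 1
    simp [smul_comm a c]

theorem quantOn_star {S S' : Set (D.ι → ℤ)} (hS : ∀ r ∈ S, -r ∈ S')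
    {p : C(D.X, BL2 (D.ι → ℤ)) × C(D.X, ℂ)} (hp : p ∈ D.quantOn S) : star p ∈ D.quantOn S' := by
  induction hp using Submodule.span_induction with
  | mem p hp =>
    obtain ⟨r, hr, f, hf, rfl⟩ := hp
    have := symbol_mem_quantOn (hS r hr) hf.star
    rw [← star_symbol] at this
    exact this
  | zero => simp
  | add p q _ _ h h' => rw [star_add]; exact add_mem h h'
  | smul a p _ h => rw [star_smul]; exact Submodule.smul_mem _ _ h

theorem fst_mem_alg_of_mem_quantOn {S : Set (D.ι → ℤ)}
    {p : C(D.X, BL2 (D.ι → ℤ)) × C(D.X, ℂ)} (hp : p ∈ D.quantOn S) : p.1 ∈ D.alg := by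
  induction hp using Submodule.span_induction with
  | mem p hp =>
    obtain ⟨r, hr, f, hf, rfl⟩ := hp
    exact D.symbol_mem hf
  | zero => exact zero_mem _
  | add p q _ _ h h' => exact add_mem h h'
  | smul a p _ h => exact D.alg.smul_mem h a

/-- The isotypic component of degree `r` at `x`. -/
def component (r : D.ι → ℤ) (f : C(D.X, ℂ)) (x : D.X) : ℂ :=
  ∫ t, torusChar (-r) t * f (D.act t x) ∂haarProb (D.ι → Circle)

theorem integrable_component (r : D.ι → ℤ) (f : C(D.X, ℂ)) (x : D.X) :
    Integrable (fun t => torusChar (-r) t * f (D.act t x)) (haarProb (D.ι → Circle)) :=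
  integrable_of_continuous_of_compactSpace _ (by
    have := continuous_orbit x
    fun_prop)

theorem component_zero (r : D.ι → ℤ) (x : D.X) : component r 0 x = 0 := by
  simp [component]

theorem component_add (r : D.ι → ℤ) (f g : C(D.X, ℂ)) (x : D.X) :
    component r (f + g) x = component r f x + component r g x := by
  rw [component, component, component,
    ← integral_add (integrable_component r f x) (integrable_component r g x)]
  simp [mul_add]

theorem component_smul (r : D.ι → ℤ) (c : ℂ) (f : C(D.X, ℂ)) (x : D.X) :
    component r (c • f) x = c * component r f x := by
  rw [component, component, ← integral_const_mul]
  simp [mul_left_comm]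

theorem norm_component_le (r : D.ι → ℤ) (f : C(D.X, ℂ)) (x : D.X) :
    ‖component r f x‖ ≤ ‖f‖ := by
  have := norm_integral_le_of_norm_le_const (μ := haarProb (D.ι → Circle)) (C := ‖f‖)
    (f := fun t => torusChar (-r) t * f (D.act t x)) (Eventually.of_forall fun t => by
      rw [norm_mul, norm_torusChar, one_mul]
      exact f.norm_coe_le_norm _)
  simpa [component] using this

theorem IsIsotypic.component_eq {r : D.ι → ℤ} {f : C(D.X, ℂ)} (hf : D.IsIsotypic r f)
    (s : D.ι → ℤ) [Decidable (s = r)] (x : D.X) :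
    component s f x = if s = r then f x else 0 := by
  classical
  have : ∀ t, torusChar (-s) t * f (D.act t x) = torusChar (r - s) t * f x := fun t => by
    rw [isIsotypic_iff.1 hf, sub_eq_neg_add, torusChar_add]
    ring
  rw [component]
  simp only [this]
  rw [integral_mul_const, integral_torusChar]
  simp [sub_eq_zero, eq_comm]

/-- The operator of degree r moves the basis vector at n to n + r, so the (k, n) matrix coefficient
sees only the component of degree k - n. Hence f determines F. -/
theorem apply_basis_of_mem_quantOn {S : Set (D.ι → ℤ)}
    {p : C(D.X, BL2 (D.ι → ℤ)) × C(D.X, ℂ)} (hp : p ∈ D.quantOn S) (x : D.X) (n k : D.ι → ℤ) :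
    p.1 x (L2.basis n) k = bichar D.θ (k - n) n * component (k - n) p.2 x := by
  classical
  induction hp using Submodule.span_induction with
  | mem p hp =>
    obtain ⟨r, hr, f, hf, rfl⟩ := hp
    change f x * weyl D.θ r (L2.basis n) k = _
    rw [weyl_basis D.skew]
    change f x * (_ * L2.basis _ _) = _
    rw [hf.component_eq, L2.basis_apply]
    by_cases h : k = n + r
    · subst h
      simp [mul_comm]
    · rw [if_neg h, if_neg fun h' => h (by rw [← h']; simp)]
      simp
  | zero => simp [component_zero]
  | add p q _ _ h h' =>
    rw [Prod.snd_add, component_add, mul_add, ← h, ← h']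
    rfl
  | smul a p _ h =>
    rw [Prod.smul_snd, component_smul, mul_left_comm, ← h]
    rfl

/-- Every bicharacter equals 1 at the origin, so applying F(x) to the basis vector at 0 lists the
components of f at x without phases, and summing them restores f(x). Hence F determines f. -/
theorem hasSum_of_mem_quantOn {S : Set (D.ι → ℤ)}
    {p : C(D.X, BL2 (D.ι → ℤ)) × C(D.X, ℂ)} (hp : p ∈ D.quantOn S) (x : D.X) :
    HasSum (fun k => p.1 x (L2.basis 0) k) (p.2 x) := by
  classical
  induction hp using Submodule.span_induction with
  | mem p hp =>
    obtain ⟨r, hr, f, hf, rfl⟩ := hp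
    have : ∀ k, D.symbol r f x (L2.basis 0) k = if k = r then f x else 0 := fun k => by
      change f x * weyl D.θ r (L2.basis 0) k = _
      rw [weyl_basis D.skew, bichar_zero_right, one_smul, zero_add, L2.basis_apply]
      simp
    simp only [this]
    exact hasSum_ite_eq r (f x)
  | zero => exact hasSum_zero
  | add p q _ _ h h' => exact h.add h'
  | smul a p _ h => exact h.mul_left a

theorem quantOn_fst_unique {S : Set (D.ι → ℤ)} {F G : C(D.X, BL2 (D.ι → ℤ))} {f : C(D.X, ℂ)}
    (hF : (F, f) ∈ D.quantOn S) (hG : (G, f) ∈ D.quantOn S) : F = G := by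
  ext1 x
  refine L2.op_ext fun n => lp.ext (funext fun k => ?_)
  rw [apply_basis_of_mem_quantOn hF, apply_basis_of_mem_quantOn hG]

theorem quantOn_snd_unique {S : Set (D.ι → ℤ)} {F : C(D.X, BL2 (D.ι → ℤ))} {f g : C(D.X, ℂ)}
    (hf : (F, f) ∈ D.quantOn S) (hg : (F, g) ∈ D.quantOn S) : f = g := by
  ext1 x
  exact (hasSum_of_mem_quantOn hf x).unique (hasSum_of_mem_quantOn hg x)

end Isotypic

/-! ## Density of quantized algebras of isotypic functions -/

/-- A graded `*`-algebra of isotypic functions which separates points. -/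
structure SeparatingFamily (D : ToricDatum) (L : (D.ι → ℤ) → C(D.X, ℂ) → Prop) : Prop where
  isotypic {r f} : L r f → D.IsIsotypic r f
  zero r : L r 0
  one : L 0 1
  add {r f g} : L r f → L r g → L r (f + g)
  smul {r f} (c : ℂ) : L r f → L r (c • f)
  mul {r s f g} : L r f → L s g → L (r + s) (f * g)
  star {r f} : L r f → L (-r) (star f)
  separates {x y} : x ≠ y → ∃ r f, L r f ∧ f x ≠ f y

theorem norm_incl (D : ToricDatum) (a : D.CAlg) : ‖D.incl a‖ = ‖a‖ := rfl

theorem incl_injective (D : ToricDatum) : Function.Injective D.incl := Subtype.val_injective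

theorem isometry_incl (D : ToricDatum) : Isometry D.incl :=
  AddMonoidHomClass.isometry_of_norm D.incl D.norm_incl

theorem incl_elt (D : ToricDatum) {r : D.ι → ℤ} {f : C(D.X, ℂ)} (h : D.IsIsotypic r f) :
    D.incl (D.elt r f h) = D.symbol r f := rfl

namespace SeparatingFamily

variable {D : ToricDatum} {L : (D.ι → ℤ) → C(D.X, ℂ) → Prop}

/-- The `*`-algebra of functions spanned by a separating family. -/
def span (h : D.SeparatingFamily L) : StarSubalgebra ℂ C(D.X, ℂ) where
  __ := (Submodule.span ℂ {f | ∃ r, L r f}).toSubalgebra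
    (Submodule.subset_span ⟨0, h.one⟩) (by
      intro f g hf hg
      have := Submodule.mul_mem_mul hf hg
      rw [Submodule.span_mul_span] at this
      refine Submodule.span_mono ?_ this
      rintro _ ⟨f, ⟨r, hf⟩, g, ⟨s, hg⟩, rfl⟩
      exact ⟨_, h.mul hf hg⟩)
  star_mem' := by
    intro f hf
    change f ∈ Submodule.span ℂ _ at hf
    change Star.star f ∈ Submodule.span ℂ {f | ∃ r, L r f}
    induction hf using Submodule.span_induction with
    | mem f hf =>
      obtain ⟨r, hr⟩ := hf
      exact Submodule.subset_span ⟨_, h.star hr⟩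
    | zero => simp
    | add f g _ _ hf hg => rw [star_add]; exact add_mem hf hg
    | smul a f _ hf => rw [star_smul]; exact Submodule.smul_mem _ _ hf

/-- The projection to a single degree does not leave the family: on a member it is the identity or
zero. -/
theorem exists_component (h : D.SeparatingFamily L) {f : C(D.X, ℂ)} (hf : f ∈ h.span)
    (r : D.ι → ℤ) : ∃ g, L r g ∧ ∀ x, g x = component r f x := by
  classical
  change f ∈ Submodule.span ℂ _ at hf
  induction hf using Submodule.span_induction with
  | mem f hf =>
    obtain ⟨s, hs⟩ := hf
    by_cases hrs : r = s
    · subst hrs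
      exact ⟨f, hs, fun x => by rw [(h.isotypic hs).component_eq, if_pos rfl]⟩
    · exact ⟨0, h.zero r, fun x => by rw [(h.isotypic hs).component_eq, if_neg hrs]; rfl⟩
  | zero => exact ⟨0, h.zero r, fun x => by rw [component_zero]; rfl⟩
  | add f f' _ _ hf hf' =>
    obtain ⟨g, hg, hgf⟩ := hf
    obtain ⟨g', hg', hgf'⟩ := hf'
    exact ⟨g + g', h.add hg hg', fun x => by
      rw [component_add, ← hgf, ← hgf', ContinuousMap.add_apply]⟩
  | smul a f _ hf =>
    obtain ⟨g, hg, hgf⟩ := hf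
    exact ⟨a • g, h.smul a hg, fun x => by
      rw [component_smul, ← hgf, ContinuousMap.smul_apply, smul_eq_mul]⟩

/-- Stone–Weierstrass approximates f by a member of the span. Projecting to degree r is contractive
and fixes f, so the approximant may be replaced by its component of degree r. -/
theorem exists_norm_sub_lt (h : D.SeparatingFamily L) {r : D.ι → ℤ} {f : C(D.X, ℂ)}
    (hf : D.IsIsotypic r f) {ε : ℝ} (hε : 0 < ε) : ∃ g, L r g ∧ ‖f - g‖ < ε := by
  classical
  have htop : h.span.topologicalClosure = ⊤ := by
    refine ContinuousMap.starSubalgebra_topologicalClosure_eq_top_of_separatesPoints _ ?_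
    intro x y hxy
    obtain ⟨r, f, hf, hne⟩ := h.separates hxy
    exact ⟨f, ⟨f, Submodule.subset_span ⟨r, hf⟩, rfl⟩, hne⟩
  have hmem : f ∈ closure (h.span : Set C(D.X, ℂ)) := by
    rw [← StarSubalgebra.topologicalClosure_coe, htop]
    trivial
  obtain ⟨p, hp, hpf⟩ := Metric.mem_closure_iff.1 hmem ε hε
  obtain ⟨g, hg, hgp⟩ := h.exists_component hp r
  refine ⟨g, hg, lt_of_le_of_lt ?_ hpf⟩
  rw [dist_eq_norm]
  refine (ContinuousMap.norm_le _ (norm_nonneg _)).2 fun x => ?_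
  have h1 : component r (f - p) x = f x - g x := by
    rw [hgp, sub_eq_add_neg, component_add, ← neg_one_smul ℂ p, component_smul,
      hf.component_eq, if_pos rfl]
    ring
  rw [ContinuousMap.sub_apply, ← h1]
  exact norm_component_le _ _ _

/-- Within one degree quantization is contractive, so uniform approximation of isotypic functions by
members of the family carries over to the deformed algebra, where isotypic elements generate a dense
subalgebra. This is the density principle behind all later comparisons of homomorphisms. -/
theorem eq_top (h : D.SeparatingFamily L) (S : StarSubalgebra ℂ D.CAlg)
    (hS : IsClosed (S : Set D.CAlg)) (hL : ∀ r f (hf : L r f), D.elt r f (h.isotypic hf) ∈ S) :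
    S = ⊤ := by
  have h1 : ∀ r f (hf : D.IsIsotypic r f), D.elt r f hf ∈ S := by
    intro r f hf
    rw [← SetLike.mem_coe, ← hS.closure_eq, Metric.mem_closure_iff]
    intro ε hε
    obtain ⟨g, hg, hlt⟩ := h.exists_norm_sub_lt hf hε
    refine ⟨_, hL r g hg, ?_⟩
    rw [dist_eq_norm, ← norm_incl, map_sub, incl_elt, incl_elt]
    refine lt_of_le_of_lt ?_ hlt
    have : D.symbol r f - D.symbol r g = D.symbol r (f - g) := by
      rw [sub_eq_add_neg f, symbol_add, ← neg_one_smul ℂ g, symbol_smul, neg_one_smul,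
        sub_eq_add_neg]
    rw [this]
    exact norm_symbol_le _ _
  have h2 : StarAlgebra.adjoin ℂ {a | ∃ r f, D.IsIsotypic r f ∧ a = D.symbol r f} ≤
      S.map D.incl := by
    refine StarAlgebra.adjoin_le ?_
    rintro _ ⟨r, f, hf, rfl⟩
    exact ⟨_, h1 r f hf, rfl⟩
  refine eq_top_iff.2 fun a _ => ?_
  rw [← SetLike.mem_coe, ← hS.closure_eq, Metric.mem_closure_iff]
  intro ε hε
  obtain ⟨b, hb, hab⟩ := Metric.mem_closure_iff.1
    (show D.incl a ∈ closure (StarAlgebra.adjoin ℂ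
      {a | ∃ r f, D.IsIsotypic r f ∧ a = D.symbol r f} : Set C(D.X, BL2 (D.ι → ℤ))) from
      D.incl_mem a) ε hε
  obtain ⟨c, hc, rfl⟩ := h2 hb
  exact ⟨c, hc, by rwa [← D.isometry_incl.dist_eq]⟩

theorem hom_ext (h : D.SeparatingFamily L) {B : Type*} [CStarAlgebra B] {φ ψ : D.CAlg →⋆ₐ[ℂ] B}
    (hL : ∀ r f (hf : L r f), φ (D.elt r f (h.isotypic hf)) = ψ (D.elt r f (h.isotypic hf))) :
    φ = ψ := by
  have := h.eq_top (StarAlgHom.equalizer φ ψ)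
    (isClosed_eq (continuous_starAlgHom φ) (continuous_starAlgHom ψ)) hL
  ext a
  exact (this ▸ StarSubalgebra.mem_top : a ∈ StarAlgHom.equalizer φ ψ)

end SeparatingFamily

end ToricDatum

/-! ## Homomorphisms from contractive graphs -/

/-- A `*`-subalgebra `S ⊆ A × B` with `‖b‖ ≤ ‖a‖` on `S` and dense first projection is contained in
the graph of a `*`-homomorphism. -/
theorem exists_starAlgHom_of_graph {A B : Type*} [CStarAlgebra A] [CStarAlgebra B]
    (S : StarSubalgebra ℂ (A × B)) (hS : ∀ p ∈ S, ‖p.2‖ ≤ ‖p.1‖)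
    (hd : ∀ A' : StarSubalgebra ℂ A, IsClosed (A' : Set A) → (∀ p ∈ S, p.1 ∈ A') → A' = ⊤) :
    ∃ φ : A →⋆ₐ[ℂ] B, ∀ p ∈ S, φ p.1 = p.2 := by
  let T := S.topologicalClosure
  have hT : ∀ p ∈ T, ‖p.2‖ ≤ ‖p.1‖ := by
    have hc : IsClosed {p : A × B | ‖p.2‖ ≤ ‖p.1‖} := isClosed_le (by fun_prop) (by fun_prop)
    exact fun p hp => closure_minimal (fun q hq => hS q hq) hc hp
  -- On the closure of S the norm of a pair is the norm of its first entry. The first projection is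
  -- therefore isometric, its range is closed, and by density it is all of A; inverting it and
  -- projecting to B gives the homomorphism.
  let f : T →⋆ₐ[ℂ] A := (StarAlgHom.fst ℂ A B).comp T.subtype
  have hnorm : ∀ p : T, ‖f p‖ = ‖p‖ := fun p => by
    change ‖(p : A × B).1‖ = ‖(p : A × B)‖
    rw [Prod.norm_def, max_eq_left (hT _ p.2)]
  have hiso : Isometry f := AddMonoidHomClass.isometry_of_norm f hnorm
  have hTc : IsClosed (T : Set (A × B)) := StarSubalgebra.isClosed_topologicalClosure _
  have : CompleteSpace T := hTc.completeSpace_coe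
  have hsurj : Function.Surjective f := fun a => by
    have hcl : IsClosed (Set.range f) := hiso.isClosedEmbedding.isClosed_range
    have h := hd f.range hcl fun p hp =>
      ⟨⟨p, S.le_topologicalClosure hp⟩, rfl⟩
    exact (h ▸ StarSubalgebra.mem_top : a ∈ f.range)
  let e := StarAlgEquiv.ofBijective f ⟨hiso.injective, hsurj⟩
  refine ⟨((StarAlgHom.snd ℂ A B).comp T.subtype).comp (e.symm : A →⋆ₐ[ℂ] T), fun p hp => ?_⟩
  have h1 : e ⟨p, S.le_topologicalClosure hp⟩ = p.1 := rfl
  change ((e.symm p.1 : T) : A × B).2 = p.2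
  rw [← h1, StarAlgEquiv.symm_apply_apply]

/-! ## Phase functions -/

/-- A bicharacter which is trivial on a subgroup `M` is, on `M`, the coboundary of a phase. -/
theorem exists_phase {G : Type*} [AddCommGroup G] (M : AddSubgroup G) (σ : G → G → ℂ)
    (hn : ∀ x y, ‖σ x y‖ = 1) (hl : ∀ x x' y, σ (x + x') y = σ x y * σ x' y)
    (hr : ∀ x y y', σ x (y + y') = σ x y * σ x y') (hM : ∀ x ∈ M, ∀ y ∈ M, σ x y = 1) :
    ∃ c : G → ℂ, (∀ x, ‖c x‖ = 1) ∧ ∀ μ ∈ M, ∀ x, c (x + μ) = σ μ x * c x := by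
  let o : G → G := fun x => (QuotientAddGroup.mk x : G ⧸ M).out
  have ho : ∀ x, x - o x ∈ M := fun x => by
    have := (QuotientAddGroup.eq (s := M)).1 (QuotientAddGroup.out_eq' (QuotientAddGroup.mk x : G ⧸ M))
    rwa [neg_add_eq_sub] at this
  -- Here o x is a chosen representative of the coset of x. Adding μ ∈ M keeps o x and multiplies
  -- the value by σ(μ, o x), which is σ(μ, x) because σ is trivial on M × M.
  refine ⟨fun x => σ (x - o x) (o x), fun x => hn _ _, fun μ hμ x => ?_⟩
  have h1 : o (x + μ) = o x := by
    refine congrArg Quotient.out ?_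
    rw [QuotientAddGroup.mk_add_of_mem x hμ]
  have h2 : σ μ x = σ μ (o x) := by
    conv_lhs => rw [← sub_add_cancel x (o x), hr, hM μ hμ _ (ho x), one_mul]
  change σ (x + μ - o (x + μ)) (o (x + μ)) = σ μ x * σ (x - o x) (o x)
  rw [h1, h2, ← hl]
  congr 1
  abel

/-! ## Følner vectors -/

namespace L2

variable {I : Type}

/-- Pointwise multiplication by a function of modulus one. -/
def phaseMul (c : I → ℂ) (hc : ∀ i, ‖c i‖ = 1) (ξ : L2 I) : L2 I :=
  ⟨fun i => c i * ξ i, memlp (by simpa [hc] using (hasSum_sq ξ).summable)⟩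

theorem phaseMul_apply (c : I → ℂ) (hc : ∀ i, ‖c i‖ = 1) (ξ : L2 I) (i : I) :
    phaseMul c hc ξ i = c i * ξ i := rfl

theorem norm_eq_of_norm_apply_eq {ξ η : L2 I} (h : ∀ i, ‖ξ i‖ = ‖η i‖) : ‖ξ‖ = ‖η‖ := by
  have h1 := hasSum_sq ξ
  simp only [h] at h1
  exact (sq_eq_sq₀ (norm_nonneg _) (norm_nonneg _)).1 (h1.unique (hasSum_sq η))

theorem norm_phaseMul (c : I → ℂ) (hc : ∀ i, ‖c i‖ = 1) (ξ : L2 I) : ‖phaseMul c hc ξ‖ = ‖ξ‖ :=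
  norm_eq_of_norm_apply_eq fun i => by rw [phaseMul_apply, norm_mul, hc, one_mul]

theorem sum_basis_apply [DecidableEq I] (s : Finset I) (j : I) :
    (∑ i ∈ s, basis i : L2 I) j = if j ∈ s then 1 else 0 := by
  have : (∑ i ∈ s, basis i : L2 I) j = ∑ i ∈ s, basis i j := by
    rw [lp.coeFn_sum, Finset.sum_apply]
  rw [this]
  simp only [basis_apply]
  simp

theorem inner_sum_basis (s : Finset I) (ξ : L2 I) :
    ⟪(∑ i ∈ s, basis i : L2 I), ξ⟫_ℂ = ∑ i ∈ s, ξ i := by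
  rw [sum_inner]
  simp only [inner_basis_left]

end L2

/-- The interval [0, N + 1) and its translate by r overlap in N + 1 - |r| points once N is large. -/
theorem tendsto_card_Ico_inter (r : ℤ) :
    Tendsto (fun N : ℕ => (((Finset.Ico (max 0 r) (min (N + 1) (N + 1 + r))).card : ℝ) / (N + 1)))
      atTop (𝓝 1) := by
  have h1 : Tendsto (fun N : ℕ => 1 - |(r : ℝ)| * (1 / ((N : ℝ) + 1))) atTop (𝓝 1) := by
    have := (tendsto_one_div_add_atTop_nhds_zero_nat (𝕜 := ℝ)).const_mul |(r : ℝ)|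
    simpa using this.const_sub 1
  refine h1.congr' ?_
  -- For N ≥ |r| the overlap is nonempty, so its cardinality is not truncated at zero.
  filter_upwards [eventually_ge_atTop r.natAbs] with N hN
  have hz : ((Finset.Ico (max 0 r) (min (N + 1) (N + 1 + r))).card : ℤ) = N + 1 - |r| := by
    rw [Int.card_Ico, Int.toNat_of_nonneg] <;> grind
  have hr : ((Finset.Ico (max 0 r) (min (N + 1) (N + 1 + r))).card : ℝ) = N + 1 - |(r : ℝ)| := by
    exact_mod_cast hz
  rw [hr]
  have : (N : ℝ) + 1 ≠ 0 := by positivity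
  field_simp

/-- `ℤ^ι` is amenable: there are almost translation invariant unit vectors in `ℓ²(ℤ^ι)`. -/
theorem exists_folner (ι : Type) [Fintype ι] : ∃ η : ℕ → L2 (ι → ℤ), (∀ N, ‖η N‖ = 1) ∧
    ∀ r, Tendsto (fun N => weyl 0 r (η N) - η N) atTop (𝓝 0) := by
  classical
  let B : ℕ → Finset (ι → ℤ) := fun N => Fintype.piFinset fun _ => Finset.Ico 0 (N + 1 : ℤ)
  have hB : ∀ N, ((B N).card : ℝ) = ((N : ℝ) + 1) ^ Fintype.card ι := fun N => by
    rw [Fintype.card_piFinset]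
    simp
  have hBpos : ∀ N, 0 < ((B N).card : ℝ) := fun N => by rw [hB]; positivity
  let b : ℕ → L2 (ι → ℤ) := fun N => ∑ i ∈ B N, L2.basis i
  have hb : ∀ N, ‖b N‖ ^ 2 = (B N).card := fun N => by
    have h : ((‖b N‖ ^ 2 : ℝ) : ℂ) = (((B N).card : ℝ) : ℂ) := by
      have := inner_self_eq_norm_sq_to_K (𝕜 := ℂ) (b N)
      push_cast
      refine this.symm.trans ?_
      rw [L2.inner_sum_basis]
      simp only [b, L2.sum_basis_apply]
      simp
    exact Complex.ofReal_injective h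
  have hin : ∀ r N, ⟪b N, weyl 0 r (b N)⟫_ℂ =
      ∏ i, ((Finset.Ico (max 0 (r i)) (min (N + 1) (N + 1 + r i))).card : ℂ) := fun r N => by
    rw [L2.inner_sum_basis]
    have h1 : ∀ k, weyl 0 r (b N) k = if k - r ∈ B N then 1 else 0 := fun k => by
      rw [weyl_apply, L2.sum_basis_apply]
      simp [bichar]
    simp only [h1]
    rw [Finset.sum_boole, ← Nat.cast_prod, ← Fintype.card_piFinset]
    congr 2
    ext k
    simp only [B, Finset.mem_filter, Fintype.mem_piFinset, Finset.mem_Ico, Pi.sub_apply,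
      ← forall_and]
    refine forall_congr' fun i => ?_
    grind
  refine ⟨fun N => ((‖b N‖⁻¹ : ℝ) : ℂ) • b N, fun N => ?_, fun r => ?_⟩
  · have : ‖b N‖ ≠ 0 := fun h => by
      have := hb N
      rw [h] at this
      have := hBpos N
      simp_all
    rw [norm_smul, Complex.norm_real, norm_inv, norm_norm, inv_mul_cancel₀ this]
  · rw [tendsto_zero_iff_norm_tendsto_zero]
    have hlim : Tendsto (fun N : ℕ => 2 - 2 * ∏ i,
        (((Finset.Ico (max 0 (r i)) (min (N + 1) (N + 1 + r i))).card : ℝ) / (N + 1)))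
        atTop (𝓝 0) := by
      have := tendsto_finsetProd (Finset.univ : Finset ι) fun i _ => tendsto_card_Ico_inter (r i)
      have := (this.const_mul 2).const_sub 2
      simpa using this
    -- With zero deformation matrix the Weyl operator is plain translation. For the normalized
    -- indicator η of a box, ‖Uη - η‖² = 2 - 2 Re⟨η, Uη⟩, and the inner product is the relative
    -- overlap of the box with its translate, a product over coordinates.
    have hsq : ∀ N, ‖weyl 0 r (((‖b N‖⁻¹ : ℝ) : ℂ) • b N) - ((‖b N‖⁻¹ : ℝ) : ℂ) • b N‖ ^ 2 =
        2 - 2 * ∏ i,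
        (((Finset.Ico (max 0 (r i)) (min (N + 1) (N + 1 + r i))).card : ℝ) / (N + 1)) := fun N => by
      rw [map_smul, ← smul_sub, norm_smul, mul_pow, Complex.norm_real, norm_inv, norm_norm,
        inv_pow, norm_sub_sq (𝕜 := ℂ), norm_weyl_apply, inner_re_symm, hin, hb,
        Finset.prod_div_distrib]
      have h2 : (∏ i, ((Finset.Ico (max 0 (r i)) (min (N + 1) (N + 1 + r i))).card : ℂ)) =
          ((∏ i, ((Finset.Ico (max 0 (r i)) (min (N + 1) (N + 1 + r i))).card : ℝ) : ℝ) : ℂ) := by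
        push_cast
        rfl
      rw [h2]
      have h3 : ∏ _i : ι, ((N : ℝ) + 1) = (B N).card := by rw [hB]; simp
      rw [h3]
      have := (hBpos N).ne'
      change ((B N).card : ℝ)⁻¹ * ((B N).card - 2 * (∏ i, _) + (B N).card) = _
      field_simp
      ring
    have := (Real.continuous_sqrt.tendsto 0).comp hlim
    rw [Real.sqrt_zero] at this
    refine this.congr fun N => ?_
    rw [Function.comp_apply, ← hsq, Real.sqrt_sq (norm_nonneg _)]

/-! ## Square integrable functions on the torus -/

section TorusL2

variable (κ : Type) [Fintype κ] (H : Type) [NormedAddCommGroup H] [InnerProductSpace ℂ H]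

/-- Square integrable `H`-valued functions on the torus. -/
abbrev TorusL2 : Type := Lp H 2 (haarProb (κ → Circle))

variable {κ H}

/-- The function `t ↦ t^n v`. -/
def charVec (n : κ → ℤ) (v : H) : TorusL2 κ H :=
  ContinuousMap.toLp (E := H) 2 (haarProb (κ → Circle)) ℂ ⟨fun t => torusChar n t • v, by fun_prop⟩

theorem coeFn_charVec (n : κ → ℤ) (v : H) :
    charVec n v =ᵐ[haarProb (κ → Circle)] fun t => torusChar n t • v :=
  ContinuousMap.coeFn_toLp _ _

theorem charVec_sub (n : κ → ℤ) (v w : H) : charVec n (v - w) = charVec n v - charVec n w := by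
  refine Lp.ext ?_
  filter_upwards [coeFn_charVec n v, coeFn_charVec n w, coeFn_charVec n (v - w),
    Lp.coeFn_sub (charVec n v) (charVec n w)] with t h1 h2 h3 h4
  rw [h3, h4, Pi.sub_apply, h1, h2, smul_sub]

theorem charVec_smul (n : κ → ℤ) (c : ℂ) (v : H) : charVec n (c • v) = c • charVec n v := by
  refine Lp.ext ?_
  filter_upwards [coeFn_charVec n v, coeFn_charVec n (c • v),
    Lp.coeFn_smul c (charVec n v)] with t h1 h2 h3
  rw [h2, h3, Pi.smul_apply, h1, smul_comm]

theorem inner_charVec [DecidableEq κ] (m n : κ → ℤ) (v w : H) :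
    ⟪charVec m v, charVec n w⟫_ℂ = if n = m then ⟪v, w⟫_ℂ else 0 := by
  rw [L2.inner_def]
  have : ∫ t, ⟪charVec m v t, charVec n w t⟫_ℂ ∂haarProb (κ → Circle) =
      ∫ t, torusChar (n - m) t * ⟪v, w⟫_ℂ ∂haarProb (κ → Circle) := by
    refine integral_congr_ae ?_
    filter_upwards [coeFn_charVec m v, coeFn_charVec n w] with t h1 h2
    rw [h1, h2, inner_smul_left, inner_smul_right, sub_eq_add_neg, torusChar_add, torusChar_neg]
    ring
  rw [this, integral_mul_const, integral_torusChar]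
  simp [sub_eq_zero]

theorem norm_charVec (n : κ → ℤ) (v : H) : ‖charVec n v‖ = ‖v‖ := by
  classical
  have h := inner_charVec n n v v
  rw [if_pos rfl, inner_self_eq_norm_sq_to_K, inner_self_eq_norm_sq_to_K] at h
  have h' : ‖charVec n v‖ ^ 2 = ‖v‖ ^ 2 := by exact_mod_cast h
  exact (sq_eq_sq₀ (norm_nonneg _) (norm_nonneg _)).1 h'

theorem orthonormal_charVec {v : (κ → ℤ) → H} (hv : ∀ n, ‖v n‖ = 1) :
    Orthonormal ℂ fun n => charVec n (v n) := by
  classical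
  refine ⟨fun n => by rw [norm_charVec, hv], fun m n hmn => ?_⟩
  dsimp only
  rw [inner_charVec, if_neg (Ne.symm hmn)]

variable [CompleteSpace H]

/-- The isometry of `ℓ²(ℤ^κ)` into `L²(𝕋^κ, H)` given by a family of unit vectors. -/
def charIsometry (v : (κ → ℤ) → H) (hv : ∀ n, ‖v n‖ = 1) :
    L2 (κ → ℤ) →ₗᵢ[ℂ] TorusL2 κ H :=
  (orthonormal_charVec hv).orthogonalFamily.linearIsometry

theorem charIsometry_basis (v : (κ → ℤ) → H) (hv : ∀ n, ‖v n‖ = 1) (n : κ → ℤ) :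
    charIsometry v hv (L2.basis n) = charVec n (v n) := by
  classical
  have := (orthonormal_charVec hv).orthogonalFamily.linearIsometry_apply_single (i := n) (1 : ℂ)
  rw [L2.basis, charIsometry]
  convert this using 1
  · congr!
  · simp

/-- Multiplication by a continuous operator valued function on the torus. -/
def mulOp (A : C(κ → Circle, H →L[ℂ] H)) : TorusL2 κ H →L[ℂ] TorusL2 κ H :=
  (ContinuousLinearMap.id ℂ (H →L[ℂ] H)).holderL (haarProb (κ → Circle)) ⊤ 2 2
    (ContinuousMap.toLp (E := H →L[ℂ] H) ⊤ (haarProb (κ → Circle)) ℂ A)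

theorem coeFn_mulOp (A : C(κ → Circle, H →L[ℂ] H)) (f : TorusL2 κ H) :
    mulOp A f =ᵐ[haarProb (κ → Circle)] fun t => A t (f t) := by
  have h1 := (ContinuousLinearMap.id ℂ (H →L[ℂ] H)).coeFn_holder (r := 2)
    (ContinuousMap.toLp (E := H →L[ℂ] H) ⊤ (haarProb (κ → Circle)) ℂ A) f
  filter_upwards [h1, ContinuousMap.coeFn_toLp (E := H →L[ℂ] H) (p := ⊤) (𝕜 := ℂ)
    (haarProb (κ → Circle)) A] with t ht1 ht2
  refine ht1.trans ?_
  rw [ht2]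
  rfl

theorem mulOp_zero : mulOp (0 : C(κ → Circle, H →L[ℂ] H)) = 0 := by
  rw [mulOp, map_zero, map_zero]

theorem mulOp_add (A B : C(κ → Circle, H →L[ℂ] H)) : mulOp (A + B) = mulOp A + mulOp B := by
  rw [mulOp, map_add, map_add]
  rfl

theorem mulOp_smul (c : ℂ) (A : C(κ → Circle, H →L[ℂ] H)) : mulOp (c • A) = c • mulOp A := by
  rw [mulOp, map_smul, map_smul]
  rfl

theorem norm_mulOp_apply_le (A : C(κ → Circle, H →L[ℂ] H)) {c : ℝ} (hc : ∀ t, ‖A t‖ ≤ c)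
    (f : TorusL2 κ H) : ‖mulOp A f‖ ≤ c * ‖f‖ := by
  refine Lp.norm_le_mul_norm_of_ae_le_mul ?_
  filter_upwards [coeFn_mulOp A f] with t ht
  rw [ht]
  exact (A t).le_of_opNorm_le (hc t) _

theorem mulOp_charVec (m n : κ → ℤ) (T : H →L[ℂ] H) (v : H) :
    mulOp ⟨fun t => torusChar m t • T, by fun_prop⟩ (charVec n v) = charVec (n + m) (T v) := by
  refine Lp.ext ?_
  filter_upwards [coeFn_mulOp ⟨fun t => torusChar m t • T, by fun_prop⟩ (charVec n v),
    coeFn_charVec n v, coeFn_charVec (n + m) (T v)] with t h1 h2 h3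
  rw [h1, h2, h3]
  change torusChar m t • T (torusChar n t • v) = _
  rw [map_smul, smul_smul, torusChar_add, mul_comm]

end TorusL2

/-! ## Asymptotic intertwiners -/

/-- The operators `a` and `b` are asymptotically intertwined by the isometries `V N`. -/
def AsympIntertwines {H K : Type} [NormedAddCommGroup H] [InnerProductSpace ℂ H]
    [NormedAddCommGroup K] [InnerProductSpace ℂ K] (V : ℕ → H →ₗᵢ[ℂ] K) (a : K →L[ℂ] K)
    (b : H →L[ℂ] H) : Prop :=
  ∀ ξ, Tendsto (fun N => a (V N ξ) - V N (b ξ)) atTop (𝓝 0)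

namespace AsympIntertwines

variable {H K : Type} [NormedAddCommGroup H] [InnerProductSpace ℂ H]
    [NormedAddCommGroup K] [InnerProductSpace ℂ K] {V : ℕ → H →ₗᵢ[ℂ] K} {a a' : K →L[ℂ] K}
    {b b' : H →L[ℂ] H}

theorem zero : AsympIntertwines V (0 : K →L[ℂ] K) (0 : H →L[ℂ] H) := fun ξ => by simp

theorem add (h : AsympIntertwines V a b) (h' : AsympIntertwines V a' b') :
    AsympIntertwines V (a + a') (b + b') := fun ξ => by
  have := (h ξ).add (h' ξ)
  rw [add_zero] at this
  refine this.congr fun N => ?_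
  simp only [add_apply, map_add]
  abel

theorem smul (c : ℂ) (h : AsympIntertwines V a b) : AsympIntertwines V (c • a) (c • b) :=
  fun ξ => by
    have := (h ξ).const_smul c
    rw [smul_zero] at this
    refine this.congr fun N => ?_
    simp only [smul_apply, map_smul, smul_sub]

/-- Since the V N are isometric, ‖b ξ‖ is within a vanishing error of ‖a (V N ξ)‖, which is at most
c ‖ξ‖. -/
theorem norm_le (h : AsympIntertwines V a b) {c : ℝ} (hc : 0 ≤ c) (ha : ∀ f, ‖a f‖ ≤ c * ‖f‖) :
    ‖b‖ ≤ c := by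
  refine b.opNorm_le_bound hc fun ξ => ?_
  have h1 := (tendsto_zero_iff_norm_tendsto_zero.1 (h ξ)).const_add (c * ‖ξ‖)
  rw [add_zero] at h1
  refine ge_of_tendsto h1 (Eventually.of_forall fun N => ?_)
  calc ‖b ξ‖ = ‖V N (b ξ)‖ := ((V N).norm_map _).symm
    _ = ‖a (V N ξ) - (a (V N ξ) - V N (b ξ))‖ := by rw [sub_sub_cancel]
    _ ≤ ‖a (V N ξ)‖ + ‖a (V N ξ) - V N (b ξ)‖ := norm_sub_le _ _
    _ ≤ c * ‖ξ‖ + ‖a (V N ξ) - V N (b ξ)‖ := by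
      gcongr
      exact (ha _).trans_eq (by rw [(V N).norm_map])

/-- The defects are bounded by ‖a‖ + ‖b‖ uniformly in N, so the vectors on which they tend to zero
form a closed subspace. -/
theorem of_basis {I : Type} {V : ℕ → L2 I →ₗᵢ[ℂ] K} {b : BL2 I}
    (h : ∀ i, Tendsto (fun N => a (V N (L2.basis i)) - V N (b (L2.basis i))) atTop (𝓝 0)) :
    AsympIntertwines V a b := by
  let S : Submodule ℂ (L2 I) :=
    { carrier := {ξ | Tendsto (fun N => a (V N ξ) - V N (b ξ)) atTop (𝓝 0)}
      zero_mem' := by simp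
      add_mem' := by
        intro ξ η hξ hη
        have := Tendsto.add hξ hη
        rw [add_zero] at this
        refine this.congr fun N => ?_
        simp only [map_add]
        abel
      smul_mem' := by
        intro c ξ hξ
        have := Tendsto.const_smul hξ c
        rw [smul_zero] at this
        refine this.congr fun N => ?_
        simp only [map_smul, smul_sub] }
  have hS : IsClosed (S : Set (L2 I)) := by
    rw [← closure_subset_iff_isClosed]
    intro ξ hξ
    change Tendsto _ _ _
    rw [tendsto_zero_iff_norm_tendsto_zero, Metric.tendsto_nhds]
    intro ε hε
    have hpos : 0 < ‖a‖ + ‖b‖ + 1 := by positivity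
    obtain ⟨η, hη, hd⟩ := Metric.mem_closure_iff.1 hξ (ε / 2 / (‖a‖ + ‖b‖ + 1)) (by positivity)
    have hη' := Metric.tendsto_nhds.1 (tendsto_zero_iff_norm_tendsto_zero.1 hη) (ε / 2) (by positivity)
    filter_upwards [hη'] with N hN
    rw [Real.dist_0_eq_abs, abs_norm] at hN ⊢
    have hdec : a (V N ξ) - V N (b ξ) = (a (V N (ξ - η)) - V N (b (ξ - η))) +
        (a (V N η) - V N (b η)) := by
      simp only [map_sub]
      abel
    have h1 : ‖a (V N (ξ - η)) - V N (b (ξ - η))‖ ≤ (‖a‖ + ‖b‖ + 1) * ‖ξ - η‖ := by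
      calc _ ≤ ‖a (V N (ξ - η))‖ + ‖V N (b (ξ - η))‖ := norm_sub_le _ _
        _ ≤ ‖a‖ * ‖ξ - η‖ + ‖b‖ * ‖ξ - η‖ := by
          gcongr
          · exact (a.le_opNorm _).trans_eq (by rw [(V N).norm_map])
          · rw [(V N).norm_map]
            exact b.le_opNorm _
        _ ≤ _ := by nlinarith [norm_nonneg (ξ - η)]
    rw [dist_eq_norm, lt_div_iff₀ hpos] at hd
    calc _ ≤ _ := hdec ▸ norm_add_le _ _
      _ < ε / 2 + ε / 2 := by
        refine add_lt_add (lt_of_le_of_lt h1 ?_) hN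
        linarith
      _ = ε := add_halves ε
  exact fun ξ => L2.mem_of_isClosed S hS h ξ

end AsympIntertwines

/-- Let `M` be a group of pairs of degrees on which the bicharacters of `θ'` and `θ` agree. Then
the Weyl operators of `θ'` are asymptotically contained in those of `θ` times characters. -/
theorem exists_weyl_intertwiner {ι κ : Type} [Fintype ι] [Fintype κ] {θ : Matrix ι ι ℝ}
    {θ' : Matrix κ κ ℝ} (hθ : θᵀ = -θ) (hθ' : θ'ᵀ = -θ') (M : AddSubgroup ((κ → ℤ) × (ι → ℤ)))
    (hM : ∀ p ∈ M, ∀ q ∈ M, bichar θ' p.1 q.1 = bichar θ p.2 q.2) :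
    ∃ V : ℕ → L2 (κ → ℤ) →ₗᵢ[ℂ] TorusL2 κ (L2 (ι → ℤ)), ∀ p ∈ M,
      AsympIntertwines V (mulOp ⟨fun t => torusChar p.1 t • weyl θ p.2, by fun_prop⟩)
        (weyl θ' p.1) := by
  obtain ⟨η, hη, hfol⟩ := exists_folner ι
  -- The ratio of the two bicharacters is a bicharacter on all pairs of degrees which is trivial on
  -- M by `hM`.
  obtain ⟨c, hc, hcM⟩ := exists_phase M
    (fun p q => bichar θ p.2 q.2 * (bichar θ' p.1 q.1)⁻¹)
    (fun p q => by rw [norm_mul, norm_inv, norm_bichar, norm_bichar, inv_one, one_mul])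
    (fun p p' q => by
      rw [Prod.snd_add, Prod.fst_add, bichar_add_left, bichar_add_left, mul_inv]
      ring)
    (fun p q q' => by
      rw [Prod.snd_add, Prod.fst_add, bichar_add_right, bichar_add_right, mul_inv]
      ring)
    (fun p hp q hq => by
      rw [hM p hp q hq]
      exact mul_inv_cancel₀ (bichar_ne_zero _ _ _))
  -- The basis vector at n will go to t^n times the Følner vector twisted by the phase b ↦ c(n, b).
  -- The factors t^n keep the images orthogonal.
  let v : ℕ → (κ → ℤ) → L2 (ι → ℤ) := fun N n =>
    L2.phaseMul (fun b => c (n, b)) (fun b => hc _) (η N)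
  have hv : ∀ N n, ‖v N n‖ = 1 := fun N n => by rw [L2.norm_phaseMul, hη]
  refine ⟨fun N => charIsometry (v N) (hv N), fun p hp => AsympIntertwines.of_basis fun n => ?_⟩
  -- The quasi-periodicity of c in the direction p trades the bicharacter of θ, which depends on the
  -- position b, for the bicharacter of θ' at n. What remains is a plain translate of the Følner
  -- vector carrying the phase that belongs to n + p.1.
  have key : ∀ N, weyl θ p.2 (v N n) = bichar θ' p.1 n •
      L2.phaseMul (fun b => c (n + p.1, b)) (fun b => hc _) (weyl 0 p.2 (η N)) := fun N => by
    refine lp.ext (funext fun b => ?_)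
    change _ = bichar θ' p.1 n * L2.phaseMul _ _ (weyl 0 p.2 (η N)) b
    rw [weyl_apply, L2.phaseMul_apply, L2.phaseMul_apply, weyl_apply]
    have h1 := hcM p hp (n, b - p.2)
    have h2 : (n, b - p.2) + p = (n + p.1, b) := Prod.ext rfl (sub_add_cancel _ _)
    rw [h2] at h1
    have h3 : bichar θ p.2 (b - p.2) = bichar θ p.2 b := by
      rw [sub_eq_add_neg, bichar_add_right, bichar_neg_right, bichar_self hθ, inv_one, mul_one]
    have h4 : bichar (0 : Matrix ι ι ℝ) p.2 b = 1 := by simp [bichar]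
    dsimp only at h1
    rw [h1, h3, h4]
    have := bichar_ne_zero θ' p.1 n
    field_simp
  rw [tendsto_zero_iff_norm_tendsto_zero]
  refine (tendsto_zero_iff_norm_tendsto_zero.1 (hfol p.2)).congr fun N => ?_
  rw [charIsometry_basis, mulOp_charVec, weyl_basis hθ', map_smul, charIsometry_basis, key,
    charVec_smul, ← smul_sub, ← charVec_sub, norm_smul, norm_bichar, one_mul, norm_charVec]
  refine L2.norm_eq_of_norm_apply_eq fun b => ?_
  change ‖_‖ = ‖L2.phaseMul _ _ (weyl 0 p.2 (η N)) b - L2.phaseMul _ _ (η N) b‖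
  rw [L2.phaseMul_apply, L2.phaseMul_apply, ← mul_sub, norm_mul, hc, one_mul]
  rfl

namespace ToricDatum

/-! ## Quantized maps -/

/-- A continuous map `E.X → D.X` together with a relation between the degrees of `D` and those of
`E` which respects the bicharacters, such that the isotypic functions on `D.X` whose pullbacks have
components of related degrees only separate points. It induces a homomorphism of the deformed
algebras. -/
structure QMap (D E : ToricDatum) where
  map : C(E.X, D.X)
  rel : AddSubgroup ((E.ι → ℤ) × (D.ι → ℤ))
  isotropic : ∀ p ∈ rel, ∀ q ∈ rel, bichar E.θ p.1 q.1 = bichar D.θ p.2 q.2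
  separates : ∀ x y : D.X, x ≠ y → ∃ r f, (D.IsIsotypic r f ∧
    ∃ b, (b, f.comp map) ∈ E.quantOn {m | (m, r) ∈ rel}) ∧ f x ≠ f y

namespace QMap

variable {D E : ToricDatum} (Q : D.QMap E)

/-- The degrees related to `r`. -/
def fiber (r : D.ι → ℤ) : Set (E.ι → ℤ) := {m | (m, r) ∈ Q.rel}

/-- Isotypic functions whose pullback has components of related degrees only. -/
def Liftable (r : D.ι → ℤ) (f : C(D.X, ℂ)) : Prop :=
  D.IsIsotypic r f ∧ ∃ b, (b, f.comp Q.map) ∈ E.quantOn (Q.fiber r)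

theorem quantOn_fiber_mul {r s : D.ι → ℤ} {p q : C(E.X, BL2 (E.ι → ℤ)) × C(E.X, ℂ)}
    (hp : p ∈ E.quantOn (Q.fiber r)) (hq : q ∈ E.quantOn (Q.fiber s)) :
    (p.1 * q.1, bichar D.θ r s • (p.2 * q.2)) ∈ E.quantOn (Q.fiber (r + s)) :=
  quantOn_mul (fun m h m' h' => Q.isotropic (m, r) h (m', s) h')
    (fun m h m' h' => show (m, r) + (m', s) ∈ Q.rel from Q.rel.add_mem h h') hp hq

theorem quantOn_fiber_star {r : D.ι → ℤ} {p : C(E.X, BL2 (E.ι → ℤ)) × C(E.X, ℂ)}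
    (hp : p ∈ E.quantOn (Q.fiber r)) : star p ∈ E.quantOn (Q.fiber (-r)) := by
  refine quantOn_star (fun m h => ?_) hp
  exact Q.rel.neg_mem (x := (m, r)) h

variable {Q}

theorem Liftable.zero (r : D.ι → ℤ) : Q.Liftable r 0 :=
  ⟨IsIsotypic.zero r, 0, by rw [ContinuousMap.zero_comp]; exact zero_mem _⟩

theorem Liftable.one : Q.Liftable 0 1 :=
  ⟨IsIsotypic.one, 1, by
    rw [ContinuousMap.one_comp]
    exact one_mem_quantOn (S := Q.fiber 0) Q.rel.zero_mem⟩

theorem Liftable.add {r : D.ι → ℤ} {f g : C(D.X, ℂ)} (hf : Q.Liftable r f)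
    (hg : Q.Liftable r g) : Q.Liftable r (f + g) := by
  obtain ⟨hf, b, hb⟩ := hf
  obtain ⟨hg, c, hc⟩ := hg
  refine ⟨hf.add hg, b + c, ?_⟩
  rw [ContinuousMap.add_comp]
  exact add_mem hb hc

theorem Liftable.smul {r : D.ι → ℤ} {f : C(D.X, ℂ)} (a : ℂ) (hf : Q.Liftable r f) :
    Q.Liftable r (a • f) := by
  obtain ⟨hf, b, hb⟩ := hf
  refine ⟨hf.smul a, a • b, ?_⟩
  rw [ContinuousMap.smul_comp]
  exact Submodule.smul_mem _ a hb

theorem Liftable.mul {r s : D.ι → ℤ} {f g : C(D.X, ℂ)} (hf : Q.Liftable r f)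
    (hg : Q.Liftable s g) : Q.Liftable (r + s) (f * g) := by
  obtain ⟨hf, b, hb⟩ := hf
  obtain ⟨hg, c, hc⟩ := hg
  refine ⟨hf.mul hg, (bichar D.θ r s)⁻¹ • (b * c), ?_⟩
  have := Submodule.smul_mem _ (bichar D.θ r s)⁻¹ (Q.quantOn_fiber_mul hb hc)
  rw [Prod.smul_mk, smul_smul, inv_mul_cancel₀ (bichar_ne_zero _ _ _), one_smul] at this
  rw [ContinuousMap.mul_comp]
  exact this

theorem Liftable.star {r : D.ι → ℤ} {f : C(D.X, ℂ)} (hf : Q.Liftable r f) :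
    Q.Liftable (-r) (Star.star f) := by
  obtain ⟨hf, b, hb⟩ := hf
  have e : (Star.star f).comp Q.map = Star.star (f.comp Q.map) := ContinuousMap.ext fun _ => rfl
  refine ⟨hf.star, Star.star b, ?_⟩
  rw [e]
  have := Q.quantOn_fiber_star hb
  rw [Prod.star_def] at this
  exact this

variable (Q)

theorem separatingFamily : D.SeparatingFamily Q.Liftable where
  isotypic h := h.1
  zero := Liftable.zero
  one := Liftable.one
  add := Liftable.add
  smul := Liftable.smul
  mul := Liftable.mul
  star := Liftable.star
  separates {x y} h := Q.separates x y h

/-- The pairs consisting of an isotypic function and its quantized pullback. -/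
def graphSet : Set (D.CAlg × E.CAlg) :=
  {p | ∃ r f, ∃ h : D.IsIsotypic r f, p.1 = D.elt r f h ∧
    (E.incl p.2, f.comp Q.map) ∈ E.quantOn (Q.fiber r)}

theorem graphSet_mul {p q : D.CAlg × E.CAlg} (hp : p ∈ Q.graphSet) (hq : q ∈ Q.graphSet) :
    p * q ∈ Q.graphSet := by
  obtain ⟨r, f, hf, h1, h2⟩ := hp
  obtain ⟨s, g, hg, h3, h4⟩ := hq
  refine ⟨r + s, bichar D.θ r s • (f * g), (hf.mul hg).smul _, ?_, ?_⟩
  · apply D.incl_injective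
    rw [Prod.fst_mul, map_mul, h1, h3, incl_elt, incl_elt, incl_elt, symbol_mul, symbol_smul]
  · have := Q.quantOn_fiber_mul h2 h4
    rw [Prod.snd_mul, map_mul]
    exact this

theorem graphSet_star {p : D.CAlg × E.CAlg} (hp : p ∈ Q.graphSet) : star p ∈ Q.graphSet := by
  obtain ⟨r, f, hf, h1, h2⟩ := hp
  refine ⟨-r, star f, hf.star, ?_, ?_⟩
  · apply D.incl_injective
    rw [Prod.fst_star, map_star, h1, incl_elt, incl_elt, star_symbol]
  · have := Q.quantOn_fiber_star h2
    rw [Prod.snd_star, map_star]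
    exact this

/-- The `*`-algebra spanned by the pairs of isotypic functions and their quantized pullbacks. -/
def graph : StarSubalgebra ℂ (D.CAlg × E.CAlg) where
  __ := (Submodule.span ℂ Q.graphSet).toSubalgebra
    (Submodule.subset_span ⟨0, 1, IsIsotypic.one,
      D.incl_injective (by rw [Prod.fst_one, map_one, incl_elt, symbol_one]),
      by
        rw [Prod.snd_one, map_one]
        exact one_mem_quantOn Q.rel.zero_mem⟩) (by
      intro p q hp hq
      have := Submodule.mul_mem_mul hp hq
      rw [Submodule.span_mul_span] at this
      refine Submodule.span_mono ?_ this
      rintro _ ⟨p, hp, q, hq, rfl⟩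
      exact Q.graphSet_mul hp hq)
  star_mem' := by
    intro p hp
    change p ∈ Submodule.span ℂ _ at hp
    change star p ∈ Submodule.span ℂ Q.graphSet
    induction hp using Submodule.span_induction with
    | mem p hp => exact Submodule.subset_span (Q.graphSet_star hp)
    | zero => simp
    | add f g _ _ hf hg => rw [star_add]; exact add_mem hf hg
    | smul a f _ hf => rw [star_smul]; exact Submodule.smul_mem _ _ hf

/-- For f isotypic of degree m one has f(t · y) = t^m f(y), so multiplication along the orbit is
f(y) times the operator of the pair (m, r), which `hV` handles. Linearity does the rest. -/
theorem asympIntertwines_of_mem_quantOn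
    {V : ℕ → L2 (E.ι → ℤ) →ₗᵢ[ℂ] TorusL2 E.ι (L2 (D.ι → ℤ))}
    (hV : ∀ p ∈ Q.rel, AsympIntertwines V
      (mulOp ⟨fun t => torusChar p.1 t • weyl D.θ p.2, by fun_prop⟩) (weyl E.θ p.1))
    {r : D.ι → ℤ} {p : C(E.X, BL2 (E.ι → ℤ)) × C(E.X, ℂ)} (hp : p ∈ E.quantOn (Q.fiber r))
    (y : E.X) :
    AsympIntertwines V (mulOp ⟨fun t => p.2 (E.act t y) • weyl D.θ r, by
      have := continuous_orbit y
      fun_prop⟩) (p.1 y) := by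
  induction hp using Submodule.span_induction with
  | mem p hp =>
    obtain ⟨m, hm, f, hf, rfl⟩ := hp
    have := (hV (m, r) hm).smul (f y)
    rw [← mulOp_smul] at this
    convert this using 2
    · ext1 t
      change f (E.act t y) • weyl D.θ r = f y • torusChar m t • weyl D.θ r
      rw [isIsotypic_iff.1 hf, smul_smul, mul_comm]
    · rfl
  | zero =>
    convert AsympIntertwines.zero using 1
    · rw [← mulOp_zero]
      congr 1
      ext1 t
      simp
    · rfl
  | add p q _ _ h h' =>
    convert h.add h' using 1
    · rw [← mulOp_add]
      congr 1
      ext1 t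
      simp [add_smul]
    · rfl
  | smul a p _ h =>
    convert h.smul a using 1
    · rw [← mulOp_smul]
      congr 1
      ext1 t
      simp [mul_smul]
    · rfl

/-- At each y the quantized pullback is asymptotically contained in multiplication by t ↦ F(φ(t ·
y)) on L² of the torus, where F is the first entry and φ the underlying map. That operator has norm
at most ‖F‖. -/
theorem norm_le_of_mem_graph {p : D.CAlg × E.CAlg} (hp : p ∈ Q.graph) : ‖p.2‖ ≤ ‖p.1‖ := by
  obtain ⟨V, hV⟩ := exists_weyl_intertwiner D.skew E.skew Q.rel Q.isotropic
  rw [← norm_incl, ← norm_incl]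
  refine (ContinuousMap.norm_le _ (norm_nonneg _)).2 fun y => ?_
  have key : AsympIntertwines V (mulOp ((D.incl p.1).comp
      ⟨fun t => Q.map (E.act t y), Q.map.continuous.comp (continuous_orbit y)⟩))
      (E.incl p.2 y) := by
    change p ∈ Submodule.span ℂ _ at hp
    induction hp using Submodule.span_induction with
    | mem p hp =>
      obtain ⟨r, f, hf, h1, h2⟩ := hp
      rw [h1]
      exact Q.asympIntertwines_of_mem_quantOn hV h2 y
    | zero =>
      convert AsympIntertwines.zero using 1
      · rw [← mulOp_zero]
        congr 1
      · simp
    | add p q _ _ h h' =>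
      convert h.add h' using 1
      · rw [← mulOp_add]
        congr 1
      · simp
    | smul a p _ h =>
      convert h.smul a using 1
      · rw [← mulOp_smul]
        congr 1
      · simp
  exact key.norm_le (norm_nonneg _)
    (norm_mulOp_apply_le _ fun t => (D.incl p.1).norm_coe_le_norm _)

/-- The graph is contractive, and its first projection is dense because liftable functions separate
points. -/
theorem exists_hom : ∃ φ : D.CAlg →⋆ₐ[ℂ] E.CAlg, ∀ p ∈ Q.graph, φ p.1 = p.2 := by
  refine exists_starAlgHom_of_graph Q.graph (fun p hp => Q.norm_le_of_mem_graph hp)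
    fun A' hA' hp => Q.separatingFamily.eq_top _ hA' fun r f hf => ?_
  obtain ⟨h1, b, hb⟩ := hf
  exact hp (D.elt r f h1, ⟨b, fst_mem_alg_of_mem_quantOn hb⟩)
    (Submodule.subset_span ⟨r, f, h1, rfl, hb⟩)

/-- The homomorphism of deformed algebras induced by a quantized map. -/
def hom : D.CAlg →⋆ₐ[ℂ] E.CAlg := Q.exists_hom.choose

theorem hom_elt {r : D.ι → ℤ} {f : C(D.X, ℂ)} (hf : D.IsIsotypic r f) {b : E.CAlg}
    (hb : (E.incl b, f.comp Q.map) ∈ E.quantOn (Q.fiber r)) : Q.hom (D.elt r f hf) = b :=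
  Q.exists_hom.choose_spec (D.elt r f hf, b) (Submodule.subset_span ⟨r, f, hf, rfl, hb⟩)

theorem incl_hom_elt {r : D.ι → ℤ} {f : C(D.X, ℂ)} (hf : Q.Liftable r f) :
    (E.incl (Q.hom (D.elt r f hf.1)), f.comp Q.map) ∈ E.quantOn (Q.fiber r) := by
  obtain ⟨b, hb⟩ := hf.2
  rw [Q.hom_elt hf.1 (b := ⟨b, fst_mem_alg_of_mem_quantOn hb⟩) hb]
  exact hb

end QMap

end ToricDatum

namespace ToricDatum

/-! ## Tensor products of isotypic elements -/

section Tensor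

variable {D E : ToricDatum}

theorem bichar_prod (m n : D.ι ⊕ E.ι → ℤ) :
    bichar (ι := D.ι ⊕ E.ι) (Matrix.fromBlocks D.θ 0 0 E.θ) m n =
      bichar D.θ (fun i => m (Sum.inl i)) (fun i => n (Sum.inl i)) *
        bichar E.θ (fun i => m (Sum.inr i)) (fun i => n (Sum.inr i)) := by
  simp only [bichar]
  rw [← Complex.exp_add]
  congr 1
  simp [dotProduct, Matrix.mulVec]
  ring

theorem bichar_prod_θ (m n : (D.prod E).ι → ℤ) :
    bichar (D.prod E).θ m n =
      bichar D.θ (fun i => m (Sum.inl i)) (fun i => n (Sum.inl i)) *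
        bichar E.θ (fun i => m (Sum.inr i)) (fun i => n (Sum.inr i)) :=
  bichar_prod (D := D) (E := E) m n

/-- The degree `(r, s)` of a product. -/
def join (r : D.ι → ℤ) (s : E.ι → ℤ) : (D.prod E).ι → ℤ := Sum.elim r s

theorem join_add (r r' : D.ι → ℤ) (s s' : E.ι → ℤ) :
    join r s + join r' s' = join (r + r') (s + s') := by
  funext i
  rcases i with i | i <;> rfl

theorem bichar_join (r r' : D.ι → ℤ) (s s' : E.ι → ℤ) :
    bichar (D.prod E).θ (join r s) (join r' s') = bichar D.θ r r' * bichar E.θ s s' :=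
  bichar_prod (D := D) (E := E) _ _

theorem torusChar_join (r : D.ι → ℤ) (s : E.ι → ℤ) (t : (D.prod E).ι → Circle) :
    torusChar (join r s) t = torusChar r (fun i => t (Sum.inl i)) *
      torusChar s (fun i => t (Sum.inr i)) :=
  Fintype.prod_sum_type _

/-- The function `(x, y) ↦ f(x) g(y)`. -/
def outer (f : C(D.X, ℂ)) (g : C(E.X, ℂ)) : C((D.prod E).X, ℂ) :=
  ⟨fun p : D.X × E.X => f p.1 * g p.2, by fun_prop⟩

theorem outer_apply (f : C(D.X, ℂ)) (g : C(E.X, ℂ)) (x : D.X) (y : E.X) :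
    outer f g (x, y) = f x * g y := rfl

theorem outer_mul (f f' : C(D.X, ℂ)) (g g' : C(E.X, ℂ)) :
    outer f g * outer f' g' = outer (f * f') (g * g') :=
  ContinuousMap.ext fun _ => mul_mul_mul_comm _ _ _ _

theorem outer_star (f : C(D.X, ℂ)) (g : C(E.X, ℂ)) :
    star (outer f g) = outer (star f) (star g) :=
  ContinuousMap.ext fun _ => star_mul' _ _

theorem IsIsotypic.outer {r : D.ι → ℤ} {s : E.ι → ℤ} {f : C(D.X, ℂ)} {g : C(E.X, ℂ)}
    (hf : D.IsIsotypic r f) (hg : E.IsIsotypic s g) :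
    (D.prod E).IsIsotypic (join r s) (ToricDatum.outer f g) := isIsotypic_iff.2 fun t p => by
  obtain ⟨x, y⟩ := p
  have h1 := isIsotypic_iff.1 hf (fun i => t (Sum.inl i)) x
  have h2 := isIsotypic_iff.1 hg (fun i => t (Sum.inr i)) y
  rw [torusChar_join, outer_apply, mul_mul_mul_comm, ← h1, ← h2]
  rfl

theorem inlAux_symbol_eq (r : D.ι → ℤ) (f : C(D.X, ℂ)) :
    inlAux D E (D.symbol r f) = (D.prod E).symbol (join r 0) (outer f 1) := by
  ext1 p
  change L2.ampHom (splitL D.ι E.ι) (f p.1 • weyl D.θ r) = (f p.1 * 1) • _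
  rw [map_smul, mul_one]
  exact congrArg (f p.1 • ·) (amp_weyl_left D E r)

theorem inrAux_symbol_eq (r : E.ι → ℤ) (f : C(E.X, ℂ)) :
    inrAux D E (E.symbol r f) = (D.prod E).symbol (join 0 r) (outer 1 f) := by
  ext1 p
  change L2.ampHom (splitR D.ι E.ι) (f p.2 • weyl E.θ r) = (1 * f p.2) • _
  rw [map_smul, one_mul]
  exact congrArg (f p.2 • ·) (amp_weyl_right D E r)

theorem inl_elt {r : D.ι → ℤ} {f : C(D.X, ℂ)} (hf : D.IsIsotypic r f) :
    inl D E (D.elt r f hf) = (D.prod E).elt (join r 0) (outer f 1)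
      (hf.outer IsIsotypic.one) :=
  (D.prod E).incl_injective (inlAux_symbol_eq r f)

theorem inr_elt {r : E.ι → ℤ} {f : C(E.X, ℂ)} (hf : E.IsIsotypic r f) :
    inr D E (E.elt r f hf) = (D.prod E).elt (join 0 r) (outer 1 f)
      (IsIsotypic.one.outer hf) :=
  (D.prod E).incl_injective (inrAux_symbol_eq r f)

theorem inlAux_mul_inrAux_symbol (r : D.ι → ℤ) (s : E.ι → ℤ) (f : C(D.X, ℂ)) (g : C(E.X, ℂ)) :
    inlAux D E (D.symbol r f) * inrAux D E (E.symbol s g) =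
      (D.prod E).symbol (join r s) (outer f g) := by
  rw [inlAux_symbol_eq, inrAux_symbol_eq]
  rw [symbol_mul, bichar_join, bichar_zero_right, bichar_zero_left, join_add, zero_add, add_zero,
    mul_one, one_smul, outer_mul, mul_one, one_mul]

theorem tmul_elt {r : D.ι → ℤ} {s : E.ι → ℤ} {f : C(D.X, ℂ)} {g : C(E.X, ℂ)}
    (hf : D.IsIsotypic r f) (hg : E.IsIsotypic s g) :
    tmul (D.elt r f hf) (E.elt s g hg) =
      (D.prod E).elt (join r s) (outer f g) (hf.outer hg) :=
  (D.prod E).incl_injective (inlAux_mul_inrAux_symbol r s f g)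

theorem quantOn_inl {S : Set (D.ι → ℤ)} {T : Set ((D.prod E).ι → ℤ)} (hT : ∀ r ∈ S, join r 0 ∈ T)
    {p : C(D.X, BL2 (D.ι → ℤ)) × C(D.X, ℂ)} (hp : p ∈ D.quantOn S) :
    (inlAux D E p.1, outer p.2 1) ∈ (D.prod E).quantOn T := by
  induction hp using Submodule.span_induction with
  | mem p hp =>
    obtain ⟨r, hr, f, hf, rfl⟩ := hp
    have := symbol_mem_quantOn (D := D.prod E) (hT r hr) (hf.outer IsIsotypic.one)
    rw [← inlAux_symbol_eq] at this
    exact this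
  | zero =>
    convert ((D.prod E).quantOn T).zero_mem using 1
    rw [Prod.fst_zero, map_zero]
    exact Prod.ext rfl (ContinuousMap.ext fun p => zero_mul _)
  | add p q _ _ h h' =>
    convert ((D.prod E).quantOn T).add_mem h h' using 1
    rw [Prod.fst_add, map_add]
    exact Prod.ext rfl (ContinuousMap.ext fun p => add_mul _ _ _)
  | smul a p _ h =>
    convert ((D.prod E).quantOn T).smul_mem a h using 1
    rw [Prod.smul_fst, map_smul]
    exact Prod.ext rfl (ContinuousMap.ext fun p => mul_assoc _ _ _)

theorem quantOn_inr {S : Set (E.ι → ℤ)} {T : Set ((D.prod E).ι → ℤ)} (hT : ∀ r ∈ S, join 0 r ∈ T)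
    {p : C(E.X, BL2 (E.ι → ℤ)) × C(E.X, ℂ)} (hp : p ∈ E.quantOn S) :
    (inrAux D E p.1, outer 1 p.2) ∈ (D.prod E).quantOn T := by
  induction hp using Submodule.span_induction with
  | mem p hp =>
    obtain ⟨r, hr, f, hf, rfl⟩ := hp
    have := symbol_mem_quantOn (D := D.prod E) (hT r hr) (IsIsotypic.one.outer hf)
    rw [← inrAux_symbol_eq] at this
    exact this
  | zero =>
    convert ((D.prod E).quantOn T).zero_mem using 1
    rw [Prod.fst_zero, map_zero]
    exact Prod.ext rfl (ContinuousMap.ext fun p => mul_zero _)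
  | add p q _ _ h h' =>
    convert ((D.prod E).quantOn T).add_mem h h' using 1
    rw [Prod.fst_add, map_add]
    exact Prod.ext rfl (ContinuousMap.ext fun p => mul_add _ _ _)
  | smul a p _ h =>
    convert ((D.prod E).quantOn T).smul_mem a h using 1
    rw [Prod.smul_fst, map_smul]
    exact Prod.ext rfl (ContinuousMap.ext fun p => mul_left_comm _ _ _)

end Tensor

/-- The isotypic functions separate the points of `D.X`. -/
def Separated (D : ToricDatum) : Prop :=
  ∀ x y : D.X, x ≠ y → ∃ r f, D.IsIsotypic r f ∧ f x ≠ f y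

theorem Separated.separatingFamily {D : ToricDatum} (h : D.Separated) :
    D.SeparatingFamily D.IsIsotypic where
  isotypic h := h
  zero := IsIsotypic.zero
  one := IsIsotypic.one
  add := IsIsotypic.add
  smul := IsIsotypic.smul
  mul := IsIsotypic.mul
  star := IsIsotypic.star
  separates {x y} hxy := h x y hxy

theorem Separated.prod {D E : ToricDatum} (hD : D.Separated) (hE : E.Separated) :
    (D.prod E).Separated := by
  rintro ⟨x, y⟩ ⟨x', y'⟩ hne
  by_cases hx : x = x'
  · obtain ⟨r, f, hf, h⟩ := hE y y' fun hy => hne (by rw [hx, hy])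
    refine ⟨_, outer 1 f, IsIsotypic.one.outer hf, ?_⟩
    rw [outer_apply, outer_apply]
    simpa using h
  · obtain ⟨r, f, hf, h⟩ := hD x x' hx
    refine ⟨_, outer f 1, hf.outer IsIsotypic.one, ?_⟩
    rw [outer_apply, outer_apply]
    simpa using h

namespace QMap

/-! ## Products of quantized maps -/

section Prod

variable {D E D' E' : ToricDatum} (Q : D.QMap E) (Q' : D'.QMap E')

/-- The relation of degrees of a product map. -/
def prodRel : AddSubgroup (((E.prod E').ι → ℤ) × ((D.prod D').ι → ℤ)) where
  carrier := {p | ((fun i => p.1 (Sum.inl i)), fun i => p.2 (Sum.inl i)) ∈ Q.rel ∧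
    ((fun i => p.1 (Sum.inr i)), fun i => p.2 (Sum.inr i)) ∈ Q'.rel}
  zero_mem' := ⟨Q.rel.zero_mem, Q'.rel.zero_mem⟩
  add_mem' := fun h h' => ⟨Q.rel.add_mem h.1 h'.1, Q'.rel.add_mem h.2 h'.2⟩
  neg_mem' := fun h => ⟨Q.rel.neg_mem h.1, Q'.rel.neg_mem h.2⟩

theorem mem_prodRel {p : ((E.prod E').ι → ℤ) × ((D.prod D').ι → ℤ)} : p ∈ prodRel Q Q' ↔
    ((fun i => p.1 (Sum.inl i)), fun i => p.2 (Sum.inl i)) ∈ Q.rel ∧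
    ((fun i => p.1 (Sum.inr i)), fun i => p.2 (Sum.inr i)) ∈ Q'.rel := Iff.rfl

theorem isotropic_prodRel (p) (hp : p ∈ prodRel Q Q') (q) (hq : q ∈ prodRel Q Q') :
    bichar (E.prod E').θ p.1 q.1 = bichar (D.prod D').θ p.2 q.2 := by
  rw [mem_prodRel] at hp hq
  have h1 := Q.isotropic _ hp.1 _ hq.1
  have h2 := Q'.isotropic _ hp.2 _ hq.2
  rw [bichar_prod_θ, bichar_prod_θ, h1, h2]

/-- The degrees related to a degree of a product. -/
def prodFiber (r : (D.prod D').ι → ℤ) : Set ((E.prod E').ι → ℤ) := {m | (m, r) ∈ prodRel Q Q'}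

theorem join_mem_prodFiber {m : E.ι → ℤ} {r : D.ι → ℤ} {m' : E'.ι → ℤ} {r' : D'.ι → ℤ}
    (h : m ∈ Q.fiber r) (h' : m' ∈ Q'.fiber r') : join m m' ∈ prodFiber Q Q' (join r r') := ⟨h, h'⟩

theorem zero_mem_fiber : 0 ∈ Q.fiber 0 := Q.rel.zero_mem

/-- The product of the underlying maps. -/
def prodMap : C((E.prod E').X, (D.prod D').X) := Q.map.prodMap Q'.map

theorem outer_comp_prodMap (f : C(D.X, ℂ)) (g : C(D'.X, ℂ)) :
    (outer f g).comp (prodMap Q Q') = outer (f.comp Q.map) (g.comp Q'.map) := rfl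

theorem prodMap_separates (z w : (D.prod D').X) (hne : z ≠ w) :
    ∃ r f, ((D.prod D').IsIsotypic r f ∧ ∃ b, (b, f.comp (prodMap Q Q')) ∈
      (E.prod E').quantOn (prodFiber Q Q' r)) ∧ f z ≠ f w := by
  obtain ⟨x, y⟩ := z
  obtain ⟨x', y'⟩ := w
  by_cases hx : x = x'
  · obtain ⟨r, f, ⟨hf, b, hb⟩, h⟩ := Q'.separates y y' fun hy => hne (by rw [hx, hy])
    refine ⟨join 0 r, outer 1 f, ⟨IsIsotypic.one.outer hf, inrAux E E' b, ?_⟩, ?_⟩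
    · rw [outer_comp_prodMap, ContinuousMap.one_comp]
      exact quantOn_inr (fun m hm => join_mem_prodFiber Q Q' (zero_mem_fiber Q) hm) hb
    · rw [outer_apply, outer_apply]
      simpa using h
  · obtain ⟨r, f, ⟨hf, b, hb⟩, h⟩ := Q.separates x x' hx
    refine ⟨join r 0, outer f 1, ⟨hf.outer IsIsotypic.one, inlAux E E' b, ?_⟩, ?_⟩
    · rw [outer_comp_prodMap, ContinuousMap.one_comp]
      exact quantOn_inl (fun m hm => join_mem_prodFiber Q Q' hm (zero_mem_fiber Q')) hb
    · rw [outer_apply, outer_apply]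
      simpa using h

/-- The product of two quantized maps. -/
def prod : (D.prod D').QMap (E.prod E') where
  map := prodMap Q Q'
  rel := prodRel Q Q'
  isotropic := isotropic_prodRel Q Q'
  separates := prodMap_separates Q Q'

/-- Two homomorphisms are compared on liftable isotypic elements, where both sides quantize the same
pullback with degrees related to (r, 0). -/
theorem prod_hom_inl (a : D.CAlg) : (prod Q Q').hom (inl D D' a) = inl E E' (Q.hom a) := by
  refine DFunLike.congr_fun (Q.separatingFamily.hom_ext (φ := (prod Q Q').hom.comp (inl D D'))
    (ψ := (inl E E').comp Q.hom) fun r f hf => ?_) a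
  change (prod Q Q').hom (inl D D' _) = inl E E' (Q.hom _)
  rw [inl_elt]
  refine hom_elt _ _ ?_
  have := quantOn_inl (T := prodFiber Q Q' (join r 0))
    (fun m hm => join_mem_prodFiber Q Q' hm (zero_mem_fiber Q')) (Q.incl_hom_elt hf)
  exact this

theorem prod_hom_inr (a : D'.CAlg) : (prod Q Q').hom (inr D D' a) = inr E E' (Q'.hom a) := by
  refine DFunLike.congr_fun (Q'.separatingFamily.hom_ext (φ := (prod Q Q').hom.comp (inr D D'))
    (ψ := (inr E E').comp Q'.hom) fun r f hf => ?_) a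
  change (prod Q Q').hom (inr D D' _) = inr E E' (Q'.hom _)
  rw [inr_elt]
  refine hom_elt _ _ ?_
  have := quantOn_inr (T := prodFiber Q Q' (join 0 r))
    (fun m hm => join_mem_prodFiber Q Q' (zero_mem_fiber Q) hm) (Q'.incl_hom_elt hf)
  exact this

theorem isTensorMap_prod : IsTensorMap Q.hom Q'.hom (prod Q Q').hom := fun a b => by
  rw [tmul, map_mul, prod_hom_inl, prod_hom_inr, tmul]

end Prod

end QMap

end ToricDatum

namespace ToricDatum

/-! ## Equivariant maps -/

section Reindex

variable {D E : ToricDatum}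

theorem IsIsotypic.reindex {φ : C(E.X, D.X)} {e : D.ι ≃ E.ι}
    (hφ : ∀ t y, φ (E.act t y) = D.act (fun i => t (e i)) (φ y)) {r : D.ι → ℤ} {f : C(D.X, ℂ)}
    (hf : D.IsIsotypic r f) : E.IsIsotypic (r ∘ e.symm) (f.comp φ) := isIsotypic_iff.2 fun t z => by
  rw [ContinuousMap.comp_apply, hφ, isIsotypic_iff.1 hf, ContinuousMap.comp_apply]
  congr 1
  rw [torusChar_apply, torusChar_apply]
  exact Fintype.prod_equiv e _ _ fun i => by simp

namespace QMap

/-- The graph of a bijection of degrees. -/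
def reindexRel (e : D.ι ≃ E.ι) : AddSubgroup ((E.ι → ℤ) × (D.ι → ℤ)) where
  carrier := {p | p.1 = p.2 ∘ e.symm}
  zero_mem' := rfl
  add_mem' := by
    intro p q hp hq
    change p.1 + q.1 = (p.2 + q.2) ∘ e.symm
    rw [show p.1 = _ from hp, show q.1 = _ from hq]
    rfl
  neg_mem' := by
    intro p hp
    change -p.1 = (-p.2) ∘ e.symm
    rw [show p.1 = _ from hp]
    rfl

theorem mem_reindexRel {e : D.ι ≃ E.ι} {p : (E.ι → ℤ) × (D.ι → ℤ)} :
    p ∈ reindexRel e ↔ p.1 = p.2 ∘ e.symm := Iff.rfl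

/-- An equivariant map which preserves the deformation parameters. -/
def reindex (φ : C(E.X, D.X)) (e : D.ι ≃ E.ι)
    (hφ : ∀ t y, φ (E.act t y) = D.act (fun i => t (e i)) (φ y))
    (hθ : ∀ r s : D.ι → ℤ, bichar E.θ (r ∘ e.symm) (s ∘ e.symm) = bichar D.θ r s)
    (hD : D.Separated) : D.QMap E where
  map := φ
  rel := reindexRel e
  isotropic p hp q hq := by
    rw [mem_reindexRel] at hp hq
    rw [hp, hq, hθ]
  separates x y hxy := by
    obtain ⟨r, f, hf, hne⟩ := hD x y hxy
    exact ⟨r, f, ⟨hf, E.symbol (r ∘ e.symm) (f.comp φ),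
      symbol_mem_quantOn (S := {m | (m, r) ∈ reindexRel e}) rfl (IsIsotypic.reindex hφ hf)⟩, hne⟩

variable {φ : C(E.X, D.X)} {e : D.ι ≃ E.ι}
    {hφ : ∀ t y, φ (E.act t y) = D.act (fun i => t (e i)) (φ y)}
    {hθ : ∀ r s : D.ι → ℤ, bichar E.θ (r ∘ e.symm) (s ∘ e.symm) = bichar D.θ r s}
    {hD : D.Separated}

theorem reindex_hom_elt {r : D.ι → ℤ} {f : C(D.X, ℂ)} (hf : D.IsIsotypic r f)
    {s : E.ι → ℤ} (hs : s = r ∘ e.symm) {g : C(E.X, ℂ)} (hg : g = f.comp φ)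
    (h : E.IsIsotypic s g) : (reindex φ e hφ hθ hD).hom (D.elt r f hf) = E.elt s g h := by
  refine hom_elt _ _ ?_
  subst hg
  exact symbol_mem_quantOn (S := {m | (m, r) ∈ reindexRel e}) hs h

/-- The identity as a quantized map. -/
def refl (D : ToricDatum) (hD : D.Separated) : D.QMap D :=
  reindex (ContinuousMap.id _) (Equiv.refl _) (fun _ _ => rfl) (fun _ _ => rfl) hD

theorem refl_hom {D : ToricDatum} (hD : D.Separated) : (refl D hD).hom = StarAlgHom.id ℂ D.CAlg :=
  hD.separatingFamily.hom_ext fun _ _ hf => reindex_hom_elt hf rfl rfl hf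

end QMap

end Reindex

/-! ### Associativity of the tensor product -/

namespace QMap

section Assoc

variable {D E F : ToricDatum} (hD : D.Separated) (hE : E.Separated) (hF : F.Separated)

/-- Rebracketing of triple products of spaces. -/
def assocMap (D E F : ToricDatum) : C((D.prod (E.prod F)).X, ((D.prod E).prod F).X) :=
  ⟨fun p : D.X × E.X × F.X => ((p.1, p.2.1), p.2.2), by
    have : Continuous fun p : D.X × E.X × F.X => ((p.1, p.2.1), p.2.2) := by fun_prop
    exact this⟩

/-- Rebracketing of triple products of spaces. -/
def assocInvMap (D E F : ToricDatum) : C(((D.prod E).prod F).X, (D.prod (E.prod F)).X) :=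
  ⟨fun p : (D.X × E.X) × F.X => (p.1.1, p.1.2, p.2), by
    have : Continuous fun p : (D.X × E.X) × F.X => (p.1.1, p.1.2, p.2) := by fun_prop
    exact this⟩

/-- Rebracketing of the degrees of triple products. -/
def assocEquiv (D E F : ToricDatum) : ((D.prod E).prod F).ι ≃ (D.prod (E.prod F)).ι :=
  Equiv.sumAssoc D.ι E.ι F.ι

theorem bichar_assoc (r s : ((D.prod E).prod F).ι → ℤ) :
    bichar (D.prod (E.prod F)).θ (r ∘ (assocEquiv D E F).symm) (s ∘ (assocEquiv D E F).symm) =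
      bichar ((D.prod E).prod F).θ r s := by
  rw [bichar_prod_θ, bichar_prod_θ, bichar_prod_θ, bichar_prod_θ, mul_assoc]
  rfl

theorem bichar_assocInv (r s : (D.prod (E.prod F)).ι → ℤ) :
    bichar ((D.prod E).prod F).θ (r ∘ (assocEquiv D E F)) (s ∘ (assocEquiv D E F)) =
      bichar (D.prod (E.prod F)).θ r s := by
  rw [bichar_prod_θ, bichar_prod_θ, bichar_prod_θ, bichar_prod_θ, mul_assoc]
  rfl

/-- Rebracketing of triple products. -/
def assoc : ((D.prod E).prod F).QMap (D.prod (E.prod F)) :=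
  reindex (assocMap D E F) (assocEquiv D E F) (fun _ _ => rfl) bichar_assoc ((hD.prod hE).prod hF)

/-- Rebracketing of triple products. -/
def assocInv : (D.prod (E.prod F)).QMap ((D.prod E).prod F) :=
  reindex (assocInvMap D E F) (assocEquiv D E F).symm (fun _ _ => rfl) bichar_assocInv
    (hD.prod (hE.prod hF))

theorem join_assoc (r : D.ι → ℤ) (s : E.ι → ℤ) (u : F.ι → ℤ) :
    join r (join s u) = join (join r s) u ∘ (assocEquiv D E F).symm := by
  funext i
  rcases i with i | i | i <;> rfl

theorem assoc_tmul_elt {r : D.ι → ℤ} {s : E.ι → ℤ} {u : F.ι → ℤ} {f : C(D.X, ℂ)} {g : C(E.X, ℂ)}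
    {k : C(F.X, ℂ)} (hf : D.IsIsotypic r f) (hg : E.IsIsotypic s g) (hk : F.IsIsotypic u k) :
    (assoc hD hE hF).hom (tmul (tmul (D.elt r f hf) (E.elt s g hg)) (F.elt u k hk)) =
      tmul (D.elt r f hf) (tmul (E.elt s g hg) (F.elt u k hk)) := by
  rw [tmul_elt, tmul_elt, tmul_elt, tmul_elt]
  refine reindex_hom_elt _ (join_assoc r s u) ?_ _
  ext1 p
  exact (mul_assoc _ _ _).symm

theorem elt_one (D : ToricDatum) : D.elt 0 1 IsIsotypic.one = 1 :=
  D.incl_injective (by rw [incl_elt, symbol_one, map_one])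

theorem tmul_one {D E : ToricDatum} (a : D.CAlg) : tmul a (1 : E.CAlg) = inl D E a := by
  rw [tmul, map_one, mul_one]

/-- An elementary tensor is a product of embedded copies of its factors, so the three embeddings can
be treated separately. For each it suffices to look at isotypic elements. -/
theorem isAssociator_assoc (a : D.CAlg) (b : E.CAlg) (c : F.CAlg) :
    (assoc hD hE hF).hom (tmul (tmul a b) c) = tmul a (tmul b c) := by
  have h1 : ∀ a : D.CAlg, (assoc hD hE hF).hom (inl _ _ (inl D E a)) = inl _ _ a := fun a => by
    refine DFunLike.congr_fun (hD.separatingFamily.hom_ext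
      (φ := (assoc hD hE hF).hom.comp ((inl (D.prod E) F).comp (inl D E)))
      (ψ := inl D (E.prod F)) fun r f hf => ?_) a
    have := assoc_tmul_elt hD hE hF hf (IsIsotypic.one (D := E)) (IsIsotypic.one (D := F))
    rw [elt_one, elt_one, tmul_one, tmul_one, tmul_one_left, map_one, tmul_one] at this
    exact this
  have h2 : ∀ b : E.CAlg, (assoc hD hE hF).hom (inl _ _ (inr D E b)) = inr _ _ (inl _ _ b) :=
    fun b => by
      refine DFunLike.congr_fun (hE.separatingFamily.hom_ext
        (φ := (assoc hD hE hF).hom.comp ((inl (D.prod E) F).comp (inr D E)))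
        (ψ := (inr D (E.prod F)).comp (inl E F)) fun r f hf => ?_) b
      have := assoc_tmul_elt hD hE hF (IsIsotypic.one (D := D)) hf (IsIsotypic.one (D := F))
      rw [elt_one, elt_one, tmul_one, tmul_one, tmul_one_left, tmul_one_left] at this
      exact this
  have h3 : ∀ c : F.CAlg, (assoc hD hE hF).hom (inr _ _ c) = inr _ _ (inr _ _ c) := fun c => by
    refine DFunLike.congr_fun (hF.separatingFamily.hom_ext
      (φ := (assoc hD hE hF).hom.comp (inr (D.prod E) F))
      (ψ := (inr D (E.prod F)).comp (inr E F)) fun r f hf => ?_) c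
    have := assoc_tmul_elt hD hE hF (IsIsotypic.one (D := D)) (IsIsotypic.one (D := E)) hf
    rw [elt_one, elt_one, tmul_one, map_one, tmul_one_left, tmul_one_left, tmul_one_left] at this
    exact this
  simp only [tmul, map_mul, h1, h2, h3, mul_assoc]

theorem exists_isAssociator {D E F : ToricDatum} (hD : D.Separated) (hE : E.Separated)
    (hF : F.Separated) : ∃ α : ((D.prod E).prod F).CAlg ≃⋆ₐ[ℂ] (D.prod (E.prod F)).CAlg,
    IsAssociator α := by
  have h1 : (assocInv hD hE hF).hom.comp (assoc hD hE hF).hom = StarAlgHom.id ℂ _ := by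
    refine ((hD.prod hE).prod hF).separatingFamily.hom_ext fun r f hf => ?_
    have e1 : (assoc hD hE hF).hom (((D.prod E).prod F).elt r f hf) = _ :=
      reindex_hom_elt hf rfl rfl (IsIsotypic.reindex (φ := assocMap D E F)
        (e := assocEquiv D E F) (fun _ _ => rfl) hf)
    have e2 : (assocInv hD hE hF).hom ((assoc hD hE hF).hom
        (((D.prod E).prod F).elt r f hf)) = ((D.prod E).prod F).elt r f hf := by
      rw [e1]
      exact reindex_hom_elt _ (by funext i; simp) rfl hf
    exact e2
  have h2 : (assoc hD hE hF).hom.comp (assocInv hD hE hF).hom = StarAlgHom.id ℂ _ := by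
    refine (hD.prod (hE.prod hF)).separatingFamily.hom_ext fun r f hf => ?_
    have e1 : (assocInv hD hE hF).hom ((D.prod (E.prod F)).elt r f hf) = _ :=
      reindex_hom_elt hf rfl rfl (IsIsotypic.reindex (φ := assocInvMap D E F)
        (e := (assocEquiv D E F).symm) (fun _ _ => rfl) hf)
    have e2 : (assoc hD hE hF).hom ((assocInv hD hE hF).hom
        ((D.prod (E.prod F)).elt r f hf)) = (D.prod (E.prod F)).elt r f hf := by
      rw [e1]
      exact reindex_hom_elt _ (by funext i; simp) rfl hf
    exact e2
  have hb : Function.Bijective (assoc hD hE hF).hom :=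
    ⟨Function.LeftInverse.injective fun a => DFunLike.congr_fun h1 a,
      Function.RightInverse.surjective fun a => DFunLike.congr_fun h2 a⟩
  exact ⟨StarAlgEquiv.ofBijective (assoc hD hE hF).hom hb, isAssociator_assoc hD hE hF⟩

end Assoc

end QMap

end ToricDatum

/-! ### Tools for reducing identities to generators -/

/-- A bimultiplicative function which is trivial on generators is trivial. -/
theorem eq_one_of_mem_closure {M : Type*} [AddCommGroup M] {F : M → M → ℂ}
    (hl0 : ∀ q, F 0 q = 1) (hr0 : ∀ p, F p 0 = 1)
    (hl : ∀ p p' q, F (p + p') q = F p q * F p' q) (hr : ∀ p q q', F p (q + q') = F p q * F p q')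
    (hnl : ∀ p q, F (-p) q = (F p q)⁻¹) (hnr : ∀ p q, F p (-q) = (F p q)⁻¹)
    {G : Set M} (hG : ∀ p ∈ G, ∀ q ∈ G, F p q = 1) {p q : M} (hp : p ∈ AddSubgroup.closure G)
    (hq : q ∈ AddSubgroup.closure G) : F p q = 1 := by
  induction hp, hq using AddSubgroup.closure_induction₂ with
  | mem x y hx hy => exact hG x hx y hy
  | zero_left x _ => exact hl0 x
  | zero_right x _ => exact hr0 x
  | add_left x y z _ _ _ h1 h2 => rw [hl, h1, h2, one_mul]
  | add_right x y z _ _ _ h1 h2 => rw [hr, h1, h2, one_mul]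
  | neg_left x y _ _ h => rw [hnl, h, inv_one]
  | neg_right x y _ _ h => rw [hnr, h, inv_one]

theorem exists_starSubalgebra_coe_eq_closure {A : Type*} [CStarAlgebra A]
    (S : StarSubalgebra ℂ A) : ∃ S' : StarSubalgebra ℂ A, (S' : Set A) = closure S :=
  ⟨S.topologicalClosure, StarSubalgebra.topologicalClosure_coe S⟩

/-- Including the adjoints of X in the centralizer makes it a closed *-subalgebra, so commutation
can be propagated from a dense generating family. -/
theorem exists_starSubalgebra_commuting {A B : Type*} [CStarAlgebra A] [CStarAlgebra B]
    (φ : B →⋆ₐ[ℂ] A) (X : Set A) : ∃ S : StarSubalgebra ℂ B, IsClosed (S : Set B) ∧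
      ∀ b, b ∈ S ↔ ∀ x ∈ X, x * φ b = φ b * x ∧ star x * φ b = φ b * star x :=
  ⟨(StarSubalgebra.centralizer ℂ X).comap φ,
    (Set.isClosed_centralizer _).preimage (continuous_starAlgHom φ),
    fun _ => StarSubalgebra.mem_centralizer_iff ℂ⟩

namespace ToricDatum

/-! ## Maps given by coordinate functions -/

theorem elt_congr {D : ToricDatum} {r s : D.ι → ℤ} {f g : C(D.X, ℂ)} (hf : D.IsIsotypic r f)
    (hg : D.IsIsotypic s g) (hr : r = s) (h : f = g) : D.elt r f hf = D.elt s g hg := by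
  subst hr h
  rfl

theorem elt_zero {D : ToricDatum} (r : D.ι → ℤ) : D.elt r 0 (IsIsotypic.zero r) = 0 :=
  D.incl_injective (by rw [map_zero, incl_elt, symbol_zero])

theorem elt_add {D : ToricDatum} {r : D.ι → ℤ} {f g : C(D.X, ℂ)} (hf : D.IsIsotypic r f)
    (hg : D.IsIsotypic r g) : D.elt r (f + g) (hf.add hg) = D.elt r f hf + D.elt r g hg :=
  D.incl_injective (by rw [map_add, incl_elt, incl_elt, incl_elt, symbol_add])

theorem elt_smul {D : ToricDatum} {r : D.ι → ℤ} {f : C(D.X, ℂ)} (c : ℂ)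
    (hf : D.IsIsotypic r f) : D.elt r (c • f) (hf.smul c) = c • D.elt r f hf :=
  D.incl_injective (by rw [map_smul, incl_elt, incl_elt, symbol_smul])

theorem elt_mul {D : ToricDatum} {r s : D.ι → ℤ} {f g : C(D.X, ℂ)} (hf : D.IsIsotypic r f)
    (hg : D.IsIsotypic s g) :
    D.elt r f hf * D.elt s g hg = bichar D.θ r s • D.elt (r + s) (f * g) (hf.mul hg) :=
  D.incl_injective (by rw [map_mul, map_smul, incl_elt, incl_elt, incl_elt, symbol_mul])

theorem star_elt {D : ToricDatum} {r : D.ι → ℤ} {f : C(D.X, ℂ)} (hf : D.IsIsotypic r f) :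
    star (D.elt r f hf) = D.elt (-r) (star f) hf.star :=
  D.incl_injective (by rw [map_star, incl_elt, incl_elt, star_symbol])

/-- Isotypic functions which separate the points of `D.X`. -/
structure Coordinates (D : ToricDatum) (J : Type) where
  deg : J → D.ι → ℤ
  fn : J → C(D.X, ℂ)
  isotypic : ∀ j, D.IsIsotypic (deg j) (fn j)
  separates : ∀ x y, (∀ j, fn j x = fn j y) → x = y

namespace Coordinates

variable {D E : ToricDatum} {J K : Type} (c : D.Coordinates J)

/-- The coordinates as elements of the deformed algebra. -/
def gen (j : J) : D.CAlg := D.elt (c.deg j) (c.fn j) (c.isotypic j)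

include c in
theorem separated : D.Separated := fun x y hxy => by
  by_contra! h
  exact hxy (c.separates x y fun j => h _ _ (c.isotypic j))

/-- The isotypic functions whose quantization lies in a `*`-algebra which contains the
coordinates. -/
theorem separatingFamily (S : StarSubalgebra ℂ D.CAlg) (hS : ∀ j, c.gen j ∈ S) :
    D.SeparatingFamily fun r f => ∃ h : D.IsIsotypic r f, D.elt r f h ∈ S where
  isotypic h := h.1
  zero r := ⟨IsIsotypic.zero r, by
    rw [elt_zero]
    exact S.zero_mem⟩
  one := ⟨IsIsotypic.one, by
    rw [QMap.elt_one]
    exact S.one_mem⟩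
  add := fun ⟨hf, h⟩ ⟨hg, h'⟩ => ⟨hf.add hg, by
    rw [elt_add hf hg]
    exact S.add_mem h h'⟩
  smul a := fun ⟨hf, h⟩ => ⟨hf.smul a, by
    have := elt_smul a hf
    rw [this]
    exact S.smul_mem h a⟩
  mul := fun {r s f g} ⟨hf, h⟩ ⟨hg, h'⟩ => ⟨hf.mul hg, by
    have := S.smul_mem (S.mul_mem h h') (bichar D.θ r s)⁻¹
    rwa [elt_mul, smul_smul, inv_mul_cancel₀ (bichar_ne_zero _ _ _), one_smul] at this⟩
  star := fun ⟨hf, h⟩ => ⟨hf.star, by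
    rw [← star_elt hf]
    exact star_mem h⟩
  separates {x y} hxy := by
    by_contra! h
    exact hxy (c.separates x y fun j => h _ _ ⟨c.isotypic j, hS j⟩)

theorem eq_top (S : StarSubalgebra ℂ D.CAlg) (hc : IsClosed (S : Set D.CAlg))
    (hS : ∀ j, c.gen j ∈ S) : S = ⊤ :=
  (c.separatingFamily S hS).eq_top S hc fun _ _ h => h.2

theorem hom_ext {B : Type*} [CStarAlgebra B] {φ ψ : D.CAlg →⋆ₐ[ℂ] B}
    (h : ∀ j, φ (c.gen j) = ψ (c.gen j)) : φ = ψ :=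
  (c.separatingFamily (StarAlgHom.equalizer φ ψ) h).hom_ext fun _ _ h => h.2

theorem closure_eq_univ (S : StarSubalgebra ℂ D.CAlg) (hS : ∀ j, c.gen j ∈ S) :
    closure (S : Set D.CAlg) = Set.univ := by
  obtain ⟨S', hS'⟩ := exists_starSubalgebra_coe_eq_closure S
  have := c.eq_top S' (hS' ▸ isClosed_closure) fun j => by
    rw [← SetLike.mem_coe, hS']
    exact subset_closure (hS j)
  rw [← hS', this]
  rfl

variable [Fintype K]

/-- A map of the underlying spaces for which the pullback of each coordinate is a sum of isotypic
functions. -/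
structure Pullback (c : D.Coordinates J) (E : ToricDatum) (K : Type) [Fintype K] where
  map : C(E.X, D.X)
  deg : J → K → E.ι → ℤ
  fn : J → K → C(E.X, ℂ)
  isotypic : ∀ j k, E.IsIsotypic (deg j k) (fn j k)
  comp_map : ∀ j, (c.fn j).comp map = ∑ k, fn j k
  isotropic : ∀ j k, fn j k ≠ 0 → ∀ j' k', fn j' k' ≠ 0 →
    bichar E.θ (deg j k) (deg j' k') = bichar D.θ (c.deg j) (c.deg j')

namespace Pullback

variable {c} (P : c.Pullback E K)

/-- The relation generated by the degrees of the components of the pullbacks. -/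
def rel : AddSubgroup ((E.ι → ℤ) × (D.ι → ℤ)) :=
  AddSubgroup.closure {p | ∃ j k, P.fn j k ≠ 0 ∧ p = (P.deg j k, c.deg j)}

/-- The quotient of the two bicharacters is bimultiplicative, so it is trivial on the generated
group once it is trivial on pairs of generators. -/
theorem isotropic_rel (p) (hp : p ∈ P.rel) (q) (hq : q ∈ P.rel) :
    bichar E.θ p.1 q.1 = bichar D.θ p.2 q.2 := by
  rw [← div_eq_one_iff_eq (bichar_ne_zero _ _ _)]
  refine eq_one_of_mem_closure
    (F := fun p q : (E.ι → ℤ) × (D.ι → ℤ) => bichar E.θ p.1 q.1 / bichar D.θ p.2 q.2)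
    ?_ ?_ ?_ ?_ ?_ ?_ ?_ hp hq
  · intro q
    simp [bichar_zero_left]
  · intro q
    simp [bichar_zero_right]
  · intro p p' q
    simp only [Prod.fst_add, Prod.snd_add, bichar_add_left]
    exact mul_div_mul_comm _ _ _ _
  · intro p q q'
    simp only [Prod.fst_add, Prod.snd_add, bichar_add_right]
    exact mul_div_mul_comm _ _ _ _
  · intro p q
    simp only [Prod.fst_neg, Prod.snd_neg, bichar_neg_left]
    rw [inv_div_inv, inv_div]
  · intro p q
    simp only [Prod.fst_neg, Prod.snd_neg, bichar_neg_right]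
    rw [inv_div_inv, inv_div]
  · rintro _ ⟨j, k, h, rfl⟩ _ ⟨j', k', h', rfl⟩
    exact (div_eq_one_iff_eq (bichar_ne_zero _ _ _)).2 (P.isotropic j k h j' k' h')

theorem mem_quantOn (j : J) {S : Set (E.ι → ℤ)} (hS : S = {m | (m, c.deg j) ∈ P.rel}) :
    (E.incl (∑ k, E.elt _ _ (P.isotypic j k)), (c.fn j).comp P.map) ∈ E.quantOn S := by
  have h : ∀ k, (E.symbol (P.deg j k) (P.fn j k), P.fn j k) ∈ E.quantOn S := fun k => by
    by_cases h0 : P.fn j k = 0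
    · rw [h0, symbol_zero]
      exact zero_mem _
    · refine symbol_mem_quantOn ?_ (P.isotypic j k)
      rw [hS]
      exact AddSubgroup.subset_closure ⟨j, k, h0, rfl⟩
  have := Submodule.sum_mem (E.quantOn S) fun k (_ : k ∈ Finset.univ) => h k
  convert this using 1
  refine Prod.ext ?_ ?_
  · rw [Prod.fst_sum, map_sum]
    rfl
  · rw [Prod.snd_sum]
    exact P.comp_map j

/-- The quantized map. -/
def toQMap : D.QMap E where
  map := P.map
  rel := P.rel
  isotropic := P.isotropic_rel
  separates x y hxy := by
    by_contra! h
    exact hxy (c.separates x y fun j => h _ _ ⟨c.isotypic j, _, P.mem_quantOn j rfl⟩)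

theorem toQMap_hom_gen (j : J) : P.toQMap.hom (c.gen j) = ∑ k, E.elt _ _ (P.isotypic j k) :=
  QMap.hom_elt _ _ (P.mem_quantOn j rfl)

theorem liftable (j : J) : P.toQMap.Liftable (c.deg j) (c.fn j) :=
  ⟨c.isotypic j, _, P.mem_quantOn j rfl⟩

end Pullback

end Coordinates

/-! ## The two factors of a tensor product -/

section Tensor

variable {D E : ToricDatum}

theorem commute_inl_inr_elt {r : D.ι → ℤ} {f : C(D.X, ℂ)} (hf : D.IsIsotypic r f)
    {s : E.ι → ℤ} {g : C(E.X, ℂ)} (hg : E.IsIsotypic s g) :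
    inl D E (D.elt r f hf) * inr D E (E.elt s g hg) =
      inr D E (E.elt s g hg) * inl D E (D.elt r f hf) := by
  rw [inl_elt, inr_elt, elt_mul, elt_mul, bichar_join, bichar_join]
  simp only [bichar_zero_left, bichar_zero_right]
  congr 1
  exact elt_congr _ _ (add_comm _ _) (mul_comm _ _)

/-- The block diagonal matrix pairs degrees of the two factors trivially, so isotypic elements
commute. Density is applied first in b, for isotypic a, and then in a. -/
theorem commute_inl_inr (hD : D.Separated) (hE : E.Separated) (a : D.CAlg) (b : E.CAlg) :
    inl D E a * inr D E b = inr D E b * inl D E a := by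
  have h1 : ∀ r f (hf : D.IsIsotypic r f) (b : E.CAlg),
      inl D E (D.elt r f hf) * inr D E b = inr D E b * inl D E (D.elt r f hf) := by
    intro r f hf b
    obtain ⟨S, hS, hm⟩ := exists_starSubalgebra_commuting (inr D E) {inl D E (D.elt r f hf)}
    have : S = ⊤ := by
      refine hE.separatingFamily.eq_top _ hS fun s g hg => (hm _).2 ?_
      rintro _ rfl
      refine ⟨commute_inl_inr_elt hf hg, ?_⟩
      rw [← map_star, star_elt]
      exact commute_inl_inr_elt hf.star hg
    exact ((hm b).1 (this ▸ StarSubalgebra.mem_top) _ rfl).1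
  obtain ⟨S, hS, hm⟩ := exists_starSubalgebra_commuting (inl D E) (Set.range (inr D E))
  have : S = ⊤ := by
    refine hD.separatingFamily.eq_top _ hS fun s g hg => (hm _).2 ?_
    rintro _ ⟨b, rfl⟩
    refine ⟨(h1 _ _ _ _).symm, ?_⟩
    rw [← map_star]
    exact (h1 _ _ _ _).symm
  exact ((hm a).1 (this ▸ StarSubalgebra.mem_top) _ ⟨b, rfl⟩).1.symm

theorem tmul_sum_left {K : Type} (s : Finset K) (a : K → D.CAlg) (b : E.CAlg) :
    tmul (∑ k ∈ s, a k) b = ∑ k ∈ s, tmul (a k) b := by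
  simp only [tmul, map_sum]
  exact Finset.sum_mul _ _ _

theorem tmul_sum_right {K : Type} (s : Finset K) (a : D.CAlg) (b : K → E.CAlg) :
    tmul a (∑ k ∈ s, b k) = ∑ k ∈ s, tmul a (b k) := by
  simp only [tmul, map_sum]
  exact Finset.mul_sum _ _ _

/-- A homomorphism into a tensor product maps the `*`-algebra generated by a set into the span of
the elementary tensors of two `*`-algebras if it does so for the generators. -/
theorem map_mem_span_tmul {A : Type*} [CStarAlgebra A] (hD : D.Separated) (hE : E.Separated)
    (S : StarSubalgebra ℂ D.CAlg) (T : StarSubalgebra ℂ E.CAlg) (φ : A →⋆ₐ[ℂ] (D.prod E).CAlg)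
    {G : Set A}
    (hG : ∀ a ∈ G, φ a ∈ Submodule.span ℂ {c | ∃ h ∈ S, ∃ b ∈ T, c = tmul h b})
    {a : A} (ha : a ∈ StarAlgebra.adjoin ℂ G) :
    φ a ∈ Submodule.span ℂ {c | ∃ h ∈ S, ∃ b ∈ T, c = tmul h b} := by
  induction ha using StarAlgebra.adjoin_induction with
  | mem x hx => exact hG x hx
  | algebraMap r =>
    rw [AlgHomClass.commutes, Algebra.algebraMap_eq_smul_one]
    exact Submodule.smul_mem _ _ (Submodule.subset_span ⟨1, S.one_mem, 1, T.one_mem, by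
      rw [tmul_one_left, map_one]⟩)
  | add x y _ _ hx hy => rw [map_add]; exact add_mem hx hy
  | mul x y _ _ hx hy =>
    rw [map_mul]
    have := Submodule.mul_mem_mul hx hy
    rw [Submodule.span_mul_span] at this
    refine Submodule.span_mono ?_ this
    rintro _ ⟨_, ⟨h, hh, b, hb, rfl⟩, _, ⟨h', hh', b', hb', rfl⟩, rfl⟩
    refine ⟨h * h', S.mul_mem hh hh', b * b', T.mul_mem hb hb', ?_⟩
    simp only [tmul, map_mul, mul_assoc]
    rw [← mul_assoc (inl D E h'), commute_inl_inr hD hE h' b]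
    simp only [mul_assoc]
  | star x _ hx =>
    rw [map_star]
    generalize φ x = y at hx ⊢
    induction hx using Submodule.span_induction with
    | mem y hy =>
      obtain ⟨h, hh, b, hb, rfl⟩ := hy
      refine Submodule.subset_span ⟨star h, star_mem hh, star b, star_mem hb, ?_⟩
      rw [tmul, tmul, star_mul, map_star, map_star, ← map_star, ← map_star,
        commute_inl_inr hD hE]
    | zero => rw [star_zero]; exact zero_mem _
    | add y z _ _ hy hz => rw [star_add]; exact add_mem hy hz
    | smul r y _ hy => rw [star_smul]; exact Submodule.smul_mem _ _ hy

end Tensor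

/-! ## The point -/

/-- The one point space. -/
def point : ToricDatum where
  X := Unit
  ι := Empty
  act _ x := x
  act_one _ := rfl
  act_mul _ _ _ := rfl
  continuous_act := continuous_snd
  θ := 0
  skew := by simp

theorem point_separated : point.Separated := fun _ _ h => (h rfl).elim

theorem point_elt {r : point.ι → ℤ} {f : C(point.X, ℂ)} (hf : point.IsIsotypic r f) :
    point.elt r f hf = algebraMap ℂ _ (f ()) := by
  rw [Algebra.algebraMap_eq_smul_one, ← QMap.elt_one, ← elt_smul]
  refine elt_congr _ _ (funext fun i => i.elim) ?_
  ext1 x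
  exact (mul_one _).symm

theorem isClosed_range_algebraMap {A : Type*} [CStarAlgebra A] [Nontrivial A] :
    IsClosed ((StarAlgHom.ofId ℂ A).range : Set A) :=
  (algebraMap_isometry ℂ A).isClosedEmbedding.isClosed_range

theorem point_nontrivial : Nontrivial point.CAlg := by
  refine ⟨0, 1, fun h => ?_⟩
  have h1 := congrArg (fun a => point.incl a () (L2.basis 0)) h
  simp only [map_zero, map_one] at h1
  have h2 := L2.norm_basis (0 : point.ι → ℤ)
  rw [← show (1 : C(point.X, BL2 (point.ι → ℤ))) () (L2.basis 0) = L2.basis 0 from rfl, ← h1] at h2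
  change ‖(0 : L2 (point.ι → ℤ))‖ = 1 at h2
  rw [norm_zero] at h2
  exact zero_ne_one h2

/-- All isotypic elements over a point are scalars, and the scalars form a closed subalgebra. -/
theorem point_bijective : Function.Bijective (StarAlgHom.ofId ℂ point.CAlg) := by
  have := point_nontrivial
  refine ⟨(algebraMap_isometry ℂ point.CAlg).injective, fun a => ?_⟩
  have := point_separated.separatingFamily.eq_top (StarAlgHom.ofId ℂ point.CAlg).range
    isClosed_range_algebraMap fun r f hf => by
      rw [point_elt]
      exact ⟨f (), rfl⟩
  exact (this ▸ StarSubalgebra.mem_top : a ∈ (StarAlgHom.ofId ℂ point.CAlg).range)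

/-- The algebra of functions on a point. -/
def pointEquiv : point.CAlg ≃⋆ₐ[ℂ] ℂ := (StarAlgEquiv.ofBijective _ point_bijective).symm

theorem pointEquiv_algebraMap (c : ℂ) : pointEquiv (algebraMap ℂ _ c) = c :=
  (StarAlgEquiv.ofBijective _ point_bijective).symm_apply_apply c

/-- The canonical isomorphism `ℂ ⊗ A ≅ A`, as a quantized map. -/
def unitor (D : ToricDatum) (hD : D.Separated) : (point.prod D).QMap D :=
  QMap.reindex ⟨fun x => ((), x), by
    have : Continuous fun x : D.X => ((), x) := by fun_prop
    exact this⟩ (Equiv.emptySum Empty D.ι) (fun _ _ => rfl) (fun r s => by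
      rw [bichar_prod_θ]
      rw [show bichar point.θ (fun i => r (Sum.inl i)) (fun i => s (Sum.inl i)) = 1 from by
        rw [bichar, show point.θ = 0 from rfl, Matrix.zero_mulVec, dotProduct_zero]
        simp, one_mul]
      rfl) (point_separated.prod hD)

theorem unitor_tmul {D : ToricDatum} (hD : D.Separated) (a : point.CAlg) (b : D.CAlg) :
    (unitor D hD).hom (tmul a b) = pointEquiv a • b := by
  obtain ⟨c, rfl⟩ := point_bijective.2 a
  have h : ∀ b, (unitor D hD).hom (inr point D b) = b := fun b => by
    refine DFunLike.congr_fun (hD.separatingFamily.hom_ext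
      (φ := (unitor D hD).hom.comp (inr point D)) (ψ := StarAlgHom.id ℂ _) fun r f hf => ?_) b
    change (unitor D hD).hom (inr point D _) = _
    rw [inr_elt]
    refine QMap.reindex_hom_elt _ ?_ ?_ hf
    · rfl
    · ext1 x
      exact (one_mul _).symm
  rw [tmul, map_mul, h]
  change (unitor D hD).hom (inl point D (algebraMap ℂ _ c)) * b =
    pointEquiv (algebraMap ℂ _ c) • b
  rw [pointEquiv_algebraMap, AlgHomClass.commutes, AlgHomClass.commutes, Algebra.smul_def]

end ToricDatum

/-! ## The quantum group `SU(3)_θ` -/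

instance SU3.instIsTopologicalGroup : IsTopologicalGroup SU3 where
  continuous_mul := by
    refine Continuous.subtype_mk ?_ _
    exact (continuous_subtype_val.comp continuous_fst).mul
      (continuous_subtype_val.comp continuous_snd)
  continuous_inv := by
    refine Continuous.subtype_mk ?_ _
    exact continuous_star.comp continuous_subtype_val

theorem bichar_fromBlocks {ι κ : Type} [Fintype ι] [Fintype κ] (A : Matrix ι ι ℝ)
    (B : Matrix κ κ ℝ) (r r' : ι → ℤ) (s s' : κ → ℤ) :
    bichar (Matrix.fromBlocks A 0 0 B) (Sum.elim r s) (Sum.elim r' s') =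
      bichar A r r' * bichar B s s' := by
  simp only [bichar]
  rw [← Complex.exp_add]
  congr 1
  simp [dotProduct, Matrix.mulVec]
  ring

theorem bichar_neg_matrix {ι : Type} [Fintype ι] (A : Matrix ι ι ℝ) (r s : ι → ℤ) :
    bichar (-A) r s = (bichar A r s)⁻¹ := by
  simp only [bichar]
  rw [← Complex.exp_neg]
  congr 1
  simp [Matrix.neg_mulVec]

theorem bichar_single {ι : Type} [Fintype ι] [DecidableEq ι] (A : Matrix ι ι ℝ) (i j : ι) :
    bichar A (Pi.single i 1) (Pi.single j 1) =
      Complex.exp (Real.pi * Complex.I * (A i j : ℂ)) := by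
  have h : ∀ k : ι, (fun i => ((Pi.single k (1 : ℤ) : ι → ℤ) i : ℝ)) = Pi.single k (1 : ℝ) :=
    fun k => by
      funext i
      by_cases h : i = k
      · subst h; simp
      · simp [h]
  rw [bichar, h, h, Matrix.mulVec_single_one, single_one_dotProduct]
  rfl

/-- The weights of the defining representation of `SU(3)`. -/
def wt (i : Fin 3) : Fin 2 → ℤ := ![![1, 0], ![0, 1], ![-1, -1]] i

/-- The bicharacter of two weights. -/
def wtChar (θ : ℝ) (i j : Fin 3) : ℂ := bichar !![0, -θ; θ, 0] (wt i) (wt j)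

/-- The exponent of the bicharacter of two weights. -/
def wtForm (θ : ℝ) (i j : Fin 3) : ℝ := θ * !![0, -1, 1; 1, 0, -1; -1, 1, 0] i j

theorem wtChar_ne_zero (θ : ℝ) (i j : Fin 3) : wtChar θ i j ≠ 0 := bichar_ne_zero _ _ _

/-- The three weights sum to zero, so the form given by K takes the cyclic values 0, -θ, θ on them.
-/
theorem wtChar_eq (θ : ℝ) (i j : Fin 3) :
    wtChar θ i j = Complex.exp (Real.pi * Complex.I * (wtForm θ i j : ℂ)) := by
  have : (fun k => (wt i k : ℝ)) ⬝ᵥ (!![0, -θ; θ, 0] *ᵥ fun k => (wt j k : ℝ)) = wtForm θ i j := by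
    fin_cases i <;> fin_cases j <;>
      simp [wt, wtForm, dotProduct, Matrix.mulVec, Fin.sum_univ_two]
  rw [wtChar, bichar, this]

theorem uDeg_eq (i j : Fin 3) : uDeg i j = Sum.elim (-wt i) (wt j) := by
  rw [uDeg, wt, wt]
  congr 1
  fin_cases i <;> funext k <;> fin_cases k <;> rfl

/-- The block K contributes the row indices, whose two signs cancel, and the block -K contributes
the inverse for the column indices. It is this opposition of rows and columns that makes matrix
products compatible with the deformation. -/
theorem bichar_uDeg (θ : ℝ) (i j i' j' : Fin 3) :
    bichar (qSU3 θ).θ (uDeg i j) (uDeg i' j') = wtChar θ i i' * (wtChar θ j j')⁻¹ := by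
  rw [uDeg_eq, uDeg_eq]
  refine (bichar_fromBlocks _ _ _ _ _ _).trans ?_
  rw [bichar_neg_left, bichar_neg_right, inv_inv, bichar_neg_matrix]
  rfl

/-- The matrix entries as coordinates of `SU(3)`. -/
def coordSU3 (θ : ℝ) : (qSU3 θ).Coordinates (Fin 3 × Fin 3) where
  deg p := uDeg p.1 p.2
  fn p := uFun p.1 p.2
  isotypic p := uFun_isotypic θ p.1 p.2
  separates _ _ h := Subtype.ext (Matrix.ext fun i j => h (i, j))

theorem bichar_coordSU3 (θ : ℝ) (p q : Fin 3 × Fin 3) :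
    bichar (qSU3 θ).θ ((coordSU3 θ).deg p) ((coordSU3 θ).deg q) =
      wtChar θ p.1 q.1 * (wtChar θ p.2 q.2)⁻¹ := bichar_uDeg θ _ _ _ _

open ToricDatum

/-- The multiplication of `SU(3)`, as a quantized map. -/
def mulPullback (θ : ℝ) : (coordSU3 θ).Pullback ((qSU3 θ).prod (qSU3 θ)) (Fin 3) where
  map := ⟨fun p : SU3 × SU3 => p.1 * p.2, by
    have : Continuous fun p : SU3 × SU3 => p.1 * p.2 := by fun_prop
    exact this⟩
  deg p k := join ((coordSU3 θ).deg (p.1, k)) ((coordSU3 θ).deg (k, p.2))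
  fn p k := outer ((coordSU3 θ).fn (p.1, k)) ((coordSU3 θ).fn (k, p.2))
  isotypic p k := ((coordSU3 θ).isotypic (p.1, k)).outer ((coordSU3 θ).isotypic (k, p.2))
  comp_map p := by
    ext1 x
    rw [ContinuousMap.sum_apply]
    exact Matrix.mul_apply (M := (x.1 : SU3).1) (N := (x.2 : SU3).1)
  -- The summation indices k, k' enter once as columns and once as rows, with inverse contributions.
  isotropic p k _ p' k' _ := by
    rw [bichar_join, bichar_coordSU3, bichar_coordSU3, bichar_coordSU3]
    have := wtChar_ne_zero θ k k'
    field_simp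

/-- The coproduct of `C(SU(3)_θ)`. -/
def coprod (θ : ℝ) : (qSU3 θ).CAlg →⋆ₐ[ℂ] ((qSU3 θ).prod (qSU3 θ)).CAlg :=
  (mulPullback θ).toQMap.hom

theorem coprod_u (θ : ℝ) (i j : Fin 3) :
    coprod θ (u θ i j) = ∑ k, tmul (u θ i k) (u θ k j) := by
  refine ((mulPullback θ).toQMap_hom_gen (i, j)).trans (Finset.sum_congr rfl fun k _ => ?_)
  exact (tmul_elt (uFun_isotypic θ i k) (uFun_isotypic θ k j)).symm

theorem ToricDatum.IsIsotypic.const (D : ToricDatum) (c : ℂ) :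
    D.IsIsotypic 0 (ContinuousMap.const D.X c) := fun t x => by simp

/-- The unit of `SU(3)`, as a quantized map. -/
def onePullback (θ : ℝ) : (coordSU3 θ).Pullback point Unit where
  map := ContinuousMap.const _ (1 : SU3)
  deg _ _ := 0
  fn p _ := ContinuousMap.const _ ((1 : Matrix (Fin 3) (Fin 3) ℂ) p.1 p.2)
  isotypic _ _ := IsIsotypic.const _ _
  comp_map p := by
    ext1 x
    rw [ContinuousMap.sum_apply]
    simp only [Finset.univ_unique, Finset.sum_const, Finset.card_singleton, one_smul]
    rfl
  isotropic p _ h p' _ h' := by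
    -- Only diagonal entries are nonzero at the identity. Their degrees pair trivially, since rows
    -- and columns cancel; off-diagonal degrees need not, which is why the condition is imposed on
    -- nonzero components only.
    have hd : ∀ p : Fin 3 × Fin 3, ContinuousMap.const point.X
        ((1 : Matrix (Fin 3) (Fin 3) ℂ) p.1 p.2) ≠ 0 → p.1 = p.2 := fun p h => by
      by_contra hne
      exact h (by rw [Matrix.one_apply_ne hne]; rfl)
    refine Eq.trans ?_ (bichar_uDeg θ p.1 p.2 p'.1 p'.2).symm
    rw [hd p h, hd p' h', mul_inv_cancel₀ (wtChar_ne_zero _ _ _), bichar_zero_left]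

/-- The counit of `C(SU(3)_θ)`. -/
def counit (θ : ℝ) : (qSU3 θ).CAlg →⋆ₐ[ℂ] ℂ :=
  (pointEquiv : point.CAlg →⋆ₐ[ℂ] ℂ).comp (onePullback θ).toQMap.hom

theorem counit_u (θ : ℝ) (i j : Fin 3) : counit θ (u θ i j) = if i = j then 1 else 0 := by
  have h1 := (onePullback θ).toQMap_hom_gen (i, j)
  rw [Fintype.sum_unique, point_elt] at h1
  change pointEquiv ((onePullback θ).toQMap.hom ((coordSU3 θ).gen (i, j))) = _
  rw [h1, pointEquiv_algebraMap]
  exact Matrix.one_apply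

/-! ## The coaction on the deformation of `S⁵ × S⁵` -/

/-- The index of the `k`-th coordinate of the first or second factor of `ℂ³ × ℂ³`. -/
def zIdx (a : Fin 2) (k : Fin 3) : Fin 6 := ![Fin.castAdd 3 k, Fin.natAdd 3 k] a

theorem zIdx_cases {P : Fin 6 → Prop} (h : ∀ a k, P (zIdx a k)) (i : Fin 6) : P i :=
  Fin.addCases (m := 3) (n := 3) (motive := P) (fun k => h 0 k) (fun k => h 1 k) i

/-- The coordinates of `ℂ³ × ℂ³`. -/
def coordS5S5 (θ' : Matrix (Fin 6) (Fin 6) ℝ) (hθ' : θ'ᵀ = -θ') :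
    (qS5S5 θ' hθ').Coordinates (Fin 2 × Fin 3) where
  deg p := (Pi.single (zIdx p.1 p.2) (1 : ℤ) : Fin 6 → ℤ)
  fn p := zFun (zIdx p.1 p.2)
  isotypic p := zFun_isotypic θ' hθ' (zIdx p.1 p.2)
  separates _ _ h := Subtype.ext (funext (zIdx_cases fun a k => h (a, k)))

theorem coordS5S5_gen (θ' : Matrix (Fin 6) (Fin 6) ℝ) (hθ' : θ'ᵀ = -θ') (a : Fin 2) (k : Fin 3) :
    (coordS5S5 θ' hθ').gen (a, k) = zGen θ' hθ' (zIdx a k) := rfl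

/-- The linear action of `SU(3)` on `ℂ³ × ℂ³`. -/
def diagAct (g : SU3) (z : Fin 6 → ℂ) : Fin 6 → ℂ :=
  Fin.append (m := 3) (n := 3) (g.1 *ᵥ fun k => z (zIdx 0 k)) (g.1 *ᵥ fun k => z (zIdx 1 k))

theorem diagAct_zIdx (g : SU3) (z : Fin 6 → ℂ) (a : Fin 2) (s : Fin 3) :
    diagAct g z (zIdx a s) = ∑ k, g.1 s k * z (zIdx a k) := by
  fin_cases a
  · exact Fin.append_left _ _ s
  · exact Fin.append_right _ _ s

theorem SU3.sum_norm_sq_mulVec (g : SU3) (v : Fin 3 → ℂ) :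
    ∑ k, ‖(g.1 *ᵥ v) k‖ ^ 2 = ∑ k, ‖v k‖ ^ 2 := by
  have h : ∀ v : Fin 3 → ℂ, ((∑ k, ‖v k‖ ^ 2 : ℝ) : ℂ) = star v ⬝ᵥ v := fun v => by
    rw [dotProduct]
    push_cast
    exact Finset.sum_congr rfl fun k _ => (Complex.conj_mul' _).symm
  have hg : star g.1 * g.1 = 1 :=
    Matrix.mem_unitaryGroup_iff'.1 (Matrix.specialUnitaryGroup_le_unitaryGroup g.2)
  rw [← Complex.ofReal_inj, h, h, Matrix.star_mulVec, ← Matrix.dotProduct_mulVec,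
    Matrix.mulVec_mulVec, ← Matrix.star_eq_conjTranspose, hg, Matrix.one_mulVec]

theorem S5S5.sum_norm_sq (z : S5S5) (a : Fin 2) : ∑ k, ‖z.1 (zIdx a k)‖ ^ 2 = 1 := by
  rw [Fin.sum_univ_three]
  fin_cases a
  · exact z.2.1
  · exact z.2.2

/-- A point of `S⁵ × S⁵`. -/
def S5S5.mk (z : Fin 6 → ℂ) (h : ∀ a, ∑ k, ‖z (zIdx a k)‖ ^ 2 = 1) : S5S5 :=
  ⟨z, by
    have h0 := h 0
    have h1 := h 1
    rw [Fin.sum_univ_three] at h0 h1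
    exact ⟨h0, h1⟩⟩

/-- The diagonal action of `SU(3)` on `S⁵ × S⁵`. -/
def S5S5.smul (g : SU3) (z : S5S5) : S5S5 :=
  S5S5.mk (diagAct g z.1) fun a => by
    simp only [diagAct_zIdx]
    exact (SU3.sum_norm_sq_mulVec g _).trans (z.sum_norm_sq a)

theorem S5S5.continuous_smul : Continuous fun p : SU3 × S5S5 => S5S5.smul p.1 p.2 := by
  refine Continuous.subtype_mk (continuous_pi (zIdx_cases fun a s => ?_)) _
  simp only [diagAct_zIdx]
  refine continuous_finsetSum _ fun k _ => Continuous.mul ?_ ?_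
  · exact (uFun s k).continuous.comp continuous_fst
  · exact (zFun (zIdx a k)).continuous.comp continuous_snd

/-- The entries of `θ'` which correspond to the pairs of coordinates of the two factors differ by
`lam`. -/
def IsCompatible (θ lam : ℝ) (θ' : Matrix (Fin 6) (Fin 6) ℝ) : Prop :=
  ∀ a b s t, θ' (zIdx a s) (zIdx b t) = wtForm θ s t + lam * !![0, 1; -1, 0] a b

section Coaction

variable {θ lam : ℝ} {θ' : Matrix (Fin 6) (Fin 6) ℝ} (hθ' : θ'ᵀ = -θ')
  (hc : IsCompatible θ lam θ')

include hc in
theorem IsCompatible.bichar_single (a b : Fin 2) (s t : Fin 3) :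
    bichar θ' (Pi.single (zIdx a s) 1) (Pi.single (zIdx b t) 1) = wtChar θ s t *
      Complex.exp (Real.pi * Complex.I * ((lam * !![0, 1; -1, 0] a b : ℝ) : ℂ)) := by
  rw [_root_.bichar_single, hc, wtChar_eq, ← Complex.exp_add]
  push_cast
  ring_nf

include hc in
theorem IsCompatible.bichar_coordS5S5 (p q : Fin 2 × Fin 3) :
    bichar (qS5S5 θ' hθ').θ ((coordS5S5 θ' hθ').deg p) ((coordS5S5 θ' hθ').deg q) =
      wtChar θ p.2 q.2 *
        Complex.exp (Real.pi * Complex.I * ((lam * !![0, 1; -1, 0] p.1 q.1 : ℝ) : ℂ)) :=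
  hc.bichar_single _ _ _ _

/-- The diagonal action of `SU(3)` on `S⁵ × S⁵`, as a quantized map. -/
def actPullback : (coordS5S5 θ' hθ').Pullback ((qSU3 θ).prod (qS5S5 θ' hθ')) (Fin 3) where
  map := ⟨fun p : SU3 × S5S5 => S5S5.smul p.1 p.2, S5S5.continuous_smul⟩
  deg p k := join ((coordSU3 θ).deg (p.2, k)) ((coordS5S5 θ' hθ').deg (p.1, k))
  fn p k := outer ((coordSU3 θ).fn (p.2, k)) ((coordS5S5 θ' hθ').fn (p.1, k))
  isotypic p k := ((coordSU3 θ).isotypic (p.2, k)).outer ((coordS5S5 θ' hθ').isotypic (p.1, k))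
  comp_map p := by
    ext1 x
    rw [ContinuousMap.sum_apply]
    exact diagAct_zIdx x.1 x.2.1 p.1 p.2
  -- The columns of u contribute χ(k,k')⁻¹, which cancels the weight part χ(k,k') of the z's. The
  -- remaining phase depends only on which spheres the coordinates belong to, so it is unaffected by
  -- k and k'.
  isotropic p k _ p' k' _ := by
    rw [bichar_join, bichar_coordSU3, hc.bichar_coordS5S5, hc.bichar_coordS5S5, mul_assoc, inv_mul_cancel_left₀ (wtChar_ne_zero θ k k')]

/-- The diagonal coaction. -/
def coact : (qS5S5 θ' hθ').CAlg →⋆ₐ[ℂ] ((qSU3 θ).prod (qS5S5 θ' hθ')).CAlg :=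
  (actPullback hθ' hc).toQMap.hom

theorem coact_zGen (a : Fin 2) (s : Fin 3) : coact hθ' hc (zGen θ' hθ' (zIdx a s)) =
    ∑ k, tmul (u θ s k) (zGen θ' hθ' (zIdx a k)) := by
  refine ((actPullback hθ' hc).toQMap_hom_gen (a, s)).trans (Finset.sum_congr rfl fun k _ => ?_)
  exact (tmul_elt (uFun_isotypic θ s k) (zFun_isotypic θ' hθ' (zIdx a k))).symm

/-- Both identities are between homomorphisms, hence determined on the coordinates, where they
amount to the associativity of matrix multiplication and to the identity matrix acting trivially. -/
theorem isLeftCoaction_coact : IsLeftCoaction (coprod θ) (counit θ) (coact hθ' hc) where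
  coassoc := by
    have hH := (coordSU3 θ).separated
    have hA := (coordS5S5 θ' hθ').separated
    obtain ⟨α, hα⟩ := QMap.exists_isAssociator hH hH hA
    have h1 : IsTensorMap (coprod θ) (StarAlgHom.id ℂ (qS5S5 θ' hθ').CAlg)
        (QMap.prod (mulPullback θ).toQMap (QMap.refl _ hA)).hom := by
      have := QMap.isTensorMap_prod (mulPullback θ).toQMap (QMap.refl _ hA)
      rw [QMap.refl_hom] at this
      exact this
    have h2 : IsTensorMap (StarAlgHom.id ℂ (qSU3 θ).CAlg) (coact hθ' hc)
        (QMap.prod (QMap.refl _ hH) (actPullback hθ' hc).toQMap).hom := by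
      have := QMap.isTensorMap_prod (QMap.refl _ hH) (actPullback hθ' hc).toQMap
      rw [QMap.refl_hom] at this
      exact this
    refine ⟨_, _, α, h1, h2, hα, fun a => ?_⟩
    generalize (QMap.prod (mulPullback θ).toQMap (QMap.refl _ hA)).hom = Φ at h1
    generalize (QMap.prod (QMap.refl _ hH) (actPullback hθ' hc).toQMap).hom = Ψ at h2
    refine DFunLike.congr_fun ((coordS5S5 θ' hθ').hom_ext
      (φ := ((α : _ →⋆ₐ[ℂ] _).comp Φ).comp (coact hθ' hc)) (ψ := Ψ.comp (coact hθ' hc))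
      fun p => ?_) a
    change α (Φ (coact hθ' hc (zGen θ' hθ' (zIdx p.1 p.2)))) =
      Ψ (coact hθ' hc (zGen θ' hθ' (zIdx p.1 p.2)))
    rw [coact_zGen, map_sum, map_sum, map_sum]
    have e1 : ∀ k, α (Φ (tmul (u θ p.2 k) (zGen θ' hθ' (zIdx p.1 k)))) =
        ∑ l, tmul (u θ p.2 l) (tmul (u θ l k) (zGen θ' hθ' (zIdx p.1 k))) := fun k => by
      rw [h1, coprod_u, tmul_sum_left, map_sum]
      exact Finset.sum_congr rfl fun l _ => hα _ _ _
    have e2 : ∀ l, Ψ (tmul (u θ p.2 l) (zGen θ' hθ' (zIdx p.1 l))) =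
        ∑ k, tmul (u θ p.2 l) (tmul (u θ l k) (zGen θ' hθ' (zIdx p.1 k))) := fun l => by
      rw [h2, coact_zGen, tmul_sum_right]
      rfl
    simp only [e1, e2]
    exact Finset.sum_comm
  counit := by
    have hA := (coordS5S5 θ' hθ').separated
    have h1 : ∀ h a, ((unitor _ hA).hom.comp (QMap.prod (onePullback θ).toQMap
        (QMap.refl _ hA)).hom) (tmul h a) = counit θ h • a := fun h a => by
      have := QMap.isTensorMap_prod (onePullback θ).toQMap (QMap.refl _ hA) h a
      rw [QMap.refl_hom] at this
      rw [StarAlgHom.comp_apply, this, unitor_tmul]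
      rfl
    refine ⟨_, h1, fun a => ?_⟩
    generalize (unitor _ hA).hom.comp (QMap.prod (onePullback θ).toQMap
        (QMap.refl _ hA)).hom = Φ at h1
    refine DFunLike.congr_fun ((coordS5S5 θ' hθ').hom_ext
      (φ := Φ.comp (coact hθ' hc)) (ψ := StarAlgHom.id ℂ _) fun p => ?_) a
    change Φ (coact hθ' hc (zGen θ' hθ' (zIdx p.1 p.2))) = zGen θ' hθ' (zIdx p.1 p.2)
    rw [coact_zGen, map_sum]
    simp only [h1, counit_u, ite_smul, one_smul, zero_smul]
    exact Fintype.sum_ite_eq p.2 _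

theorem coact_mem_span {a : (qS5S5 θ' hθ').CAlg} (ha : a ∈ polyS5S5 θ' hθ') :
    coact hθ' hc a ∈ Submodule.span ℂ
      {c | ∃ h ∈ polySU3 θ, ∃ b ∈ polyS5S5 θ' hθ', c = tmul h b} := by
  refine map_mem_span_tmul (coordSU3 θ).separated (coordS5S5 θ' hθ').separated _ _ _ ?_ ha
  rintro _ ⟨i, rfl⟩
  revert i
  refine zIdx_cases fun a s => ?_
  rw [coact_zGen]
  refine Submodule.sum_mem _ fun k _ => Submodule.subset_span ⟨_, ?_, _, ?_, rfl⟩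
  · exact StarAlgebra.subset_adjoin ℂ _ ⟨(s, k), rfl⟩
  · exact StarAlgebra.subset_adjoin ℂ _ ⟨zIdx a k, rfl⟩

end Coaction

/-! ## Invariant polynomial functions on `S⁵ × S⁵` -/

/-- The polynomial functions on `S⁵ × S⁵`. -/
def polyFun : StarSubalgebra ℂ C(S5S5, ℂ) := StarAlgebra.adjoin ℂ (Set.range zFun)

/-- The function `w = ∑ z_k conj(z_{k+3})`. -/
def wFun : C(S5S5, ℂ) := ∑ k, zFun (zIdx 0 k) * star (zFun (zIdx 1 k))

theorem wFun_apply (z : S5S5) : wFun z = ∑ k, z.1 (zIdx 0 k) * star (z.1 (zIdx 1 k)) := by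
  rw [wFun, ContinuousMap.sum_apply]
  rfl

/-- The function is the Hermitian pairing of the two vectors, which unitary matrices preserve. -/
theorem wFun_smul (g : SU3) (z : S5S5) : wFun (S5S5.smul g z) = wFun z := by
  have h : ∀ x y : Fin 3 → ℂ, ∑ k, x k * star (y k) = star y ⬝ᵥ x := fun x y => by
    rw [dotProduct]
    exact Finset.sum_congr rfl fun k _ => mul_comm _ _
  have hg : star g.1 * g.1 = 1 :=
    Matrix.mem_unitaryGroup_iff'.1 (Matrix.specialUnitaryGroup_le_unitaryGroup g.2)
  have h1 : ∀ a s, (S5S5.smul g z).1 (zIdx a s) = (g.1 *ᵥ fun k => z.1 (zIdx a k)) s :=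
    fun a s => diagAct_zIdx g z.1 a s
  rw [wFun_apply, wFun_apply]
  simp only [h1]
  rw [h, h (fun k => z.1 (zIdx 0 k)) (fun k => z.1 (zIdx 1 k)), Matrix.star_mulVec,
    ← Matrix.dotProduct_mulVec,
    Matrix.mulVec_mulVec, ← Matrix.star_eq_conjTranspose, hg, Matrix.one_mulVec]

theorem apply_eq_of_mem_adjoin {X : Type*} [TopologicalSpace X] {w f : C(X, ℂ)}
    (hf : f ∈ StarAlgebra.adjoin ℂ {w}) {x y : X} (h : w x = w y) : f x = f y := by
  induction hf using StarAlgebra.adjoin_induction with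
  | mem f hf => rw [Set.mem_singleton_iff.1 hf, h]
  | algebraMap r => rfl
  | add f g _ _ hf hg => rw [ContinuousMap.add_apply, ContinuousMap.add_apply, hf, hg]
  | mul f g _ _ hf hg => rw [ContinuousMap.mul_apply, ContinuousMap.mul_apply, hf, hg]
  | star f _ hf => rw [ContinuousMap.star_apply, ContinuousMap.star_apply, hf]

/-- The points `((1, 0, 0), (conj c, s, 0))`. -/
def S5S5.slice (c : ℂ) (s : ℝ) (h : ‖c‖ ^ 2 + s ^ 2 = 1) : S5S5 :=
  ⟨![1, 0, 0, star c, s, 0], by simp, by simpa using h⟩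

theorem wFun_slice {c : ℂ} {s : ℝ} (h : ‖c‖ ^ 2 + s ^ 2 = 1) : wFun (S5S5.slice c s h) = c := by
  rw [wFun_apply, Fin.sum_univ_three]
  change (1 : ℂ) * star (star c) + 0 * star (s : ℂ) + 0 * star 0 = c
  simp

/-- On the slice the coordinates become 1, 0, 0, conj w, s, 0 with s real and s² = 1 - w conj w. So
polynomials restrict to expressions of degree at most one in s over the algebra generated by w and
its conjugate. -/
theorem exists_apply_slice_eq {f : C(S5S5, ℂ)} (hf : f ∈ polyFun) :
    ∃ a ∈ StarAlgebra.adjoin ℂ {wFun}, ∃ b ∈ StarAlgebra.adjoin ℂ {wFun}, ∀ c s h,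
      f (S5S5.slice c s h) = a (S5S5.slice c s h) + s * b (S5S5.slice c s h) := by
  have hw : wFun ∈ StarAlgebra.adjoin ℂ {wFun} := StarAlgebra.subset_adjoin ℂ _ rfl
  have hs : ∀ (c : ℂ) (s : ℝ) h, (s : ℂ) * s = (1 - wFun * star wFun) (S5S5.slice c s h) := fun c s h => by
    change (s : ℂ) * s = 1 - wFun (S5S5.slice c s h) * star (wFun (S5S5.slice c s h))
    rw [wFun_slice, Complex.star_def, Complex.mul_conj']
    have : ((‖c‖ ^ 2 + s ^ 2 : ℝ) : ℂ) = 1 := by rw [h]; simp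
    push_cast at this
    linear_combination this
  induction hf using StarAlgebra.adjoin_induction with
  | mem f hf =>
    obtain ⟨i, rfl⟩ := hf
    fin_cases i
    · exact ⟨1, one_mem _, 0, zero_mem _, fun c s h => by
        change (1 : ℂ) = 1 + s * 0
        simp⟩
    · exact ⟨0, zero_mem _, 0, zero_mem _, fun c s h => by
        change (0 : ℂ) = 0 + s * 0
        simp⟩
    · exact ⟨0, zero_mem _, 0, zero_mem _, fun c s h => by
        change (0 : ℂ) = 0 + s * 0
        simp⟩
    · exact ⟨star wFun, star_mem hw, 0, zero_mem _, fun c s h => by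
        change star c = star (wFun (S5S5.slice c s h)) + s * 0
        rw [wFun_slice]
        simp⟩
    · exact ⟨0, zero_mem _, 1, one_mem _, fun c s h => by
        change (s : ℂ) = 0 + s * 1
        simp⟩
    · exact ⟨0, zero_mem _, 0, zero_mem _, fun c s h => by
        change (0 : ℂ) = 0 + s * 0
        simp⟩
  | algebraMap r => exact ⟨_, algebraMap_mem _ r, 0, zero_mem _, fun c s h => by simp⟩
  | add f g _ _ hf hg =>
    obtain ⟨a, ha, b, hb, hf⟩ := hf
    obtain ⟨a', ha', b', hb', hg⟩ := hg
    refine ⟨a + a', add_mem ha ha', b + b', add_mem hb hb', fun c s h => ?_⟩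
    simp only [ContinuousMap.add_apply, hf, hg]
    ring
  | mul f g _ _ hf hg =>
    obtain ⟨a, ha, b, hb, hf⟩ := hf
    obtain ⟨a', ha', b', hb', hg⟩ := hg
    refine ⟨a * a' + (1 - wFun * star wFun) * (b * b'), add_mem (mul_mem ha ha')
      (mul_mem (sub_mem (one_mem _) (mul_mem hw (star_mem hw))) (mul_mem hb hb')),
      a * b' + b * a', add_mem (mul_mem ha hb') (mul_mem hb ha'), fun c s h => ?_⟩
    simp only [ContinuousMap.add_apply, ContinuousMap.mul_apply _ g, hf, hg]
    rw [ContinuousMap.mul_apply (1 - _), ← hs]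
    simp only [ContinuousMap.mul_apply]
    ring
  | star f _ hf =>
    obtain ⟨a, ha, b, hb, hf⟩ := hf
    refine ⟨star a, star_mem ha, star b, star_mem hb, fun c s h => ?_⟩
    simp only [ContinuousMap.star_apply, hf, star_add, star_mul', Complex.star_def,
      Complex.conj_ofReal]

/-- The element of `SU(3)` whose first two columns are given orthonormal vectors. -/
def SU3.ofColumns (p v : Fin 3 → ℂ) (hp : ∑ k, p k * star (p k) = 1)
    (hv : ∑ k, v k * star (v k) = 1) (hpv : ∑ k, star (p k) * v k = 0) : SU3 :=
  ⟨!![p 0, v 0, star (p 1 * v 2 - p 2 * v 1);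
      p 1, v 1, star (p 2 * v 0 - p 0 * v 2);
      p 2, v 2, star (p 0 * v 1 - p 1 * v 0)], by
    rw [Fin.sum_univ_three] at hp hv hpv
    have hvp := congrArg star hpv
    simp only [star_add, star_mul', star_star, star_zero] at hvp
    -- The third column is the conjugate of the cross product of p and v. Lagrange's identity |p ×
    -- v|² = |p|²|v|² - |⟨p, v⟩|² shows that it is a unit vector, and the same number is the
    -- determinant.
    have hn : (p 1 * v 2 - p 2 * v 1) * star (p 1 * v 2 - p 2 * v 1) +
        (p 2 * v 0 - p 0 * v 2) * star (p 2 * v 0 - p 0 * v 2) +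
        (p 0 * v 1 - p 1 * v 0) * star (p 0 * v 1 - p 1 * v 0) = 1 := by
      simp only [star_sub, star_mul']
      linear_combination (v 0 * star (v 0) + v 1 * star (v 1) + v 2 * star (v 2)) * hp + hv
        - (p 0 * star (v 0) + p 1 * star (v 1) + p 2 * star (v 2)) * hpv
    rw [Matrix.mem_specialUnitaryGroup_iff, Matrix.mem_unitaryGroup_iff']
    simp only [Complex.star_def, map_sub, map_mul] at hp hv hpv hvp hn
    constructor
    · ext i j
      rw [Matrix.mul_apply, Fin.sum_univ_three]
      simp only [Matrix.star_apply]
      fin_cases i <;> fin_cases j <;> simp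
      · linear_combination hp
      · linear_combination hpv
      · ring
      · linear_combination hvp
      · linear_combination hv
      · ring
      · ring
      · ring
      · linear_combination hn
    · rw [Matrix.det_fin_three]
      simp
      linear_combination hn⟩

theorem exists_orthogonal (p : Fin 3 → ℂ) :
    ∃ r : Fin 3 → ℂ, r ≠ 0 ∧ ∑ k, star (p k) * r k = 0 := by
  by_cases h : p 0 = 0
  · exact ⟨![1, 0, 0], fun h => one_ne_zero (congrFun h 0), by simp [Fin.sum_univ_three, h]⟩
  · refine ⟨![-star (p 1), star (p 0), 0], fun h' => h ?_, ?_⟩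
    · simpa using congrFun h' 1
    · simp [Fin.sum_univ_three]
      ring

theorem exists_unit_smul (r : Fin 3 → ℂ) (hr : r ≠ 0) : ∃ (v : Fin 3 → ℂ) (s : ℝ),
    ∑ k, v k * star (v k) = 1 ∧ r = (s : ℂ) • v ∧ s ≠ 0 := by
  have hpos : 0 < ∑ k, ‖r k‖ ^ 2 := by
    obtain ⟨k, hk⟩ := Function.ne_iff.1 hr
    exact Finset.sum_pos' (fun _ _ => by positivity) ⟨k, Finset.mem_univ _, by
      have := norm_pos_iff.2 hk
      positivity⟩
  set s := Real.sqrt (∑ k, ‖r k‖ ^ 2) with hs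
  have hs0 : (s : ℂ) ≠ 0 := by
    rw [Complex.ofReal_ne_zero]
    exact (Real.sqrt_pos.2 hpos).ne'
  have hss : (s : ℂ) * s = ∑ k, r k * star (r k) := by
    rw [← Complex.ofReal_mul, Real.mul_self_sqrt hpos.le]
    push_cast
    exact Finset.sum_congr rfl fun k _ => (Complex.mul_conj' _).symm
  refine ⟨(s : ℂ)⁻¹ • r, s, ?_, by rw [smul_smul, mul_inv_cancel₀ hs0, one_smul],
    Complex.ofReal_ne_zero.1 hs0⟩
  have : ∀ k, ((s : ℂ)⁻¹ • r) k * star (((s : ℂ)⁻¹ • r) k) =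
      ((s : ℂ) * s)⁻¹ * (r k * star (r k)) := fun k => by
    simp only [Pi.smul_apply, smul_eq_mul, star_mul', star_inv₀, Complex.star_def,
      Complex.conj_ofReal]
    field_simp
  simp only [this]
  rw [← Finset.mul_sum, ← hss]
  field_simp

/-- Gram–Schmidt: with p, q the two unit vectors and c their pairing, write q = conj(c) p + s v with
v a unit vector orthogonal to p. The matrix with first columns p, v carries the slice point to (p,
q). -/
theorem S5S5.exists_eq_smul_slice (z : S5S5) :
    ∃ g c s h, z = S5S5.smul g (S5S5.slice c s h) := by
  have hz : ∀ a, ∑ k, z.1 (zIdx a k) * star (z.1 (zIdx a k)) = 1 := fun a => by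
    have := congrArg (fun x : ℝ => (x : ℂ)) (z.sum_norm_sq a)
    push_cast at this
    rw [← this]
    exact Finset.sum_congr rfl fun k _ => Complex.mul_conj' _
  set p : Fin 3 → ℂ := fun k => z.1 (zIdx 0 k) with hp
  set q : Fin 3 → ℂ := fun k => z.1 (zIdx 1 k) with hq
  set c := ∑ k, p k * star (q k) with hc
  have hcs : ∑ k, star (p k) * q k = star c := by
    rw [hc, star_sum]
    exact Finset.sum_congr rfl fun k _ => by rw [star_mul', star_star]
  have horth : ∑ k, star (p k) * (q k - star c * p k) = 0 := by
    simp only [mul_sub, Finset.sum_sub_distrib, hcs]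
    have : ∀ k, star (p k) * (star c * p k) = star c * (p k * star (p k)) := fun k => by ring
    simp only [this, ← Finset.mul_sum]
    rw [show ∑ k, p k * star (p k) = 1 from hz 0, mul_one, sub_self]
  obtain ⟨v, s, hv, hpv, hqv⟩ : ∃ (v : Fin 3 → ℂ) (s : ℝ), ∑ k, v k * star (v k) = 1 ∧
      ∑ k, star (p k) * v k = 0 ∧ ∀ k, q k = star c * p k + s * v k := by
    -- If q is a multiple of p, any unit vector orthogonal to p serves as v, with s = 0.
    by_cases h0 : (fun k => q k - star c * p k) = 0
    · obtain ⟨r, hr, hpr⟩ := exists_orthogonal p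
      obtain ⟨v, s, hv, rfl, hs⟩ := exists_unit_smul r hr
      refine ⟨v, 0, hv, ?_, fun k => ?_⟩
      · simp only [Pi.smul_apply, smul_eq_mul, mul_left_comm _ (s : ℂ)] at hpr
        rw [← Finset.mul_sum] at hpr
        exact (mul_eq_zero.1 hpr).resolve_left (Complex.ofReal_ne_zero.2 hs)
      · have := congrFun h0 k
        simp only [Pi.zero_apply] at this
        rw [Complex.ofReal_zero]
        linear_combination this
    · obtain ⟨v, s, hv, hr, hs⟩ := exists_unit_smul _ h0
      have hk : ∀ k, q k - star c * p k = s * v k := fun k => congrFun hr k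
      refine ⟨v, s, hv, ?_, fun k => by linear_combination hk k⟩
      simp only [hk, mul_left_comm _ (s : ℂ)] at horth
      rw [← Finset.mul_sum] at horth
      exact (mul_eq_zero.1 horth).resolve_left (Complex.ofReal_ne_zero.2 hs)
  have hnorm : ‖c‖ ^ 2 + s ^ 2 = 1 := by
    have h1 := hz 1
    change ∑ k, q k * star (q k) = 1 at h1
    have hvp := congrArg star hpv
    have hp1 := hz 0
    change ∑ k, p k * star (p k) = 1 at hp1
    have hcc : c * star c = ((‖c‖ ^ 2 : ℝ) : ℂ) := by
      push_cast
      exact Complex.mul_conj' _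
    rw [← Complex.ofReal_inj, Complex.ofReal_add, ← hcc]
    push_cast
    simp only [hqv, star_add, star_mul', Complex.star_def, Complex.conj_ofReal,
      Fin.sum_univ_three, map_zero, Complex.conj_conj] at h1 hpv hvp hp1 hv ⊢
    linear_combination h1 - c * (starRingEnd ℂ) c * hp1 - (s : ℂ) ^ 2 * hv -
      c * s * hpv - (starRingEnd ℂ) c * s * hvp
  refine ⟨SU3.ofColumns p v (hz 0) hv hpv, c, s, hnorm, Subtype.ext (funext ?_)⟩
  refine zIdx_cases fun a k => ?_
  refine Eq.trans ?_ (diagAct_zIdx _ _ a k).symm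
  rw [Fin.sum_univ_three]
  fin_cases a
  · change p k = _ * 1 + _ * 0 + _ * 0
    rw [mul_one, mul_zero, mul_zero, add_zero, add_zero]
    fin_cases k <;> rfl
  · change q k = _ * star c + _ * (s : ℂ) + _ * 0
    rw [hqv, mul_zero, add_zero, mul_comm (star c), mul_comm (s : ℂ)]
    fin_cases k <;> rfl

/-- The matrix diag(1, -1, -1) does this: determinant one forces a second sign, placed on the third
coordinates, which vanish on the slice. -/
theorem S5S5.exists_smul_slice_neg {c : ℂ} {s : ℝ} (h : ‖c‖ ^ 2 + s ^ 2 = 1)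
    (h' : ‖c‖ ^ 2 + (-s) ^ 2 = 1) :
    ∃ g, S5S5.slice c (-s) h' = S5S5.smul g (S5S5.slice c s h) := by
  refine ⟨SU3.ofColumns ![1, 0, 0] ![0, -1, 0] (by simp [Fin.sum_univ_three])
    (by simp [Fin.sum_univ_three]) (by simp [Fin.sum_univ_three]), Subtype.ext (funext ?_)⟩
  refine zIdx_cases fun a k => ?_
  refine Eq.trans ?_ (diagAct_zIdx _ _ a k).symm
  rw [Fin.sum_univ_three]
  fin_cases a <;> fin_cases k <;>
    simp [SU3.ofColumns, S5S5.slice, zIdx, Fin.castAdd, Fin.natAdd, Fin.castLE]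

/-- The polynomial functions on `S⁵ × S⁵` which are invariant under `SU(3)` are the polynomials in
`w` and its conjugate. -/
theorem mem_adjoin_wFun {f : C(S5S5, ℂ)} (hf : f ∈ polyFun)
    (hinv : ∀ g z, f (S5S5.smul g z) = f z) : f ∈ StarAlgebra.adjoin ℂ {wFun} := by
  obtain ⟨a, ha, b, hb, hab⟩ := exists_apply_slice_eq hf
  have key : f = a := by
    ext1 z
    obtain ⟨g, c, s, h, rfl⟩ := S5S5.exists_eq_smul_slice z
    have h' : ‖c‖ ^ 2 + (-s) ^ 2 = 1 := by rwa [neg_sq]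
    rw [hinv, apply_eq_of_mem_adjoin ha (wFun_smul g _)]
    obtain ⟨g', hg'⟩ := S5S5.exists_smul_slice_neg h h'
    have e : f (S5S5.slice c (-s) h') = f (S5S5.slice c s h) := by rw [hg', hinv]
    have hw : wFun (S5S5.slice c (-s) h') = wFun (S5S5.slice c s h) := by
      rw [wFun_slice, wFun_slice]
    -- Invariance under s ↦ -s becomes a - s b = a + s b, so the term s b vanishes.
    rw [hab, hab, apply_eq_of_mem_adjoin ha hw, apply_eq_of_mem_adjoin hb hw] at e
    push_cast at e
    rw [hab]
    linear_combination (-1 / 2 : ℂ) * e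
  rw [key]
  exact ha

/-! ### Compression of operators to a slice -/

namespace L2

/-- The operator which restricts a vector to a slice. -/
def sliceL {I J K : Type} (e : K ≃ I × J) (q : J) : L2 K →L[ℂ] L2 I :=
  LinearMap.mkContinuous
    { toFun := slice e q
      map_add' := fun _ _ => rfl
      map_smul' := fun _ _ => rfl } 1 fun ξ => by
    rw [one_mul]
    have h := hasSum_slice e ξ
    have : ‖slice e q ξ‖ ^ 2 ≤ ‖ξ‖ ^ 2 := le_hasSum h q fun _ _ => by positivity
    exact le_of_sq_le_sq this (norm_nonneg _)

theorem sliceL_apply {I J K : Type} (e : K ≃ I × J) (q : J) (ξ : L2 K) (i : I) :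
    sliceL e q ξ i = ξ (e.symm (i, q)) := rfl

theorem norm_sliceL_le {I J K : Type} (e : K ≃ I × J) (q : J) : ‖sliceL e q‖ ≤ 1 :=
  LinearMap.mkContinuous_norm_le _ zero_le_one _

/-- The compression of an operator to a slice. -/
def compress {I J K : Type} (e : K ≃ I × J) (q : J) (T : BL2 K) : BL2 I :=
  (sliceL e q).comp (T.comp (ContinuousLinearMap.adjoint (sliceL e q)))

theorem norm_compress_le {I J K : Type} (e : K ≃ I × J) (q : J) (T : BL2 K) :
    ‖compress e q T‖ ≤ ‖T‖ := by
  have h := norm_sliceL_le e q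
  have h' : ‖ContinuousLinearMap.adjoint (sliceL e q)‖ ≤ 1 :=
    (LinearIsometryEquiv.norm_map _ _).trans_le h
  calc ‖compress e q T‖ ≤ ‖sliceL e q‖ * ‖T.comp (ContinuousLinearMap.adjoint (sliceL e q))‖ :=
        ContinuousLinearMap.opNorm_comp_le _ _
    _ ≤ ‖sliceL e q‖ * (‖T‖ * ‖ContinuousLinearMap.adjoint (sliceL e q)‖) := by
        gcongr
        exact ContinuousLinearMap.opNorm_comp_le _ _
    _ ≤ 1 * (‖T‖ * 1) := by gcongr
    _ = ‖T‖ := by ring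

theorem compress_sub {I J K : Type} (e : K ≃ I × J) (q : J) (S T : BL2 K) :
    compress e q (S - T) = compress e q S - compress e q T := by
  ext1 ξ
  simp [compress]

theorem compress_add {I J K : Type} (e : K ≃ I × J) (q : J) (S T : BL2 K) :
    compress e q (S + T) = compress e q S + compress e q T := by
  ext1 ξ
  simp [compress]

theorem compress_smul {I J K : Type} (e : K ≃ I × J) (q : J) (c : ℂ) (T : BL2 K) :
    compress e q (c • T) = c • compress e q T := by
  ext1 ξ
  simp [compress]

theorem continuous_compress {I J K : Type} (e : K ≃ I × J) (q : J) :
    Continuous (compress e q) :=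
  AddMonoidHomClass.continuous_of_bound
    (AddMonoidHom.mk' (compress e q) (compress_add e q)) 1 fun T => by
      rw [one_mul]
      exact norm_compress_le e q T

theorem adjoint_sliceL_basis {I J K : Type} (e : K ≃ I × J) (q : J) (i : I) :
    ContinuousLinearMap.adjoint (sliceL e q) (basis i) = basis (e.symm (i, q)) := by
  refine ext_inner_right ℂ fun ξ => ?_
  rw [ContinuousLinearMap.adjoint_inner_left, inner_basis_left, inner_basis_left, sliceL_apply]

theorem compress_amp {I J K : Type} (e : K ≃ I × J) (q : J) (T : BL2 I) :
    compress e q (amp e T) = T := by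
  classical
  refine op_ext fun i => ?_
  change sliceL e q (amp e T (ContinuousLinearMap.adjoint (sliceL e q) (basis i))) = _
  rw [adjoint_sliceL_basis]
  refine (slice_amp e T _ q).trans (congrArg T ?_)
  apply lp.ext
  funext j
  rw [slice_apply, basis_apply, basis_apply]
  simp

end L2

namespace ToricDatum

/-! ## Averaging over the first factor -/

section Average

variable {D E : ToricDatum}

/-- A nonzero degree in the first factor shifts the zero slice off itself; in degree zero the
operator is an amplification. -/
theorem compress_weyl (r : D.ι → ℤ) (s : E.ι → ℤ) [Decidable (r = 0)] :
    L2.compress (splitR D.ι E.ι) 0 (weyl (D.prod E).θ (join r s)) =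
      if r = 0 then weyl E.θ s else 0 := by
  split_ifs with h
  · subst h
    refine Eq.trans ?_ (L2.compress_amp (splitR D.ι E.ι) 0 (weyl E.θ s))
    rw [amp_weyl_right D E s]
    rfl
  · classical
    refine L2.op_ext fun i => lp.ext (funext fun j => ?_)
    change L2.sliceL (splitR D.ι E.ι) 0 (weyl (D.prod E).θ (join r s)
      (ContinuousLinearMap.adjoint (L2.sliceL (splitR D.ι E.ι) 0) (L2.basis i))) j = 0
    rw [L2.adjoint_sliceL_basis]
    refine (L2.sliceL_apply _ _ _ _).trans ?_
    refine mul_eq_zero_of_right _ ?_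
    refine (L2.basis_apply _ _).trans (if_neg fun h' => h ?_)
    funext k
    have := congrFun h' (Sum.inl k)
    change (0 : ℤ) - r k = 0 at this
    simpa using this

theorem IsIsotypic.apply_act_right {r : D.ι → ℤ} {s : E.ι → ℤ} {F : C((D.prod E).X, ℂ)}
    (hF : (D.prod E).IsIsotypic (join r s) F) (t : E.ι → Circle) (x : D.X) (z : E.X) :
    F (x, E.act t z) = torusChar s t * F (x, z) := by
  have h1 : (x, E.act t z) = (D.prod E).act (Sum.elim 1 t) (x, z) :=
    Prod.ext (D.act_one x).symm rfl
  have h2 : torusChar r 1 = 1 := by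
    rw [torusChar_apply]
    simp
  refine (congrArg F h1).trans ((isIsotypic_iff.1 hF (Sum.elim 1 t) (x, z)).trans ?_)
  refine congrArg (· * F (x, z)) ((torusChar_join r s _).trans ?_)
  change torusChar r 1 * torusChar s t = _
  rw [h2, one_mul]

theorem IsIsotypic.apply_act_left {r : D.ι → ℤ} {s : E.ι → ℤ} {F : C((D.prod E).X, ℂ)}
    (hF : (D.prod E).IsIsotypic (join r s) F) (t : D.ι → Circle) (x : D.X) (z : E.X) :
    F (D.act t x, z) = torusChar r t * F (x, z) := by
  have h1 : (D.act t x, z) = (D.prod E).act (Sum.elim t 1) (x, z) :=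
    Prod.ext rfl (E.act_one z).symm
  have h2 : torusChar s 1 = 1 := by
    rw [torusChar_apply]
    simp
  refine (congrArg F h1).trans ((isIsotypic_iff.1 hF (Sum.elim t 1) (x, z)).trans ?_)
  refine congrArg (· * F (x, z)) ((torusChar_join r s _).trans ?_)
  change torusChar r t * torusChar s 1 = _
  rw [h2, mul_one]

variable [MeasurableSpace D.X] [BorelSpace D.X] (μ : Measure D.X) [IsProbabilityMeasure μ]

/-- The function `z ↦ ∫ F(x, z) dμ(x)`. -/
def average (F : C((D.prod E).X, ℂ)) : C(E.X, ℂ) :=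
  ∫ x, (show C(D.X × E.X, ℂ) from F).curry x ∂μ

theorem average_apply (F : C((D.prod E).X, ℂ)) (z : E.X) :
    average μ F z = ∫ x, F (x, z) ∂μ :=
  ContinuousMap.integral_apply (integrable_of_continuous_of_compactSpace μ
    (show C(D.X × E.X, ℂ) from F).curry.continuous) z

theorem integrable_slice (F : C((D.prod E).X, ℂ)) (z : E.X) :
    Integrable (fun x => F (x, z)) μ :=
  integrable_of_continuous_of_compactSpace μ
    (F.continuous.comp (by fun_prop : Continuous fun x : D.X => (x, z)))

theorem average_add (F G : C((D.prod E).X, ℂ)) :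
    average μ (F + G) = average μ F + average μ G := by
  ext1 z
  rw [ContinuousMap.add_apply, average_apply, average_apply, average_apply,
    ← integral_add (integrable_slice μ F z) (integrable_slice μ G z)]
  rfl

theorem average_smul (c : ℂ) (F : C((D.prod E).X, ℂ)) :
    average μ (c • F) = c • average μ F := by
  ext1 z
  rw [ContinuousMap.smul_apply, average_apply, average_apply, ← integral_smul]
  rfl

theorem average_outer (f : C(D.X, ℂ)) (g : C(E.X, ℂ)) :
    average μ (outer f g) = (∫ x, f x ∂μ) • g := by
  ext1 z
  rw [average_apply, ContinuousMap.smul_apply, smul_eq_mul, ← integral_mul_const]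
  rfl

/-- The operator `∫ ⟨e₀| G(x, z) |e₀⟩ dμ(x)`. -/
def averageOp (G : C((D.prod E).X, BL2 ((D.prod E).ι → ℤ))) (z : E.X) : BL2 (E.ι → ℤ) :=
  ∫ x, L2.compress (splitR D.ι E.ι) 0 (G (x, z)) ∂μ

theorem integrable_averageOp (G : C((D.prod E).X, BL2 ((D.prod E).ι → ℤ))) (z : E.X) :
    Integrable (fun x => L2.compress (splitR D.ι E.ι) 0 (G (x, z))) μ :=
  integrable_of_continuous_of_compactSpace μ ((L2.continuous_compress _ _).comp
    (G.continuous.comp (by fun_prop : Continuous fun x : D.X => (x, z))))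

theorem averageOp_sub (G G' : C((D.prod E).X, BL2 ((D.prod E).ι → ℤ))) (z : E.X) :
    averageOp μ (G - G') z = averageOp μ G z - averageOp μ G' z := by
  rw [averageOp, averageOp, averageOp,
    ← integral_sub (integrable_averageOp μ G z) (integrable_averageOp μ G' z)]
  exact congrArg (fun h => ∫ x, h x ∂μ) (funext fun x => L2.compress_sub _ _ _ _)

theorem averageOp_add (G G' : C((D.prod E).X, BL2 ((D.prod E).ι → ℤ))) (z : E.X) :
    averageOp μ (G + G') z = averageOp μ G z + averageOp μ G' z := by
  rw [averageOp, averageOp, averageOp,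
    ← integral_add (integrable_averageOp μ G z) (integrable_averageOp μ G' z)]
  exact congrArg (fun h => ∫ x, h x ∂μ) (funext fun x => L2.compress_add _ _ _ _)

theorem averageOp_smul (c : ℂ) (G : C((D.prod E).X, BL2 ((D.prod E).ι → ℤ))) (z : E.X) :
    averageOp μ (c • G) z = c • averageOp μ G z := by
  rw [averageOp, averageOp, ← integral_smul]
  exact congrArg (fun h => ∫ x, h x ∂μ) (funext fun x => L2.compress_smul _ _ _ _)

theorem norm_averageOp_le (G : C((D.prod E).X, BL2 ((D.prod E).ι → ℤ))) (z : E.X) :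
    ‖averageOp μ G z‖ ≤ ‖G‖ := by
  have := norm_integral_le_of_norm_le_const (μ := μ) (C := ‖G‖)
    (f := fun x => L2.compress (splitR D.ι E.ι) 0 (G (x, z))) (Eventually.of_forall fun x =>
      (L2.norm_compress_le _ _ _).trans (G.norm_coe_le_norm _))
  simpa [averageOp] using this

theorem averageOp_inr (a : E.CAlg) (z : E.X) :
    averageOp μ ((D.prod E).incl (inr D E a)) z = E.incl a z := by
  have : ∀ x, L2.compress (splitR D.ι E.ι) 0 ((D.prod E).incl (inr D E a) (x, z)) =
      E.incl a z := fun x => L2.compress_amp _ _ _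
  simp only [averageOp, this]
  simp

variable {μ}

/-- In degree (r, s) with r ≠ 0 the compression kills the Weyl operator while `hμ` kills the
integral of the function; with r = 0 both survive unchanged in degree s. So operator averaging and
function averaging agree under quantization. -/
theorem exists_average_of_mem_quantOn
    (hμ : ∀ r f, D.IsIsotypic r f → r ≠ 0 → ∫ x, f x ∂μ = 0)
    {p : C((D.prod E).X, BL2 ((D.prod E).ι → ℤ)) × C((D.prod E).X, ℂ)}
    (hp : p ∈ (D.prod E).quantOn Set.univ) :
    ∃ B, (B, average μ p.2) ∈ E.quantOn Set.univ ∧ ∀ z, B z = averageOp μ p.1 z := by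
  classical
  induction hp using Submodule.span_induction with
  | mem p hp =>
    obtain ⟨m, -, F, hF, rfl⟩ := hp
    obtain ⟨r, s, rfl⟩ : ∃ r s, m = join r s := ⟨fun i => m (Sum.inl i), fun i => m (Sum.inr i), by
      funext i
      rcases i with i | i <;> rfl⟩
    have h0 : ∀ z, averageOp μ ((D.prod E).symbol (join r s) F) z =
        average μ F z • (if r = 0 then weyl E.θ s else 0) := fun z => by
      have : ∀ x, L2.compress (splitR D.ι E.ι) 0 ((D.prod E).symbol (join r s) F (x, z)) =
          F (x, z) • (if r = 0 then weyl E.θ s else 0) := fun x => by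
        refine (L2.compress_smul _ _ (F (x, z)) (weyl (D.prod E).θ (join r s))).trans ?_
        exact congrArg (F (x, z) • ·) (compress_weyl r s)
      simp only [averageOp, this]
      rw [integral_smul_const, average_apply]
    by_cases hr : r = 0
    · have hs : E.IsIsotypic s (average μ F) := isIsotypic_iff.2 fun t z => by
        rw [average_apply, average_apply, ← integral_const_mul]
        congr 1
        funext x
        exact hF.apply_act_right t x z
      refine ⟨E.symbol s (average μ F), symbol_mem_quantOn (Set.mem_univ _) hs, fun z => ?_⟩
      rw [h0, if_pos hr, symbol_apply]
    · have hz : average μ F = 0 := by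
        ext1 z
        rw [average_apply]
        refine hμ r ⟨fun x => F (x, z), F.continuous.comp
          (by fun_prop : Continuous fun x : D.X => (x, z))⟩ (isIsotypic_iff.2 fun t x => ?_) hr
        exact hF.apply_act_left t x z
      refine ⟨0, ?_, fun z => ?_⟩
      · rw [hz]
        exact zero_mem _
      · rw [h0, if_neg hr, smul_zero]
        rfl
  | zero =>
    have h1 : average μ (0 : C((D.prod E).X, ℂ)) = 0 := by
      simpa using average_smul μ 0 (0 : C((D.prod E).X, ℂ))
    refine ⟨0, ?_, fun z => ?_⟩
    · rw [Prod.snd_zero, h1]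
      exact zero_mem _
    · have := averageOp_smul μ 0 (0 : C((D.prod E).X, BL2 ((D.prod E).ι → ℤ))) z
      rw [zero_smul, zero_smul] at this
      exact this.symm
  | add p q _ _ hp hq =>
    obtain ⟨B, hB, h⟩ := hp
    obtain ⟨C, hC, h'⟩ := hq
    refine ⟨B + C, ?_, fun z => ?_⟩
    · rw [Prod.snd_add, average_add]
      exact add_mem hB hC
    · rw [Prod.fst_add, averageOp_add, ← h, ← h']
      rfl
  | smul a p _ hp =>
    obtain ⟨B, hB, h⟩ := hp
    refine ⟨a • B, ?_, fun z => ?_⟩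
    · rw [Prod.smul_snd, average_smul]
      exact Submodule.smul_mem _ a hB
    · rw [Prod.smul_fst, averageOp_smul, ← h]
      rfl

/-- An element whose image is the average of `G` is as close to `a` as `G` is to `1 ⊗ a`. -/
theorem norm_sub_le_of_average {G : (D.prod E).CAlg} {b : E.CAlg}
    (hb : ∀ z, E.incl b z = averageOp μ ((D.prod E).incl G) z) (a : E.CAlg) :
    ‖b - a‖ ≤ ‖G - inr D E a‖ := by
  rw [← norm_incl, ← norm_incl]
  refine (ContinuousMap.norm_le _ (norm_nonneg _)).2 fun z => ?_
  rw [map_sub, ContinuousMap.sub_apply, hb, ← averageOp_inr (D := D) μ a z, ← averageOp_sub,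
    ← map_sub]
  exact norm_averageOp_le μ _ z

end Average

/-! ## Polynomials in the coordinates -/

theorem mk_add_mem_quantOn {D : ToricDatum} {S : Set (D.ι → ℤ)} {F G : C(D.X, BL2 (D.ι → ℤ))}
    {f g : C(D.X, ℂ)} (hF : (F, f) ∈ D.quantOn S) (hG : (G, g) ∈ D.quantOn S) :
    (F + G, f + g) ∈ D.quantOn S := add_mem hF hG

theorem mk_smul_mem_quantOn {D : ToricDatum} {S : Set (D.ι → ℤ)} {F : C(D.X, BL2 (D.ι → ℤ))}
    {f : C(D.X, ℂ)} (c : ℂ) (hF : (F, f) ∈ D.quantOn S) : (c • F, c • f) ∈ D.quantOn S :=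
  Submodule.smul_mem _ c hF

namespace Coordinates.Pullback

variable {D E : ToricDatum} {J K : Type} [Fintype K] {c : D.Coordinates J} (P : c.Pullback E K)

/-- The quantizations of the polynomial isotypic functions with a quantized pullback. -/
def polySet : Set D.CAlg :=
  {a | ∃ r f, ∃ h : P.toQMap.Liftable r f,
    f ∈ StarAlgebra.adjoin ℂ (Set.range c.fn) ∧ a = D.elt r f h.1}

theorem star_mem_span_polySet {a : D.CAlg} (ha : a ∈ Submodule.span ℂ P.polySet) :
    star a ∈ Submodule.span ℂ P.polySet := by
  induction ha using Submodule.span_induction with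
  | mem a ha =>
    obtain ⟨r, f, hf, hf', rfl⟩ := ha
    exact Submodule.subset_span ⟨-r, _, hf.star, star_mem hf', star_elt hf.1⟩
  | zero => rw [star_zero]; exact zero_mem _
  | add a b _ _ ha hb => rw [star_add]; exact add_mem ha hb
  | smul r a _ ha => rw [star_smul]; exact Submodule.smul_mem _ _ ha

/-- The deformed product of two isotypic polynomials is a scalar times their pointwise product, so
deformed polynomials quantize ordinary ones. -/
theorem mem_span_polySet {a : D.CAlg} (ha : a ∈ StarAlgebra.adjoin ℂ (Set.range c.gen)) :
    a ∈ Submodule.span ℂ P.polySet := by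
  have h1 : (1 : D.CAlg) ∈ P.polySet :=
    ⟨0, 1, QMap.Liftable.one, one_mem _, (QMap.elt_one D).symm⟩
  induction ha using StarAlgebra.adjoin_induction with
  | mem a ha =>
    obtain ⟨j, rfl⟩ := ha
    exact Submodule.subset_span ⟨_, _, P.liftable j, StarAlgebra.subset_adjoin ℂ _ ⟨j, rfl⟩, rfl⟩
  | algebraMap r =>
    rw [Algebra.algebraMap_eq_smul_one]
    exact Submodule.smul_mem _ _ (Submodule.subset_span h1)
  | add a b _ _ ha hb => exact add_mem ha hb
  | mul a b _ _ ha hb =>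
    have := Submodule.mul_mem_mul ha hb
    rw [Submodule.span_mul_span] at this
    refine Submodule.span_mono ?_ this
    rintro _ ⟨_, ⟨r, f, hf, hf', rfl⟩, _, ⟨s, g, hg, hg', rfl⟩, rfl⟩
    refine ⟨r + s, _, (hf.mul hg).smul (bichar D.θ r s),
      (StarAlgebra.adjoin ℂ (Set.range c.fn)).smul_mem (mul_mem hf' hg') _, ?_⟩
    exact (elt_mul hf.1 hg.1).trans (elt_smul _ _).symm
  | star a _ ha => exact P.star_mem_span_polySet ha

/-- A polynomial in the coordinates is the quantization of a polynomial function, and its image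
under the homomorphism that of the pullback. -/
theorem exists_polynomial {a : D.CAlg} (ha : a ∈ StarAlgebra.adjoin ℂ (Set.range c.gen)) :
    ∃ f ∈ StarAlgebra.adjoin ℂ (Set.range c.fn), (D.incl a, f) ∈ D.quantOn Set.univ ∧
      (E.incl (P.toQMap.hom a), f.comp P.map) ∈ E.quantOn Set.univ := by
  have := P.mem_span_polySet ha
  clear ha
  induction this using Submodule.span_induction with
  | mem a ha =>
    obtain ⟨r, f, hf, hf', rfl⟩ := ha
    exact ⟨f, hf', symbol_mem_quantOn (Set.mem_univ _) hf.1,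
      quantOn_mono (Set.subset_univ _) (P.toQMap.incl_hom_elt hf)⟩
  | zero =>
    refine ⟨0, zero_mem _, ?_, ?_⟩
    · rw [map_zero]
      exact zero_mem _
    · rw [map_zero, map_zero, ContinuousMap.zero_comp]
      exact zero_mem _
  | add a b _ _ ha hb =>
    obtain ⟨f, hf, h1, h2⟩ := ha
    obtain ⟨g, hg, h3, h4⟩ := hb
    have e : E.incl (P.toQMap.hom (a + b)) =
        E.incl (P.toQMap.hom a) + E.incl (P.toQMap.hom b) := by rw [map_add, map_add]
    refine ⟨f + g, add_mem hf hg, ?_, ?_⟩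
    · rw [map_add]
      exact mk_add_mem_quantOn h1 h3
    · rw [e, ContinuousMap.add_comp]
      exact mk_add_mem_quantOn h2 h4
  | smul r a _ ha =>
    obtain ⟨f, hf, h1, h2⟩ := ha
    have e : E.incl (P.toQMap.hom (r • a)) = r • E.incl (P.toQMap.hom a) := by
      rw [map_smul, map_smul]
    refine ⟨r • f, (StarAlgebra.adjoin ℂ (Set.range c.fn)).smul_mem hf r, ?_, ?_⟩
    · rw [map_smul]
      exact mk_smul_mem_quantOn r h1
    · rw [e, ContinuousMap.smul_comp]
      exact mk_smul_mem_quantOn r h2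

end Coordinates.Pullback

end ToricDatum

/-! ### Haar measure on SU(3) -/

instance SU3.instMeasurableSpace : MeasurableSpace SU3 := borel SU3

instance SU3.instBorelSpace : BorelSpace SU3 := ⟨rfl⟩

instance qSU3.instMeasurableSpace (θ : ℝ) : MeasurableSpace (qSU3 θ).X := SU3.instMeasurableSpace

instance qSU3.instBorelSpace (θ : ℝ) : BorelSpace (qSU3 θ).X := SU3.instBorelSpace

/-- The Haar measure of `SU(3)`. -/
def haarSU3 (θ : ℝ) : Measure (qSU3 θ).X := haarProb SU3

instance haarSU3.isProbabilityMeasure (θ : ℝ) : IsProbabilityMeasure (haarSU3 θ) :=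
  haarProb.isProbabilityMeasure SU3

/-- The torus acts by left and right translations, both of which preserve Haar measure. This is the
condition that averaging needs. -/
theorem integral_haarSU3_eq_zero (θ : ℝ) (r : (qSU3 θ).ι → ℤ) (f : C((qSU3 θ).X, ℂ))
    (hf : (qSU3 θ).IsIsotypic r f) (hr : r ≠ 0) : ∫ x, f x ∂haarSU3 θ = 0 := by
  obtain ⟨t, ht⟩ := exists_torusChar_ne_one hr
  exact integral_haarProb_eq_zero (G := SU3) f _ _ _ ht fun x => isIsotypic_iff.1 hf t x

/-! ## Invariants and coinvariants -/

theorem range_coordS5S5_fn (θ' : Matrix (Fin 6) (Fin 6) ℝ) (hθ' : θ'ᵀ = -θ') :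
    Set.range (coordS5S5 θ' hθ').fn = Set.range zFun := by
  refine Set.Subset.antisymm ?_ ?_
  · rintro _ ⟨p, rfl⟩
    exact ⟨zIdx p.1 p.2, rfl⟩
  · rintro _ ⟨i, rfl⟩
    exact zIdx_cases (P := fun i => zFun i ∈ Set.range (coordS5S5 θ' hθ').fn)
      (fun a k => ⟨(a, k), rfl⟩) i

theorem range_coordS5S5_gen (θ' : Matrix (Fin 6) (Fin 6) ℝ) (hθ' : θ'ᵀ = -θ') :
    Set.range (coordS5S5 θ' hθ').gen = Set.range (zGen θ' hθ') := by
  refine Set.Subset.antisymm ?_ ?_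
  · rintro _ ⟨p, rfl⟩
    exact ⟨zIdx p.1 p.2, rfl⟩
  · rintro _ ⟨i, rfl⟩
    exact zIdx_cases (P := fun i => zGen θ' hθ' i ∈ Set.range (coordS5S5 θ' hθ').gen)
      (fun a k => ⟨(a, k), rfl⟩) i

theorem adjoin_one_self_star {A : Type*} [CStarAlgebra A] (w : A) :
    (StarAlgebra.adjoin ℂ {w}).toSubalgebra = Algebra.adjoin ℂ {1, w, star w} := by
  rw [StarAlgebra.adjoin_toSubalgebra]
  refine le_antisymm (Algebra.adjoin_mono ?_) (Algebra.adjoin_le ?_)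
  · rintro x (rfl | hx)
    · simp
    · have : x = star w := by
        rw [Set.mem_star, Set.mem_singleton_iff] at hx
        rw [← hx, star_star]
      simp [this]
  · rintro x (rfl | rfl | rfl)
    · exact one_mem _
    · exact Algebra.subset_adjoin (Or.inl rfl)
    · exact Algebra.subset_adjoin (Or.inr (by simp))

theorem adjoin_one_smul_star {A : Type*} [CStarAlgebra A] (w : A) {c : ℂ} (hc : c ≠ 0) :
    Algebra.adjoin ℂ {1, c • star w, w} = Algebra.adjoin ℂ {1, w, star w} := by
  refine le_antisymm (Algebra.adjoin_le ?_) (Algebra.adjoin_le ?_)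
  · rintro x (rfl | rfl | rfl)
    · exact one_mem _
    · exact Subalgebra.smul_mem _ (Algebra.subset_adjoin (by simp)) c
    · exact Algebra.subset_adjoin (by simp)
  · rintro x (rfl | rfl | rfl)
    · exact one_mem _
    · exact Algebra.subset_adjoin (by simp)
    · have hm : c • star w ∈ Algebra.adjoin ℂ {1, c • star w, w} :=
        Algebra.subset_adjoin (by simp)
      have := Subalgebra.smul_mem _ hm c⁻¹
      rwa [smul_smul, inv_mul_cancel₀ hc, one_smul] at this

theorem commute_of_mem_closure_adjoin {A : Type*} [CStarAlgebra A] {w : A}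
    (hw : w * star w = star w * w) {a b : A}
    (ha : a ∈ closure (Algebra.adjoin ℂ {1, w, star w} : Set A))
    (hb : b ∈ closure (Algebra.adjoin ℂ {1, w, star w} : Set A)) : a * b = b * a := by
  have h : ∀ x ∈ ({1, w, star w} : Set A), ∀ y ∈ ({1, w, star w} : Set A), x * y = y * x := by
    rintro x (rfl | rfl | rfl) y (rfl | rfl | rfl) <;> simp [hw]
  have h1 : ∀ x ∈ Algebra.adjoin ℂ {1, w, star w}, ∀ y ∈ Algebra.adjoin ℂ {1, w, star w},
      x * y = y * x := fun x hx y hy =>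
    congrArg Subtype.val ((Algebra.isMulCommutative_adjoin ℂ h).is_comm.comm ⟨x, hx⟩ ⟨y, hy⟩)
  refine closure_minimal (s := (Algebra.adjoin ℂ {1, w, star w} : Set A))
    (t := {x | x * b = b * x}) (fun x hx => ?_)
    (isClosed_eq (by fun_prop) (by fun_prop)) ha
  refine closure_minimal (s := (Algebra.adjoin ℂ {1, w, star w} : Set A))
    (t := {y | x * y = y * x}) (fun y hy => h1 x hx y hy)
    (isClosed_eq (by fun_prop) (by fun_prop)) hb

theorem isClosed_equalizer {A B : Type*} [CStarAlgebra A] [CStarAlgebra B] (φ ψ : A →⋆ₐ[ℂ] B) :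
    IsClosed {a | φ a = ψ a} :=
  isClosed_eq (continuous_starAlgHom φ) (continuous_starAlgHom ψ)

/-- If a dense set of elements can be moved into `B` by at most the defect of coinvariance, the
closure of `B` contains all coinvariant elements. -/
theorem mem_closure_of_forall_exists_norm_sub_le {A C : Type*} [CStarAlgebra A] [CStarAlgebra C]
    {φ ψ : A →⋆ₐ[ℂ] C} {S B : Set A} (hS : closure S = Set.univ)
    (h : ∀ p ∈ S, ∃ b ∈ B, ∀ a, ‖b - a‖ ≤ ‖φ p - ψ a‖) {a : A} (ha : φ a = ψ a) :
    a ∈ closure B := by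
  rw [Metric.mem_closure_iff]
  intro ε hε
  have haS : a ∈ closure S := hS ▸ Set.mem_univ a
  obtain ⟨p, hp, hap⟩ := Metric.mem_closure_iff.1 haS ε hε
  obtain ⟨b, hb, hba⟩ := h p hp
  refine ⟨b, hb, ?_⟩
  rw [dist_comm, dist_eq_norm]
  refine (hba a).trans_lt ?_
  -- Coinvariance turns φ p - ψ a into φ (p - a), of norm at most ‖p - a‖.
  rw [← ha, ← map_sub]
  refine (norm_starAlgHom_apply_le φ _).trans_lt ?_
  rwa [← dist_eq_norm, dist_comm]

section Coinvariants

variable {θ lam : ℝ} {θ' : Matrix (Fin 6) (Fin 6) ℝ} (hθ' : θ'ᵀ = -θ')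
  (hc : IsCompatible θ lam θ')

/-- The action is linear in the coordinates, so it separates polynomials into functions of g times
polynomials in z. Integrating out g therefore leaves a polynomial. -/
theorem comp_act_mem_span_outer {f : C(S5S5, ℂ)} (hf : f ∈ polyFun) :
    f.comp (actPullback hθ' hc).map ∈ Submodule.span ℂ {F | ∃ h : C((qSU3 θ).X, ℂ),
      ∃ b ∈ polyFun, F = outer (D := qSU3 θ) (E := qS5S5 θ' hθ') h b} := by
  induction hf using StarAlgebra.adjoin_induction with
  | mem f hf =>
    rw [← range_coordS5S5_fn θ' hθ'] at hf
    obtain ⟨p, rfl⟩ := hf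
    refine Eq.mpr (congrArg (· ∈ _) ((actPullback hθ' hc).comp_map p)) ?_
    refine Submodule.sum_mem _ fun k _ => Submodule.subset_span ⟨_, _, ?_, rfl⟩
    exact StarAlgebra.subset_adjoin ℂ _ ⟨zIdx p.1 k, rfl⟩
  | algebraMap r =>
    refine Submodule.subset_span ⟨1, algebraMap ℂ _ r, algebraMap_mem _ r, ?_⟩
    ext1 x
    exact (one_mul _).symm
  | add f g _ _ hf hg => exact add_mem hf hg
  | mul f g _ _ hf hg =>
    have := Submodule.mul_mem_mul hf hg
    rw [Submodule.span_mul_span] at this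
    refine Submodule.span_mono ?_ this
    rintro _ ⟨_, ⟨h, b, hb, rfl⟩, _, ⟨h', b', hb', rfl⟩, rfl⟩
    exact ⟨h * h', b * b', mul_mem hb hb', outer_mul _ _ _ _⟩
  | star f _ hf =>
    change star (f.comp (actPullback hθ' hc).map) ∈ _
    generalize f.comp (actPullback hθ' hc).map = F at hf
    induction hf using Submodule.span_induction with
    | mem F hF =>
      obtain ⟨h, b, hb, rfl⟩ := hF
      exact Submodule.subset_span ⟨star h, star b, star_mem hb, outer_star _ _⟩
    | zero => rw [star_zero]; exact zero_mem _
    | add F G _ _ hF hG => rw [star_add]; exact add_mem hF hG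
    | smul c F _ hF => rw [star_smul]; exact Submodule.smul_mem _ _ hF

/-- The average of a function over the orbits of `SU(3)`. -/
def orbitAverage (f : C(S5S5, ℂ)) : C(S5S5, ℂ) :=
  average (D := qSU3 θ) (E := qS5S5 θ' hθ') (haarSU3 θ) (f.comp (actPullback hθ' hc).map)

theorem orbitAverage_mem_polyFun {f : C(S5S5, ℂ)} (hf : f ∈ polyFun) :
    orbitAverage hθ' hc f ∈ polyFun := by
  have := comp_act_mem_span_outer hθ' hc hf
  rw [orbitAverage]
  generalize f.comp (actPullback hθ' hc).map = F at this
  induction this using Submodule.span_induction with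
  | mem F hF =>
    obtain ⟨h, b, hb, rfl⟩ := hF
    exact Eq.mpr (congrArg (· ∈ polyFun) (average_outer (D := qSU3 θ) (E := qS5S5 θ' hθ')
      (haarSU3 θ) h b)) (polyFun.smul_mem hb _)
  | zero =>
    have := average_smul (D := qSU3 θ) (E := qS5S5 θ' hθ') (haarSU3 θ) 0 0
    rw [zero_smul, zero_smul] at this
    rw [this]
    exact zero_mem _
  | add F G _ _ hF hG => rw [average_add]; exact add_mem hF hG
  | smul c F _ hF => rw [average_smul]; exact polyFun.smul_mem hF c

theorem S5S5.smul_smul (g h : SU3) (z : S5S5) :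
    S5S5.smul g (S5S5.smul h z) = S5S5.smul (g * h) z := by
  refine Subtype.ext (funext (zIdx_cases fun a s => ?_))
  have e : ∀ (g : SU3) (z : S5S5) k, (S5S5.smul g z).1 (zIdx a k) =
      (g.1 *ᵥ fun k => z.1 (zIdx a k)) k := fun g z k => diagAct_zIdx g z.1 a k
  rw [e, e]
  simp only [e]
  rw [Submonoid.coe_mul, ← Matrix.mulVec_mulVec]

theorem orbitAverage_smul (f : C(S5S5, ℂ)) (g : SU3) (z : S5S5) :
    orbitAverage hθ' hc f (S5S5.smul g z) = orbitAverage hθ' hc f z := by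
  have h : ∀ z, orbitAverage hθ' hc f z = ∫ x, f (S5S5.smul x z) ∂haarProb SU3 := fun z =>
    average_apply _ _ _
  rw [h, h]
  simp only [S5S5.smul_smul]
  exact integral_mul_right_eq_self (fun x => f (S5S5.smul x z)) g

/-- The degree of `z_k conj(z_{k+3})`. -/
def wDeg (k : Fin 3) : (qS5S5 θ' hθ').ι → ℤ :=
  (coordS5S5 θ' hθ').deg (0, k) + -(coordS5S5 θ' hθ').deg (1, k)

/-- The degrees of the functions of `w`. -/
def wLattice : AddSubgroup ((qS5S5 θ' hθ').ι → ℤ) :=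
  AddSubgroup.closure (Set.range (wDeg hθ'))

/-- The phase relating the orders of the factors of `z_k^* z_{k+3}`. -/
def wPhase (lam : ℝ) : ℂ := Complex.exp (Real.pi * Complex.I * (lam : ℂ))

theorem wPhase_ne_zero (lam : ℝ) : wPhase lam ≠ 0 := Complex.exp_ne_zero _

theorem wtChar_self (θ : ℝ) (k : Fin 3) : wtChar θ k k = 1 := by
  rw [wtChar_eq]
  have : wtForm θ k k = 0 := by fin_cases k <;> simp [wtForm]
  rw [this]
  simp

include hc in
theorem bichar_coord_zero_one (k l : Fin 3) :
    bichar (qS5S5 θ' hθ').θ ((coordS5S5 θ' hθ').deg (0, k)) ((coordS5S5 θ' hθ').deg (1, l)) =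
      wtChar θ k l * wPhase lam := by
  rw [hc.bichar_coordS5S5]
  simp [wPhase]

include hc in
theorem bichar_coord_one_zero (k l : Fin 3) :
    bichar (qS5S5 θ' hθ').θ ((coordS5S5 θ' hθ').deg (1, k)) ((coordS5S5 θ' hθ').deg (0, l)) =
      wtChar θ k l * (wPhase lam)⁻¹ := by
  rw [hc.bichar_coordS5S5, wPhase, ← Complex.exp_neg]
  simp

include hc in
theorem bichar_coord_self (a : Fin 2) (k l : Fin 3) :
    bichar (qS5S5 θ' hθ').θ ((coordS5S5 θ' hθ').deg (a, k)) ((coordS5S5 θ' hθ').deg (a, l)) =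
      wtChar θ k l := by
  rw [hc.bichar_coordS5S5]
  fin_cases a <;> simp

include hc in
-- In a degree of the form e_k - e_{k+3} the weight contributions cancel in pairs, as do the phases
-- of the two mixed terms. This triviality is what makes the coinvariants commutative.
theorem bichar_wDeg (k l : Fin 3) :
    bichar (qS5S5 θ' hθ').θ (wDeg hθ' k) (wDeg hθ' l) = 1 := by
  have h1 := wtChar_ne_zero θ k l
  have h2 := wPhase_ne_zero lam
  simp only [wDeg, bichar_add_left, bichar_add_right, bichar_neg_left, bichar_neg_right,
    bichar_coord_self hθ' hc, bichar_coord_zero_one hθ' hc, bichar_coord_one_zero hθ' hc]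
  field_simp

include hc in
theorem bichar_wLattice (r) (hr : r ∈ wLattice hθ') (s) (hs : s ∈ wLattice hθ') :
    bichar (qS5S5 θ' hθ').θ r s = 1 :=
  eq_one_of_mem_closure (bichar_zero_left _) (bichar_zero_right _)
    (fun _ _ _ => bichar_add_left _ _ _ _) (fun _ _ _ => bichar_add_right _ _ _ _)
    (fun _ _ => bichar_neg_left _ _ _) (fun _ _ => bichar_neg_right _ _ _)
    (by
      rintro _ ⟨k, rfl⟩ _ ⟨l, rfl⟩
      exact bichar_wDeg hθ' hc k l) hr hs

include hc in
theorem quantOn_wLattice_mul {F G : C((qS5S5 θ' hθ').X, BL2 ((qS5S5 θ' hθ').ι → ℤ))}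
    {f g : C((qS5S5 θ' hθ').X, ℂ)} (hF : (F, f) ∈ (qS5S5 θ' hθ').quantOn (wLattice hθ'))
    (hG : (G, g) ∈ (qS5S5 θ' hθ').quantOn (wLattice hθ')) :
    (F * G, f * g) ∈ (qS5S5 θ' hθ').quantOn (wLattice hθ') := by
  have := quantOn_mul (S'' := wLattice hθ') (bichar_wLattice hθ' hc)
    (fun _ h _ h' => (wLattice hθ').add_mem h h') hF hG
  rw [one_smul] at this
  exact this

theorem quantOn_wLattice_star {F : C((qS5S5 θ' hθ').X, BL2 ((qS5S5 θ' hθ').ι → ℤ))}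
    {f : C((qS5S5 θ' hθ').X, ℂ)} (hF : (F, f) ∈ (qS5S5 θ' hθ').quantOn (wLattice hθ')) :
    (star F, star f) ∈ (qS5S5 θ' hθ').quantOn (wLattice hθ') := by
  have := quantOn_star (S' := wLattice hθ') (fun r hr => (wLattice hθ').neg_mem hr) hF
  rw [Prod.star_def] at this
  exact this

/-- The function `w` on the space underlying the deformation. -/
def wClass : C((qS5S5 θ' hθ').X, ℂ) := wFun

theorem zGen_mul_star_zGen (k : Fin 3) :
    zGen θ' hθ' (zIdx 0 k) * star (zGen θ' hθ' (zIdx 1 k)) =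
      bichar (qS5S5 θ' hθ').θ ((coordS5S5 θ' hθ').deg (0, k)) (-(coordS5S5 θ' hθ').deg (1, k)) •
        (qS5S5 θ' hθ').elt (wDeg hθ' k) ((coordS5S5 θ' hθ').fn (0, k) *
          star ((coordS5S5 θ' hθ').fn (1, k)))
          (((coordS5S5 θ' hθ').isotypic (0, k)).mul ((coordS5S5 θ' hθ').isotypic (1, k)).star) := by
  rw [← coordS5S5_gen, ← coordS5S5_gen, Coordinates.gen, Coordinates.gen, star_elt, elt_mul]
  rfl

include hc in
-- The ordering phase of z_k z_{k+3}^* is the same for all k, since a weight pairs trivially with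
-- itself, so it factors out of the sum.
theorem wElt_mem_quantOn : ((qS5S5 θ' hθ').incl (wElt θ' hθ'), (wPhase lam)⁻¹ • wClass hθ') ∈
    (qS5S5 θ' hθ').quantOn (wLattice hθ') := by
  have h : ∀ k, ((qS5S5 θ' hθ').incl (zGen θ' hθ' (zIdx 0 k) * star (zGen θ' hθ' (zIdx 1 k))),
      (wPhase lam)⁻¹ • ((coordS5S5 θ' hθ').fn (0, k) * star ((coordS5S5 θ' hθ').fn (1, k)))) ∈
      (qS5S5 θ' hθ').quantOn (wLattice hθ') := fun k => by
    rw [zGen_mul_star_zGen, map_smul, bichar_neg_right, bichar_coord_zero_one hθ' hc,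
      wtChar_self, one_mul]
    refine mk_smul_mem_quantOn _ (symbol_mem_quantOn ?_
      (((coordS5S5 θ' hθ').isotypic (0, k)).mul ((coordS5S5 θ' hθ').isotypic (1, k)).star))
    exact AddSubgroup.subset_closure ⟨k, rfl⟩
  have := Submodule.sum_mem _ fun k (_ : k ∈ Finset.univ) => h k
  refine Eq.mp (congrArg (· ∈ _) (Prod.ext ?_ ?_)) this
  · rw [Prod.fst_sum, ← map_sum]
    rfl
  · rw [Prod.snd_sum, ← Finset.smul_sum]
    rfl

include hc in
-- Exchanging z_k^* and z_{k+3} costs the factor exp(-2πiλ), independent of k.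
theorem wElt'_eq : wElt' θ' hθ' = ((wPhase lam)⁻¹ * (wPhase lam)⁻¹) • star (wElt θ' hθ') := by
  have h : ∀ k, star (zGen θ' hθ' (zIdx 0 k)) * zGen θ' hθ' (zIdx 1 k) =
      ((wPhase lam)⁻¹ * (wPhase lam)⁻¹) •
        star (zGen θ' hθ' (zIdx 0 k) * star (zGen θ' hθ' (zIdx 1 k))) := fun k => by
    rw [star_mul, star_star, ← coordS5S5_gen, ← coordS5S5_gen, Coordinates.gen, Coordinates.gen,
      star_elt, elt_mul, elt_mul, smul_smul, bichar_neg_left, bichar_neg_right,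
      bichar_coord_zero_one hθ' hc, bichar_coord_one_zero hθ' hc, wtChar_self]
    have h2 := wPhase_ne_zero lam
    congr 1
    · field_simp
    · exact elt_congr _ _ (add_comm _ _) (mul_comm _ _)
  have e1 : wElt' θ' hθ' = ∑ k, star (zGen θ' hθ' (zIdx 0 k)) * zGen θ' hθ' (zIdx 1 k) := rfl
  have e2 : wElt θ' hθ' = ∑ k, zGen θ' hθ' (zIdx 0 k) * star (zGen θ' hθ' (zIdx 1 k)) := rfl
  rw [e1, e2, star_sum, Finset.smul_sum]
  exact Finset.sum_congr rfl fun k _ => h k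

include hc in
theorem wClass_mem_quantOn :
    ((qS5S5 θ' hθ').incl (wPhase lam • wElt θ' hθ'), wClass hθ') ∈
    (qS5S5 θ' hθ').quantOn (wLattice hθ') := by
  have := mk_smul_mem_quantOn (wPhase lam) (wElt_mem_quantOn hθ' hc)
  rw [smul_smul, mul_inv_cancel₀ (wPhase_ne_zero lam), one_smul] at this
  rw [map_smul]
  exact this

include hc in
-- Quantization is multiplicative on the lattice of degrees of w, so the same polynomial is
-- evaluated at the rescaled deformed w.
theorem exists_quantization {f : C(S5S5, ℂ)} (hf : f ∈ StarAlgebra.adjoin ℂ {wFun}) :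
    ∃ b ∈ StarAlgebra.adjoin ℂ {wElt θ' hθ'}, ((qS5S5 θ' hθ').incl b, f) ∈
      (qS5S5 θ' hθ').quantOn (wLattice hθ') := by
  induction hf using StarAlgebra.adjoin_induction with
  | mem f hf =>
    obtain rfl := Set.mem_singleton_iff.1 hf
    exact ⟨_, (StarAlgebra.adjoin ℂ {wElt θ' hθ'}).smul_mem
      (StarAlgebra.subset_adjoin ℂ _ rfl) _, wClass_mem_quantOn hθ' hc⟩
  | algebraMap r =>
    refine ⟨algebraMap ℂ _ r, algebraMap_mem _ r, ?_⟩
    rw [Algebra.algebraMap_eq_smul_one, Algebra.algebraMap_eq_smul_one, map_smul, map_one]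
    exact mk_smul_mem_quantOn r (one_mem_quantOn (wLattice hθ').zero_mem)
  | add f g _ _ hf hg =>
    obtain ⟨a, ha, h⟩ := hf
    obtain ⟨b, hb, h'⟩ := hg
    refine ⟨a + b, add_mem ha hb, ?_⟩
    rw [map_add]
    exact mk_add_mem_quantOn h h'
  | mul f g _ _ hf hg =>
    obtain ⟨a, ha, h⟩ := hf
    obtain ⟨b, hb, h'⟩ := hg
    refine ⟨a * b, mul_mem ha hb, ?_⟩
    rw [map_mul]
    exact quantOn_wLattice_mul hθ' hc h h'
  | star f _ hf =>
    obtain ⟨a, ha, h⟩ := hf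
    refine ⟨star a, star_mem ha, ?_⟩
    rw [map_star]
    exact quantOn_wLattice_star hθ' h

include hc in
-- Both products quantize the same function, because the bicharacter is trivial on the degrees
-- involved.
theorem commute_wElt_star : wElt θ' hθ' * star (wElt θ' hθ') = star (wElt θ' hθ') * wElt θ' hθ' := by
  have h := wElt_mem_quantOn hθ' hc
  have h' := quantOn_wLattice_star hθ' h
  have h1 := quantOn_wLattice_mul hθ' hc h h'
  have h2 := quantOn_wLattice_mul hθ' hc h' h
  rw [mul_comm (star _ : C((qS5S5 θ' hθ').X, ℂ))] at h2
  have := quantOn_fst_unique h1 h2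
  apply (qS5S5 θ' hθ').incl_injective
  rw [map_mul, map_mul, map_star]
  exact this

theorem wElt_mem_polyS5S5 : wElt θ' hθ' ∈ polyS5S5 θ' hθ' :=
  sum_mem fun _ _ => mul_mem (StarAlgebra.subset_adjoin ℂ _ ⟨_, rfl⟩)
    (star_mem (StarAlgebra.subset_adjoin ℂ _ ⟨_, rfl⟩))

theorem exists_polynomial_coact {a : (qS5S5 θ' hθ').CAlg} (ha : a ∈ polyS5S5 θ' hθ') :
    ∃ f ∈ polyFun, ((qS5S5 θ' hθ').incl a, f) ∈ (qS5S5 θ' hθ').quantOn Set.univ ∧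
      (((qSU3 θ).prod (qS5S5 θ' hθ')).incl (coact hθ' hc a), f.comp (actPullback hθ' hc).map) ∈
        ((qSU3 θ).prod (qS5S5 θ' hθ')).quantOn Set.univ := by
  rw [polyS5S5, ← range_coordS5S5_gen] at ha
  obtain ⟨f, hf, h⟩ := (actPullback hθ' hc).exists_polynomial ha
  rw [range_coordS5S5_fn] at hf
  exact ⟨f, hf, h⟩

/-- By the classical invariance of w, both sides quantize the same function on SU(3) × (S⁵ × S⁵), so
uniqueness of quantizations applies. -/
theorem coact_wElt : coact hθ' hc (wElt θ' hθ') = inr (qSU3 θ) (qS5S5 θ' hθ') (wElt θ' hθ') := by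
  obtain ⟨f, hf, h1, h2⟩ := exists_polynomial_coact hθ' hc (wElt_mem_polyS5S5 hθ')
  have h3 := quantOn_mono (Set.subset_univ _) (wElt_mem_quantOn hθ' hc)
  obtain rfl := quantOn_snd_unique h1 h3
  have h4 := quantOn_inr (D := qSU3 θ) (T := Set.univ) (fun _ _ => Set.mem_univ _) h3
  have e : ((wPhase lam)⁻¹ • wClass hθ').comp (actPullback hθ' hc).map =
      outer (D := qSU3 θ) 1 ((wPhase lam)⁻¹ • wClass hθ') := by
    ext1 x
    refine Eq.trans ?_ (one_mul _).symm
    exact congrArg ((wPhase lam)⁻¹ • ·) (wFun_smul x.1 x.2)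
  exact ToricDatum.incl_injective _ (quantOn_fst_unique
    (Eq.mp (congrArg (fun k => (_, k) ∈ quantOn _ Set.univ) e) h2) h4)

/-- Take for b the average of δ(p) over SU(3). Averaging is contractive and returns a from 1 ⊗ a,
and b does not depend on a. -/
theorem exists_norm_sub_le {p : (qS5S5 θ' hθ').CAlg} (hp : p ∈ polyS5S5 θ' hθ') :
    ∃ b ∈ StarAlgebra.adjoin ℂ {wElt θ' hθ'},
      ∀ a, ‖b - a‖ ≤ ‖coact hθ' hc p - inr (qSU3 θ) (qS5S5 θ' hθ') a‖ := by
  obtain ⟨f, hf, -, h2⟩ := exists_polynomial_coact hθ' hc hp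
  obtain ⟨B, hB, hBz⟩ := exists_average_of_mem_quantOn (integral_haarSU3_eq_zero θ) h2
  obtain ⟨b, hb, hbq⟩ := exists_quantization hθ' hc (mem_adjoin_wFun
    (orbitAverage_mem_polyFun hθ' hc hf) (orbitAverage_smul hθ' hc f))
  -- The averaged operator and the polynomial in w both quantize the orbit average of f, so they are
  -- equal.
  obtain rfl := quantOn_fst_unique hB (quantOn_mono (Set.subset_univ _) hbq)
  exact ⟨b, hb, norm_sub_le_of_average hBz⟩

theorem mem_coinvariants_coact {a : (qS5S5 θ' hθ').CAlg} :
    a ∈ coinvariants (coact hθ' hc) ↔ coact hθ' hc a = inr (qSU3 θ) (qS5S5 θ' hθ') a := by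
  rw [← tmul_one_left]
  rfl

theorem adjoin_wElt_le_coinvariants :
    StarAlgebra.adjoin ℂ {wElt θ' hθ'} ≤ coinvariants (coact hθ' hc) := by
  refine StarAlgebra.adjoin_le ?_
  rintro _ rfl
  exact (mem_coinvariants_coact hθ' hc).2 (coact_wElt hθ' hc)

theorem coinvariants_inf_polyS5S5 : coinvariants (coact hθ' hc) ⊓ polyS5S5 θ' hθ' =
    StarAlgebra.adjoin ℂ {wElt θ' hθ'} := by
  refine le_antisymm ?_ (le_inf (adjoin_wElt_le_coinvariants hθ' hc) ?_)
  · rintro a ⟨ha, hp⟩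
    obtain ⟨b, hb, hba⟩ := exists_norm_sub_le hθ' hc hp
    -- For a coinvariant polynomial the approximated element may be a itself: the defect is zero, so
    -- b = a.
    have := hba a
    rw [(mem_coinvariants_coact hθ' hc).1 ha, sub_self, norm_zero] at this
    rwa [← sub_eq_zero.1 (norm_le_zero_iff.1 this)]
  · refine StarAlgebra.adjoin_le ?_
    rintro _ rfl
    exact wElt_mem_polyS5S5 hθ'

theorem closure_polyS5S5 : closure (polyS5S5 θ' hθ' : Set (qS5S5 θ' hθ').CAlg) = Set.univ :=
  (coordS5S5 θ' hθ').closure_eq_univ _ fun p => StarAlgebra.subset_adjoin ℂ _ ⟨zIdx p.1 p.2, rfl⟩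

theorem coe_coinvariants_coact :
    (coinvariants (coact hθ' hc) : Set (qS5S5 θ' hθ').CAlg) =
      closure (StarAlgebra.adjoin ℂ {wElt θ' hθ'} : Set (qS5S5 θ' hθ').CAlg) := by
  refine Set.Subset.antisymm (fun a ha => ?_) ?_
  · exact mem_closure_of_forall_exists_norm_sub_le (closure_polyS5S5 hθ')
      (fun p hp => exists_norm_sub_le hθ' hc hp) ((mem_coinvariants_coact hθ' hc).1 ha)
  · have : (coinvariants (coact hθ' hc) : Set (qS5S5 θ' hθ').CAlg) =
        {a | coact hθ' hc a = inr (qSU3 θ) (qS5S5 θ' hθ') a} :=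
      Set.ext fun a => mem_coinvariants_coact hθ' hc
    refine closure_minimal (adjoin_wElt_le_coinvariants hθ' hc) ?_
    rw [this]
    exact isClosed_equalizer _ _

end Coinvariants

/-- Since λ₂ = λ₁ - θ and λ₃ = λ₁ + θ, the upper right block is the weight form plus the constant
λ₁. The diagonal blocks are the weight form itself, and skew symmetry supplies the lower left block.
-/
theorem isCompatible_of_entries {θ lam₁ lam₂ lam₃ : ℝ} {θ' : Matrix (Fin 6) (Fin 6) ℝ}
    (hθ' : θ'ᵀ = -θ') (h12 : θ = -θ' 0 1) (h13 : θ = θ' 0 2) (h23 : θ = -θ' 1 2)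
    (h45 : θ = -θ' 3 4) (h46 : θ = θ' 3 5) (h56 : θ = -θ' 4 5)
    (h14 : lam₁ = θ' 0 3) (h25 : lam₁ = θ' 1 4) (h36 : lam₁ = θ' 2 5)
    (h15 : lam₂ = θ' 0 4) (h26 : lam₂ = θ' 1 5) (h34 : lam₂ = θ' 2 3)
    (h16 : lam₃ = θ' 0 5) (h24 : lam₃ = θ' 1 3) (h35 : lam₃ = θ' 2 4)
    (hlam₁₂ : lam₁ - lam₂ = θ) (hlam₁₃ : -lam₁ + lam₃ = θ) : IsCompatible θ lam₁ θ' := by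
  have hs : ∀ i j, θ' j i = -θ' i j := fun i j => congrFun (congrFun hθ' i) j
  have upper : ∀ s t, θ' (zIdx 0 s) (zIdx 1 t) = wtForm θ s t + lam₁ := fun s t => by
    fin_cases s <;> fin_cases t <;> simp [wtForm] <;> [
      change θ' 0 3 = _; change θ' 0 4 = _; change θ' 0 5 = _;
      change θ' 1 3 = _; change θ' 1 4 = _; change θ' 1 5 = _;
      change θ' 2 3 = _; change θ' 2 4 = _; change θ' 2 5 = _] <;> linarith
  have d : ∀ i, θ' i i = 0 := fun i => by linarith [hs i i]
  have h00 : ∀ s t, θ' (zIdx 0 s) (zIdx 0 t) = wtForm θ s t := fun s t => by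
    fin_cases s <;> fin_cases t <;> simp [wtForm] <;> [
      change θ' 0 0 = _; change θ' 0 1 = _; change θ' 0 2 = _;
      change θ' 1 0 = _; change θ' 1 1 = _; change θ' 1 2 = _;
      change θ' 2 0 = _; change θ' 2 1 = _; change θ' 2 2 = _] <;>
      linarith [hs 0 1, hs 0 2, hs 1 2, d 0, d 1, d 2]
  have h11 : ∀ s t, θ' (zIdx 1 s) (zIdx 1 t) = wtForm θ s t := fun s t => by
    fin_cases s <;> fin_cases t <;> simp [wtForm] <;> [
      change θ' 3 3 = _; change θ' 3 4 = _; change θ' 3 5 = _;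
      change θ' 4 3 = _; change θ' 4 4 = _; change θ' 4 5 = _;
      change θ' 5 3 = _; change θ' 5 4 = _; change θ' 5 5 = _] <;>
      linarith [hs 3 4, hs 3 5, hs 4 5, d 3, d 4, d 5]
  have hw : ∀ s t, wtForm θ s t = -wtForm θ t s := fun s t => by
    fin_cases s <;> fin_cases t <;> simp [wtForm]
  intro a b s t
  fin_cases a <;> fin_cases b
  · simpa using h00 s t
  · simpa using upper s t
  · have := upper t s
    rw [hs, hw] at this
    simp
    linarith
  · simpa using h11 s t

end

end

theorem theorem6p1 (θ lam₁ lam₂ lam₃ : ℝ) (θ' : Matrix (Fin 6) (Fin 6) ℝ) (hθ' : θ'ᵀ = -θ')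
    -- `θ = -θ'₁₂ = θ'₁₃ = -θ'₂₃ = -θ'₄₅ = θ'₄₆ = -θ'₅₆` (indices start at `0` here)
    (h12 : θ = -θ' 0 1) (h13 : θ = θ' 0 2) (h23 : θ = -θ' 1 2)
    (h45 : θ = -θ' 3 4) (h46 : θ = θ' 3 5) (h56 : θ = -θ' 4 5)
    -- `λ₁ = θ'₁₄ = θ'₂₅ = θ'₃₆`, `λ₂ = θ'₁₅ = θ'₂₆ = θ'₃₄`, `λ₃ = θ'₁₆ = θ'₂₄ = θ'₃₅`
    (h14 : lam₁ = θ' 0 3) (h25 : lam₁ = θ' 1 4) (h36 : lam₁ = θ' 2 5)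
    (h15 : lam₂ = θ' 0 4) (h26 : lam₂ = θ' 1 5) (h34 : lam₂ = θ' 2 3)
    (h16 : lam₃ = θ' 0 5) (h24 : lam₃ = θ' 1 3) (h35 : lam₃ = θ' 2 4)
    (hlam₁₂ : lam₁ - lam₂ = θ) (hlam₁₃ : -lam₁ + lam₃ = θ) :
    ∃ (Δ : (qSU3 θ).CAlg →⋆ₐ[ℂ] ((qSU3 θ).prod (qSU3 θ)).CAlg)
      (ε : (qSU3 θ).CAlg →⋆ₐ[ℂ] ℂ)
      (δ : (qS5S5 θ' hθ').CAlg →⋆ₐ[ℂ] ((qSU3 θ).prod (qS5S5 θ' hθ')).CAlg),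
      -- the coproduct and the counit of `C(SU(3)_θ)`
      (∀ i j, Δ (u θ i j) = ∑ k, ToricDatum.tmul (u θ i k) (u θ k j)) ∧
      (∀ i j, ε (u θ i j) = if i = j then 1 else 0) ∧
      -- `δ` extends the diagonal map
      (∀ s : Fin 3, δ (zGen θ' hθ' (Fin.castAdd 3 s)) =
        ∑ k : Fin 3, ToricDatum.tmul (u θ s k) (zGen θ' hθ' (Fin.castAdd 3 k))) ∧
      (∀ s : Fin 3, δ (zGen θ' hθ' (Fin.natAdd 3 s)) =
        ∑ k : Fin 3, ToricDatum.tmul (u θ s k) (zGen θ' hθ' (Fin.natAdd 3 k))) ∧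
      -- `δ` is a coaction, and it restricts to the polynomial algebras
      ToricDatum.IsLeftCoaction Δ ε δ ∧
      (∀ a ∈ polyS5S5 θ' hθ', δ a ∈ Submodule.span ℂ
        {c | ∃ h ∈ polySU3 θ, ∃ b ∈ polyS5S5 θ' hθ', c = ToricDatum.tmul h b}) ∧
      -- the coinvariants in `A((S⁵ × S⁵)_θ')`
      (ToricDatum.coinvariants δ ⊓ polyS5S5 θ' hθ').toSubalgebra =
        Algebra.adjoin ℂ {1, wElt θ' hθ', star (wElt θ' hθ')} ∧
      (ToricDatum.coinvariants δ ⊓ polyS5S5 θ' hθ').toSubalgebra =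
        Algebra.adjoin ℂ {1, wElt' θ' hθ', wElt θ' hθ'} ∧
      -- the coinvariants in `C((S⁵ × S⁵)_θ')`
      (ToricDatum.coinvariants δ : Set (qS5S5 θ' hθ').CAlg) =
        closure (Algebra.adjoin ℂ {1, wElt θ' hθ', star (wElt θ' hθ')} :
          Set (qS5S5 θ' hθ').CAlg) ∧
      (∀ a ∈ ToricDatum.coinvariants δ, ∀ b ∈ ToricDatum.coinvariants δ, a * b = b * a) := by
  have hc := isCompatible_of_entries hθ' h12 h13 h23 h45 h46 h56 h14 h25 h36 h15 h26 h34 h16 h24 h35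
    hlam₁₂ hlam₁₃
  have hinv : (ToricDatum.coinvariants (coact hθ' hc) ⊓ polyS5S5 θ' hθ').toSubalgebra =
      Algebra.adjoin ℂ {1, wElt θ' hθ', star (wElt θ' hθ')} := by
    rw [coinvariants_inf_polyS5S5, adjoin_one_self_star]
  have hclosure : (ToricDatum.coinvariants (coact hθ' hc) : Set (qS5S5 θ' hθ').CAlg) =
      closure (Algebra.adjoin ℂ {1, wElt θ' hθ', star (wElt θ' hθ')} :
        Set (qS5S5 θ' hθ').CAlg) := by
    rw [coe_coinvariants_coact, ← adjoin_one_self_star]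
    rfl
  refine ⟨coprod θ, counit θ, coact hθ' hc, coprod_u θ, counit_u θ, coact_zGen hθ' hc 0,
    coact_zGen hθ' hc 1, isLeftCoaction_coact hθ' hc, fun a ha => coact_mem_span hθ' hc ha, hinv,
    ?_, hclosure, fun a ha b hb => ?_⟩
  · rw [hinv, wElt'_eq hθ' hc, adjoin_one_smul_star _
      (mul_ne_zero (inv_ne_zero (wPhase_ne_zero lam₁)) (inv_ne_zero (wPhase_ne_zero lam₁)))]
  · rw [← SetLike.mem_coe, hclosure] at ha hb
    exact commute_of_mem_closure_adjoin (commute_wElt_star hθ' hc) ha hb
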